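/- Work over $\mathbb{C}$; varieties are irreducible. For a proper surjective morphism $f\colon V\to W$ of varieties and $k\ge 0$ put $W_f^k=\{w\in W : \dim f^{-1}(w)=k\}$ (points meaning closed points). The morphism $f$ is called semi-small if $\dim W_f^k+2k\le \dim V$ for every $k\ge 0$, where $\dim\emptyset=-\infty$. A line bundle $M$ on a nonsingular projective variety $V$ is called lef if there is an integer $n>0$ such that $M^{\otimes n}$ is generated by its global sections and the morphism $\psi_{|M^{\otimes n}|}\colon V\to \mathbb{P}^N$ given by a basis of $H^0(V,M^{\otimes n})$ is semi-small onto its image; the smallest such $n$ is called the exponent $\exp(M)$ of the lef line bundle $M$. Proposition. Let $X$ and $Y$ be nonsingular projective surfaces over $\mathbb{C}$, with projections $p\colon X\times Y\to X$ and $q\colon X\times Y\to Y$. Let $\Gamma$ and $B$ be lef line bundles on $X$ and $Y$ respectively, with $\exp(\Gamma)=\exp(B)=1$. Then $p^*\Gamma\otimes q^*B$ is a lef line bundle on $X\times Y$, and $\exp(p^*\Gamma\otimes q^*B)=1$. -/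

import Mathlib

open CategoryTheory AlgebraicGeometry

namespace Lef

noncomputable section

/-- The base `Spec ℂ`. A complex scheme is a scheme `X` with a morphism `X ⟶ SpecC`. -/
abbrev SpecC : Scheme.{0} := Spec (CommRingCat.of ℂ)

/-! ### Projective space and nonsingular projective varieties -/

/-- The grading of `ℂ[x_i : i ∈ ι]` by degree. -/
abbrev grading (ι : Type) : ℕ → Submodule ℂ (MvPolynomial ι ℂ) :=
  MvPolynomial.homogeneousSubmodule ι ℂ

instance (ι : Type) : GradedAlgebra (grading ι) := MvPolynomial.gradedAlgebra

theorem X_mem_grading {ι : Type} (i : ι) : (MvPolynomial.X i : MvPolynomial ι ℂ) ∈ grading ι 1 :=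
  (MvPolynomial.mem_homogeneousSubmodule 1 _).mpr (MvPolynomial.isHomogeneous_X ℂ i)

/-- The complex projective space with homogeneous coordinates `x_i`, `i ∈ ι`. -/
abbrev ProjSpace (ι : Type) : Scheme.{0} := Proj (grading ι)

/-- The structure morphism of projective space. -/
def ProjSpace.toSpecC (ι : Type) : ProjSpace ι ⟶ SpecC :=
  Proj.toSpecZero (grading ι) ≫ Spec.map (CommRingCat.ofHom (algebraMap ℂ (grading ι 0)))

/-- The standard affine open `D₊(x_i)` of projective space. -/
def ProjSpace.chart {ι : Type} (i : ι) : (ProjSpace ι).Opens :=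
  Proj.basicOpen (grading ι) (MvPolynomial.X i)

/-- The regular function `x_j / x_i` on `D₊(x_i)`. -/
def ProjSpace.ratio {ι : Type} (i j : ι) : Γ(ProjSpace ι, ProjSpace.chart i) :=
  (Proj.awayToSection (grading ι) (MvPolynomial.X i)).hom
    (HomogeneousLocalization.Away.mk (grading ι)
      (X_mem_grading i) 1 (MvPolynomial.X j)
      (by rw [one_smul]; exact X_mem_grading j))

/-- `π : X ⟶ Spec ℂ` makes `X` a nonsingular projective variety: `X` is integral, smooth over
`ℂ`, and isomorphic over `ℂ` to a closed subscheme of some `ℙⁿ`. -/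
structure IsNonsingularProjectiveVariety {X : Scheme.{0}} (π : X ⟶ SpecC) : Prop where
  isIntegral : IsIntegral X
  smooth : Smooth π
  projective : ∃ (n : ℕ) (i : X ⟶ ProjSpace (Fin (n + 1))),
    IsClosedImmersion i ∧ i ≫ ProjSpace.toSpecC (Fin (n + 1)) = π

/-- A nonsingular projective variety of dimension two. -/
structure IsNonsingularProjectiveSurface {X : Scheme.{0}} (π : X ⟶ SpecC) : Prop
    extends IsNonsingularProjectiveVariety π where
  dim_eq : topologicalKrullDim X = 2

/-! ### Semi-small morphisms -/

/-- `Y_f^k`: the set of (closed) points `y` of `Y` with `dim f⁻¹(y) = k`. -/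
def fiberDimLocus {X Y : Scheme.{0}} (f : X ⟶ Y) (k : ℕ) : Set Y :=
  {y | IsClosed {y} ∧ topologicalKrullDim (f ⁻¹' {y}) = k}

/-- A proper surjective morphism `f : X ⟶ Y` is semi-small if `dim Y_f^k + 2k ≤ dim X` for all
`k ≥ 0`, where `dim ∅ = -∞`. -/
structure IsSemiSmall {X Y : Scheme.{0}} (f : X ⟶ Y) : Prop where
  isProper : IsProper f
  surjective : Surjective f
  dim_le : ∀ k : ℕ,
    topologicalKrullDim (fiberDimLocus f k) + ((2 * k : ℕ) : WithBot ℕ∞) ≤ topologicalKrullDim X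

/-! ### Line bundles -/

/-- The structure sheaf as a sheaf of modules over itself. -/
abbrev structureModule (X : Scheme.{0}) : X.Modules := SheafOfModules.unit X.ringCatSheaf

/-- A line bundle: a sheaf of modules which is locally isomorphic to the structure sheaf. -/
def IsLineBundle {X : Scheme.{0}} (M : X.Modules) : Prop :=
  ∀ x : X, ∃ U : X.Opens, x ∈ U ∧ Nonempty (M.restrict U.ι ≅ structureModule U)

/-- The tensor product of sheaves of modules: the sheaf associated with
`U ↦ M(U) ⊗ N(U)`, the tensor product being taken over `𝒪(U)`. -/
def tensor {X : Scheme.{0}} (M N : X.Modules) : X.Modules :=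
  (PresheafOfModules.sheafification (𝟙 X.ringCatSheaf.obj)).obj
    (PresheafOfModules.Monoidal.tensorObj (R := X.sheaf.obj) M.val N.val)

/-- The tensor power `nM = M ⊗ ⋯ ⊗ M`. -/
def tensorPow {X : Scheme.{0}} (M : X.Modules) : ℕ → X.Modules
  | 0 => structureModule X
  | 1 => M
  | n + 2 => tensor (tensorPow M (n + 1)) M

/-- The complex vector space structure on the global sections of `M`. -/
@[reducible]
def sectionsModule {X : Scheme.{0}} (π : X ⟶ SpecC) (M : X.Modules) :
    Module ℂ Γ(M, ⊤) :=
  Module.compHom Γ(M, ⊤)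
    ((π.appTop.hom).comp (Scheme.ΓSpecIso (CommRingCat.of ℂ)).inv.hom)

/-- `H⁰(X, M)` has the family `s` as a basis over `ℂ`. -/
def IsSectionBasis {X : Scheme.{0}} (π : X ⟶ SpecC) (M : X.Modules) {ι : Type}
    (s : ι → Γ(M, ⊤)) : Prop :=
  letI := sectionsModule π M
  ∃ b : Module.Basis ι ℂ Γ(M, ⊤), ⇑b = s

/-- The restriction of a global section to an open set. -/
def restrictSection {X : Scheme.{0}} {M : X.Modules} (s : Γ(M, ⊤)) (U : X.Opens) : Γ(M, U) :=
  (M.presheaf.map (homOfLE (le_top : U ≤ ⊤)).op).hom s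

/-- The set `X_s` where a global section `s` does not vanish: the points with a neighbourhood
over which multiplication by `s` is an isomorphism from the structure sheaf to `M`. For a line
bundle this says that `s(x) ≠ 0` in the fibre of `M` at `x`. -/
def nonvanishingLocus {X : Scheme.{0}} {M : X.Modules} (s : Γ(M, ⊤)) : Set X :=
  {x | ∃ U : X.Opens, x ∈ U ∧ ∀ V : X.Opens, V ≤ U →
    Function.Bijective (fun r : Γ(X, V) => r • restrictSection s V)}

/-- `M` is generated by its global sections. -/
def IsGloballyGenerated {X : Scheme.{0}} (M : X.Modules) : Prop :=
  Nonempty (SheafOfModules.GeneratingSections (R := X.ringCatSheaf) M)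

/-- `ψ` is the morphism `x ↦ [s_i(x)]_i` to projective space over `ℂ` given by the global
sections `s_i` of the line bundle `M`: the preimage of `D₊(x_i)` is the set where `s_i ≠ 0`,
and `ψ` pulls `x_j / x_i` back to `s_j / s_i` there. -/
structure IsMorphismOfSections {X : Scheme.{0}} (π : X ⟶ SpecC) (M : X.Modules) {ι : Type}
    (s : ι → Γ(M, ⊤)) (ψ : X ⟶ ProjSpace ι) : Prop where
  comp_toSpecC : ψ ≫ ProjSpace.toSpecC ι = π
  preimage_chart : ∀ i, ((ψ ⁻¹ᵁ ProjSpace.chart i : X.Opens) : Set X) = nonvanishingLocus (s i)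
  ratio_smul : ∀ i j,
    (ψ.app (ProjSpace.chart i)).hom (ProjSpace.ratio i j) •
        restrictSection (s i) (ψ ⁻¹ᵁ ProjSpace.chart i) =
      restrictSection (s j) (ψ ⁻¹ᵁ ProjSpace.chart i)

/-! ### Lef line bundles -/

/-- The condition on the multiple `nM` in the definition of a lef line bundle: `nM` is generated
by global sections, and the morphism `ψ_{|nM|}` of the complete linear system, written in
coordinates given by a basis of `H⁰(X, nM)`, is semi-small onto its image. For projective `X` the
index type `ι` of such a basis is automatically finite, and another basis changes `ψ` only by a
linear automorphism of the projective space. -/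
def IsLefAt {X : Scheme.{0}} (π : X ⟶ SpecC) (M : X.Modules) (n : ℕ) : Prop :=
  IsGloballyGenerated (tensorPow M n) ∧
  ∃ (ι : Type) (s : ι → Γ(tensorPow M n, ⊤)) (ψ : X ⟶ ProjSpace ι),
    IsSectionBasis π (tensorPow M n) s ∧
    IsMorphismOfSections π (tensorPow M n) s ψ ∧
    IsSemiSmall ψ.toImage

/-- `M` is a lef line bundle. -/
structure IsLef {X : Scheme.{0}} (π : X ⟶ SpecC) (M : X.Modules) : Prop where
  isLineBundle : IsLineBundle M
  exists_isLefAt : ∃ n : ℕ, 0 < n ∧ IsLefAt π M n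

/-- The exponent of a lef line bundle: the smallest `n > 0` with the above property. -/
def lefExponent {X : Scheme.{0}} (π : X ⟶ SpecC) (M : X.Modules) : ℕ :=
  sInf {n : ℕ | 0 < n ∧ IsLefAt π M n}

/-! ### Products -/

/-- The product over `ℂ` of two complex schemes. -/
abbrev prod {X Y : Scheme.{0}} (πX : X ⟶ SpecC) (πY : Y ⟶ SpecC) : Scheme.{0} :=
  Limits.pullback πX πY

/-- The structure morphism of the product. -/
abbrev prodToSpecC {X Y : Scheme.{0}} (πX : X ⟶ SpecC) (πY : Y ⟶ SpecC) :
    prod πX πY ⟶ SpecC :=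
  Limits.pullback.fst πX πY ≫ πX

/-- The external tensor product `p^*M ⊗ q^*N` on `X × Y`, for the projections `p` and `q`. -/
def externalTensor {X Y : Scheme.{0}} (πX : X ⟶ SpecC) (πY : Y ⟶ SpecC)
    (M : X.Modules) (N : Y.Modules) : (prod πX πY).Modules :=
  tensor ((Scheme.Modules.pullback (Limits.pullback.fst πX πY)).obj M)
    ((Scheme.Modules.pullback (Limits.pullback.snd πX πY)).obj N)

end

end Lef

/-! Bases s_i of H⁰(X, Γ) and t_j of H⁰(Y, B) define morphisms φ and χ to projective spaces, each
semi-small onto its image. By the Künneth formula (`bijective_boxMap_top`, `isSectionBasis_boxTop`)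
the sections p^*s_i ⊗ q^*t_j form a basis of H⁰(X × Y, p^*Γ ⊗ q^*B). Their quotients are products of
quotients of the s_i and of the t_j, so the morphism ψ they define is φ × χ followed by the Segre
embedding (`exists_isMorphismOfSections`, `IsSegre`). Near every point some s_i and some t_j are
generators, hence so is their product; this gives both the line bundle property and global
generation.

Semi-smallness of ψ (`IsSegre.isSemiSmall`) rests on what the condition means for a surface: fibres
over closed points of the image have dimension 0 or 1, and only finitely many have dimension 1. The
Segre map is injective on closed points, so a closed fibre of ψ lies in a product of fibres of φ and
χ, and its dimension is at most the sum of theirs. Pick finite sets S in X and T in Y of closed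
points, meeting every one-dimensional fibre. If a fibre of ψ has dimension 1, one of the two factors
has dimension 1, and the fibre contains a point of S × Y ∪ X × T; if it has dimension 2, it contains
a point of S × T. Closed maps do not raise dimension, so the two loci have dimension at most 2 and
0, and dim(X × Y) ≥ 4 is exactly enough: 2 + 2 and 0 + 4. No fibre has dimension 3 or more.

Two devices carry the foundations. Inverse images and tensor products are accessible only through
morphisms out of them, so their local generators are found by the factorization criterion
`isGenerator_of_factor`. Dimensions are measured by chains of specializations of points
(`HasChain`), which restrict to subspaces and lift along closed maps; dimensions of products come
from Noether normalization (`ringKrullDim_tensorProduct`). -/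

namespace Lef
noncomputable section
open Opposite TopologicalSpace

/-! ### Sections of sheaves of modules, generators, and the sheaf j_* j^* M -/

section Basic
variable {X : Scheme.{0}}

/-- The restriction of a section to a smaller open set. -/
def res (M : X.Modules) {U V : X.Opens} (h : V ≤ U) : Γ(M, U) →+ Γ(M, V) :=
  (M.presheaf.map (homOfLE h).op).hom

/-- The restriction of a function to a smaller open set. -/
def resO {U V : X.Opens} (h : V ≤ U) : Γ(X, U) →+* Γ(X, V) :=
  (X.presheaf.map (homOfLE h).op).hom

@[simp]
theorem res_self (M : X.Modules) {U : X.Opens} (h : U ≤ U) (m : Γ(M, U)) : res M h m = m := by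
  simp [res]

@[simp]
theorem res_res (M : X.Modules) {U V W : X.Opens} (h : V ≤ U) (h' : W ≤ V) (m : Γ(M, U)) :
    res M h' (res M h m) = res M (h'.trans h) m := by
  have : (homOfLE (h'.trans h)).op = (homOfLE h).op ≫ (homOfLE h').op := rfl
  simp [res, this]

@[simp]
theorem resO_self {U : X.Opens} (h : U ≤ U) (m : Γ(X, U)) : resO h m = m := by
  simp [resO]

@[simp]
theorem resO_resO {U V W : X.Opens} (h : V ≤ U) (h' : W ≤ V) (m : Γ(X, U)) :
    resO h' (resO h m) = resO (h'.trans h) m := by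
  have : (homOfLE (h'.trans h)).op = (homOfLE h).op ≫ (homOfLE h').op := rfl
  simp [resO, this]

@[simp]
theorem res_smul (M : X.Modules) {U V : X.Opens} (h : V ≤ U) (r : Γ(X, U)) (m : Γ(M, U)) :
    res M h (r • m) = resO h r • res M h m :=
  Scheme.Modules.map_smul M (homOfLE h) r m

theorem restrictSection_eq {M : X.Modules} (s : Γ(M, ⊤)) (U : X.Opens) :
    restrictSection s U = res M le_top s := rfl

theorem app_res {M N : X.Modules} (φ : M ⟶ N) {U V : X.Opens} (h : V ≤ U) (m : Γ(M, U)) :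
    φ.app V (res M h m) = res N h (φ.app U m) :=
  ConcreteCategory.congr_hom (φ.mapPresheaf.naturality (homOfLE h).op) m

/-- A morphism of sheaves of modules given by its values on sections. -/
def mkHom {M N : X.Modules} (φ : ∀ U : X.Opens, Γ(M, U) → Γ(N, U))
    (ha : ∀ U (m n : Γ(M, U)), φ U (m + n) = φ U m + φ U n)
    (hs : ∀ U (r : Γ(X, U)) (m : Γ(M, U)), φ U (r • m) = r • φ U m)
    (hr : ∀ U V (h : V ≤ U) (m : Γ(M, U)), φ V (res M h m) = res N h (φ U m)) : M ⟶ N :=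
  SheafOfModules.Hom.mk
    { app U := ModuleCat.ofHom (X := M.val.obj U) (Y := N.val.obj U)
        { toFun := φ U.unop
          map_add' := ha U.unop
          map_smul' := hs U.unop }
      naturality := fun {U V} f => by
        ext m
        exact hr U.unop V.unop (leOfHom f.unop) m }

@[simp]
theorem mkHom_app {M N : X.Modules} (φ : ∀ U : X.Opens, Γ(M, U) → Γ(N, U)) (ha) (hs) (hr)
    (U : X.Opens) (m : Γ(M, U)) : (mkHom φ ha hs hr).app U m = φ U m := rfl

theorem modules_hom_ext {M N : X.Modules} {f g : M ⟶ N}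
    (h : ∀ U (m : Γ(M, U)), f.app U m = g.app U m) : f = g :=
  Scheme.Modules.hom_ext _ _ fun U => by ext m; exact h U m

/-- Sections which agree on an open cover are equal. -/
theorem section_ext (M : X.Modules) {U : X.Opens} {s t : Γ(M, U)}
    (h : ∀ x ∈ U, ∃ (V : X.Opens) (hV : V ≤ U), x ∈ V ∧ res M hV s = res M hV t) : s = t := by
  choose! V hV hx hst using h
  refine TopCat.Sheaf.eq_of_locally_eq' ⟨M.presheaf, M.isSheaf⟩ (fun x : U => V x.1) U
    (fun x => homOfLE (hV x.1 x.2)) ?_ s t fun x => hst x.1 x.2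
  intro x hxU
  exact Opens.mem_iSup.mpr ⟨⟨x, hxU⟩, hx x hxU⟩

/-- Functions as sections of the structure sheaf seen as a module. -/
def unitSection (U : X.Opens) : Γ(X, U) ≃+ Γ(structureModule X, U) := AddEquiv.refl Γ(X, U)

theorem unitSection_smul {U : X.Opens} (r s : Γ(X, U)) :
    unitSection U (r * s) = r • unitSection U s := rfl

theorem res_unitSection {U V : X.Opens} (h : V ≤ U) (r : Γ(X, U)) :
    res (structureModule X) h (unitSection U r) = unitSection V (resO h r) := rfl

/-- `e` is a generator of `M` over `U`: multiplication by `e` identifies the structure sheaf with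
`M` over `U`. -/
def IsGenerator {M : X.Modules} {U : X.Opens} (e : Γ(M, U)) : Prop :=
  ∀ (V : X.Opens) (h : V ≤ U), Function.Bijective fun r : Γ(X, V) => r • res M h e

theorem IsGenerator.res {M : X.Modules} {U V : X.Opens} {e : Γ(M, U)} (he : IsGenerator e)
    (h : V ≤ U) : IsGenerator (res M h e) := by
  intro W hW
  simpa using he W (hW.trans h)

/-- The coordinate of a section with respect to a generator. -/
def IsGenerator.coord {M : X.Modules} {U : X.Opens} {e : Γ(M, U)} (he : IsGenerator e)
    {V : X.Opens} (h : V ≤ U) : Γ(M, V) →+ Γ(X, V) where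
  toFun m := ((he V h).surjective m).choose
  map_zero' := (he V h).injective (by
    simpa using ((he V h).surjective 0).choose_spec)
  map_add' m n := (he V h).injective (by
    have h1 := ((he V h).surjective m).choose_spec
    have h2 := ((he V h).surjective n).choose_spec
    have h3 := ((he V h).surjective (m + n)).choose_spec
    simp only [add_smul] at h1 h2 h3 ⊢
    rw [h1, h2, h3])

theorem IsGenerator.coord_smul {M : X.Modules} {U : X.Opens} {e : Γ(M, U)} (he : IsGenerator e)
    {V : X.Opens} (h : V ≤ U) (m : Γ(M, V)) : he.coord h m • Lef.res M h e = m :=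
  ((he V h).surjective m).choose_spec

theorem IsGenerator.coord_eq {M : X.Modules} {U : X.Opens} {e : Γ(M, U)} (he : IsGenerator e)
    {V : X.Opens} (h : V ≤ U) {m : Γ(M, V)} {r : Γ(X, V)} (hr : r • Lef.res M h e = m) :
    he.coord h m = r :=
  (he V h).injective ((he.coord_smul h m).trans hr.symm)

theorem IsGenerator.coord_smul' {M : X.Modules} {U : X.Opens} {e : Γ(M, U)} (he : IsGenerator e)
    {V : X.Opens} (h : V ≤ U) (r : Γ(X, V)) (m : Γ(M, V)) :
    he.coord h (r • m) = r * he.coord h m :=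
  he.coord_eq h (by rw [mul_smul, he.coord_smul])

theorem IsGenerator.coord_res {M : X.Modules} {U : X.Opens} {e : Γ(M, U)} (he : IsGenerator e)
    {V W : X.Opens} (h : V ≤ U) (h' : W ≤ V) (m : Γ(M, V)) :
    he.coord (h'.trans h) (Lef.res M h' m) = resO h' (he.coord h m) :=
  he.coord_eq _ (by
    conv_rhs => rw [← he.coord_smul h m]
    simp)

/-- The sheaf `j_* j^* M` for the inclusion `j` of `W`. -/
def loc (W : X.Opens) (M : X.Modules) : X.Modules :=
  (Scheme.Modules.pushforward W.ι).obj (M.restrict W.ι)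

/-- The open set `V ∩ W`. -/
abbrev cut (W V : X.Opens) : X.Opens := W.ι ''ᵁ W.ι ⁻¹ᵁ V

theorem cut_le_left (W V : X.Opens) : cut W V ≤ W := by
  simp [cut, Scheme.Hom.image_preimage_eq_opensRange_inf]

theorem cut_le_right (W V : X.Opens) : cut W V ≤ V := by
  simp [cut, Scheme.Hom.image_preimage_eq_opensRange_inf]

theorem cut_mono (W : X.Opens) {V V' : X.Opens} (h : V' ≤ V) : cut W V' ≤ cut W V := by
  simp only [cut, Scheme.Hom.image_preimage_eq_opensRange_inf]
  exact inf_le_inf_left _ h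

theorem le_cut {W V V' : X.Opens} (h : V' ≤ W) (h' : V' ≤ V) : V' ≤ cut W V := by
  simp [cut, Scheme.Hom.image_preimage_eq_opensRange_inf, h, h']

/-- The sections of `j_* j^* M`. -/
def locSection (W : X.Opens) (M : X.Modules) (V : X.Opens) :
    Γ(M, cut W V) ≃+ Γ(loc W M, V) := AddEquiv.refl Γ(M, cut W V)

theorem locSection_smul (W : X.Opens) (M : X.Modules) (V : X.Opens) (r : Γ(X, V))
    (m : Γ(M, cut W V)) :
    locSection W M V (resO (cut_le_right W V) r • m) = r • locSection W M V m := by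
  have key : (W.ι.appIso (W.ι ⁻¹ᵁ V)).inv (W.ι.app V r) = resO (cut_le_right W V) r := by
    simp
    rfl
  change resO (cut_le_right W V) r • m = (W.ι.appIso (W.ι ⁻¹ᵁ V)).inv (W.ι.app V r) • m
  rw [key]

theorem res_locSection (W : X.Opens) (M : X.Modules) {V V' : X.Opens} (h : V' ≤ V)
    (m : Γ(M, cut W V)) :
    res (loc W M) h (locSection W M V m) = locSection W M V' (res M (cut_mono W h) m) := rfl


/-- The sections of `j_* j^* 𝒪`, as functions. -/
def locUnit (W V : X.Opens) : Γ(X, cut W V) ≃+ Γ(loc W (structureModule X), V) :=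
  (unitSection (cut W V)).trans (locSection W (structureModule X) V)

theorem locUnit_smul (W V : X.Opens) (r : Γ(X, V)) (s : Γ(X, cut W V)) :
    locUnit W V (resO (cut_le_right W V) r * s) = r • locUnit W V s :=
  locSection_smul W (structureModule X) V r (unitSection _ s)

theorem res_locUnit (W : X.Opens) {V V' : X.Opens} (h : V' ≤ V) (s : Γ(X, cut W V)) :
    res (loc W (structureModule X)) h (locUnit W V s) =
      locUnit W V' (resO (cut_mono W h) s) := rfl

/-- Multiplication by a section over `W`, as a morphism to `j_* j^* M`. -/
def mulSection {M : X.Modules} {W : X.Opens} (e : Γ(M, W)) :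
    loc W (structureModule X) ⟶ loc W M :=
  mkHom (fun V x => locSection W M V ((locUnit W V).symm x • res M (cut_le_left W V) e))
    (fun U x y => by rw [map_add, add_smul, map_add])
    (fun U r m => by
      obtain ⟨m, rfl⟩ := (locUnit W U).surjective m
      rw [← locUnit_smul, ← locSection_smul, AddEquiv.symm_apply_apply,
        AddEquiv.symm_apply_apply, mul_smul])
    (fun U V h m => by
      obtain ⟨m, rfl⟩ := (locUnit W U).surjective m
      rw [res_locUnit, res_locSection, AddEquiv.symm_apply_apply, AddEquiv.symm_apply_apply,
        res_smul, res_res])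

theorem mulSection_app {M : X.Modules} {W : X.Opens} (e : Γ(M, W)) (V : X.Opens)
    (r : Γ(X, cut W V)) :
    (mulSection e).app V (locUnit W V r) = locSection W M V (r • res M (cut_le_left W V) e) := by
  rw [mulSection, mkHom_app, AddEquiv.symm_apply_apply]

/-- The canonical morphism to `j_* j^* M`. -/
def toLoc (W : X.Opens) (M : X.Modules) : M ⟶ loc W M :=
  (Scheme.Modules.restrictAdjunction W.ι).unit.app M

theorem toLoc_app (W : X.Opens) (M : X.Modules) (V : X.Opens) (m : Γ(M, V)) :
    (toLoc W M).app V m = locSection W M V (res M (cut_le_right W V) m) := rfl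

/-- A section over `W` is a generator if the canonical morphism to `j_* j^* T` factors through
multiplication by it, via a morphism `lam` taking it to `1`. -/
theorem isGenerator_of_factor {T : X.Modules} {W : X.Opens} (e : Γ(T, W))
    (lam : T ⟶ loc W (structureModule X)) (h1 : lam.app W e = locUnit W W 1)
    (hfac : lam ≫ mulSection e = toLoc W T) : IsGenerator e := by
  intro V hV
  have hcut : V ≤ cut W V := le_cut hV le_rfl
  -- The factorization read on sections: over V ∩ W, t is `lam` of t times e. As V lies in W, this
  -- gives surjectivity; injectivity holds because `lam` takes r • e back to r.
  have key (t : Γ(T, V)) :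
      (locUnit W V).symm (lam.app V t) • res T (cut_le_left W V) e =
        res T (cut_le_right W V) t := by
    have h := congr(($hfac).app V t)
    rw [toLoc_app, Scheme.Modules.Hom.comp_app, ConcreteCategory.comp_apply] at h
    obtain ⟨r, hr⟩ := (locUnit W V).surjective (lam.app V t)
    rw [← hr, mulSection_app] at h
    rw [← hr, AddEquiv.symm_apply_apply]
    exact (locSection W T V).injective h
  constructor
  · intro r r' h
    have hl (r : Γ(X, V)) : lam.app V (r • res T hV e) =
        locUnit W V (resO (cut_le_right W V) r) := by
      rw [Scheme.Modules.Hom.app_smul, app_res, h1, res_locUnit, map_one, ← locUnit_smul, mul_one]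
    have h2 : resO (cut_le_right W V) r = resO (cut_le_right W V) r' := by
      apply (locUnit W V).injective
      rw [← hl, ← hl]
      exact congrArg _ h
    simpa using congrArg (resO hcut) h2
  · intro t
    refine ⟨resO hcut ((locUnit W V).symm (lam.app V t)), ?_⟩
    have := congrArg (res T hcut) (key t)
    simpa using this

end Basic

/-! ### Inverse images and pulled back sections -/

section Pullback
variable {Z X : Scheme.{0}} (f : Z ⟶ X)

/-- The direct image of a sheaf of modules. -/
def push (N : Z.Modules) : X.Modules := (Scheme.Modules.pushforward f).obj N

/-- The inverse image of a sheaf of modules. -/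
def pull (M : X.Modules) : Z.Modules := (Scheme.Modules.pullback f).obj M

/-- The unit of the adjunction between direct and inverse image. -/
def pullUnit (M : X.Modules) : M ⟶ push f (pull f M) :=
  (Scheme.Modules.pullbackPushforwardAdjunction f).unit.app M

/-- The sections of a direct image. -/
def pushSection (N : Z.Modules) (U : X.Opens) : Γ(N, f ⁻¹ᵁ U) ≃+ Γ(push f N, U) :=
  AddEquiv.refl Γ(N, f ⁻¹ᵁ U)

/-- The pullback of a section. -/
def pullSection {M : X.Modules} (U : X.Opens) (m : Γ(M, U)) : Γ(pull f M, f ⁻¹ᵁ U) :=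
  (pushSection f (pull f M) U).symm ((pullUnit f M).app U m)

theorem preimage_mono {U V : X.Opens} (h : V ≤ U) : f ⁻¹ᵁ V ≤ f ⁻¹ᵁ U := fun _ hx => h hx

/-- The pullback of functions. -/
def pullO (U : X.Opens) : Γ(X, U) →+* Γ(Z, f ⁻¹ᵁ U) := (f.app U).hom

theorem resO_pullO {U V : X.Opens} (h : V ≤ U) (r : Γ(X, U)) :
    resO (preimage_mono f h) (pullO f U r) = pullO f V (resO h r) :=
  (ConcreteCategory.congr_hom (f.naturality (homOfLE h).op) r).symm

theorem pushSection_smul (N : Z.Modules) (U : X.Opens) (r : Γ(X, U)) (n : Γ(N, f ⁻¹ᵁ U)) :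
    pushSection f N U (pullO f U r • n) = r • pushSection f N U n := rfl

theorem res_pushSection (N : Z.Modules) {U V : X.Opens} (h : V ≤ U) (n : Γ(N, f ⁻¹ᵁ U)) :
    res (push f N) h (pushSection f N U n) = pushSection f N V (res N (preimage_mono f h) n) := rfl

theorem pullSection_add {M : X.Modules} {U : X.Opens} (m n : Γ(M, U)) :
    pullSection f U (m + n) = pullSection f U m + pullSection f U n := by
  rw [pullSection, map_add, map_add]; rfl

theorem pullSection_smul {M : X.Modules} {U : X.Opens} (r : Γ(X, U)) (m : Γ(M, U)) :
    pullSection f U (r • m) = pullO f U r • pullSection f U m := by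
  apply (pushSection f (pull f M) U).injective
  rw [pushSection_smul, pullSection, pullSection, AddEquiv.apply_symm_apply,
    AddEquiv.apply_symm_apply, Scheme.Modules.Hom.app_smul]

theorem res_pullSection {M : X.Modules} {U V : X.Opens} (h : V ≤ U) (m : Γ(M, U)) :
    res _ (preimage_mono f h) (pullSection f U m) = pullSection f V (res M h m) := by
  apply (pushSection f (pull f M) V).injective
  rw [← res_pushSection, pullSection, pullSection, AddEquiv.apply_symm_apply,
    AddEquiv.apply_symm_apply, app_res]

/-- Morphisms out of an inverse image are determined by their values on pulled back sections. -/
theorem pull_hom_ext {M : X.Modules} {N : Z.Modules} {g h : pull f M ⟶ N}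
    (H : ∀ (U : X.Opens) (m : Γ(M, U)),
      g.app (f ⁻¹ᵁ U) (pullSection f U m) = h.app (f ⁻¹ᵁ U) (pullSection f U m)) :
    g = h := by
  refine ((Scheme.Modules.pullbackPushforwardAdjunction f).homEquiv M N).injective ?_
  refine ((Adjunction.homEquiv_unit _ _ _ _).trans ?_).trans
    (Adjunction.homEquiv_unit _ _ _ _).symm
  exact modules_hom_ext fun U m => H U m

theorem exists_pull_desc {M : X.Modules} {N : Z.Modules} (g : M ⟶ push f N) :
    ∃ h : pull f M ⟶ N, ∀ (U : X.Opens) (m : Γ(M, U)),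
      h.app (f ⁻¹ᵁ U) (pullSection f U m) = (pushSection f N U).symm (g.app U m) := by
  obtain ⟨h, rfl⟩ := ((Scheme.Modules.pullbackPushforwardAdjunction f).homEquiv M N).surjective g
  refine ⟨h, fun U m => ?_⟩
  rw [Adjunction.homEquiv_unit]
  rfl

theorem mem_cut {W V : X.Opens} {x : X} : x ∈ cut W V ↔ x ∈ W ∧ x ∈ V := by
  simp [cut, Scheme.Hom.image_preimage_eq_opensRange_inf]

theorem cut_preimage_le (U V : X.Opens) : cut (f ⁻¹ᵁ U) (f ⁻¹ᵁ V) ≤ f ⁻¹ᵁ cut U V := by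
  intro x hx
  exact mem_cut.mpr (mem_cut (X := Z) |>.mp hx)

/-- The criterion `isGenerator_of_factor` applies, with `lam` adjoint to the morphism which takes
the coordinate of a section with respect to e and pulls that function back. Both conditions need
checking only on pulled back sections. -/
theorem IsGenerator.pullSection {M : X.Modules} {U : X.Opens} {e : Γ(M, U)}
    (he : IsGenerator e) : IsGenerator (pullSection f U e) := by
  let c (V : X.Opens) (m : Γ(M, V)) : Γ(X, cut U V) :=
    he.coord (cut_le_left U V) (Lef.res M (cut_le_right U V) m)
  have hc (V : X.Opens) (m : Γ(M, V)) :
      c V m • Lef.res M (cut_le_left U V) e = Lef.res M (cut_le_right U V) m :=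
    he.coord_smul _ _
  let g : M ⟶ push f (loc (f ⁻¹ᵁ U) (structureModule Z)) :=
    mkHom
      (fun V m => pushSection f _ V (locUnit (f ⁻¹ᵁ U) (f ⁻¹ᵁ V)
        (resO (cut_preimage_le f U V) (pullO f (cut U V) (c V m)))))
      (fun V x y => by simp only [c, map_add])
      (fun V r m => by
        simp only [c]
        rw [← pushSection_smul, res_smul, IsGenerator.coord_smul', map_mul, map_mul,
          ← resO_pullO f (cut_le_right U V), resO_resO, ← locUnit_smul])
      (fun V V' h m => by
        simp only [c]
        rw [res_pushSection, res_locUnit, resO_resO,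
          ← resO_resO (preimage_mono f (cut_mono U h)) (cut_preimage_le f U V'),
          resO_pullO f (cut_mono U h), ← he.coord_res _ (cut_mono U h), res_res, res_res])
  obtain ⟨lam, hlam⟩ := exists_pull_desc f g
  refine isGenerator_of_factor _ lam ?_ ?_
  · rw [hlam, mkHom_app, AddEquiv.symm_apply_apply]
    have : c U e = 1 := he.coord_eq _ (by simp)
    rw [this, map_one, map_one]
  · refine pull_hom_ext f fun V m => ?_
    rw [Scheme.Modules.Hom.comp_app, ConcreteCategory.comp_apply, hlam, toLoc_app, mkHom_app,
      AddEquiv.symm_apply_apply, mulSection_app]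
    congr 1
    rw [← res_res _ (preimage_mono f (cut_le_right U V)) (cut_preimage_le f U V),
      res_pullSection f (cut_le_right U V), ← hc, pullSection_smul, res_smul,
      ← res_pullSection f (cut_le_left U V), res_res]

end Pullback

end
end Lef

namespace Lef
noncomputable section
open Opposite TopologicalSpace TensorProduct
-- Tensor products of sheaves of modules
section Tensor
variable {X : Scheme.{0}}

/-- The presheaf tensor product. -/
abbrev preTensor (M N : X.Modules) : X.PresheafOfModules :=
  PresheafOfModules.Monoidal.tensorObj (R := X.sheaf.obj) M.val N.val

/-- The canonical map from the presheaf tensor product. -/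
def toTensor (M N : X.Modules) : preTensor M N ⟶
   (PresheafOfModules.restrictScalars (𝟙 X.ringCatSheaf.obj)).obj (tensor M N).val :=
  (PresheafOfModules.sheafificationAdjunction (𝟙 X.ringCatSheaf.obj)).unit.app (preTensor M N)

def pureTensor {M N : X.Modules} {U : X.Opens} (m : Γ(M, U)) (n : Γ(N, U)) :
   (preTensor M N).obj (op U) :=
  (m ⊗ₜ[Γ(X, U)] n : Γ(M, U) ⊗[Γ(X, U)] Γ(N, U))

theorem pureTensor_ext {M N : X.Modules} {U : X.Opens} {A : Type} [AddCommGroup A]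
    {g h : (preTensor M N).obj (op U) → A} (hg : ∀ x y, g (x + y) = g x + g y)
    (hh : ∀ x y, h (x + y) = h x + h y)
    (H : ∀ m n, g (pureTensor m n) = h (pureTensor m n)) (t : (preTensor M N).obj (op U)) :
    g t = h t := by
  change Γ(M, U) ⊗[Γ(X, U)] Γ(N, U) at t
  induction t using TensorProduct.induction_on with
  | zero => exact (map_zero (AddMonoidHom.mk' g hg)).trans (map_zero (AddMonoidHom.mk' h hh)).symm
  | tmul m n => exact H m n
  | add x y hx hy => exact (hg x y).trans ((congrArg₂ (· + ·) hx hy).trans (hh x y).symm)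

/-- The section `m ⊗ n`. -/
def tmul {M N : X.Modules} {U : X.Opens} (m : Γ(M, U)) (n : Γ(N, U)) : Γ(tensor M N, U) :=
  (toTensor M N).app (op U) (pureTensor m n)

theorem tmul_add {M N : X.Modules} {U : X.Opens} (m : Γ(M, U)) (n n' : Γ(N, U)) :
    tmul m (n + n') = tmul m n + tmul m n' := by
  have : pureTensor m (n + n') = pureTensor m n + pureTensor m n' :=
    TensorProduct.tmul_add (R := Γ(X, U)) (M := Γ(M, U)) (N := Γ(N, U)) m n n'
  rw [tmul, this]
  exact map_add ((toTensor M N).app (op U)).hom _ _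

theorem add_tmul {M N : X.Modules} {U : X.Opens} (m m' : Γ(M, U)) (n : Γ(N, U)) :
    tmul (m + m') n = tmul m n + tmul m' n := by
  have : pureTensor (m + m') n = pureTensor m n + pureTensor m' n :=
    TensorProduct.add_tmul (R := Γ(X, U)) (M := Γ(M, U)) (N := Γ(N, U)) m m' n
  rw [tmul, this]
  exact map_add ((toTensor M N).app (op U)).hom _ _

theorem smul_tmul {M N : X.Modules} {U : X.Opens} (r : Γ(X, U)) (m : Γ(M, U)) (n : Γ(N, U)) :
    tmul (r • m) n = r • tmul m n :=
  ((toTensor M N).app (op U)).hom.map_smul (r : X.ringCatSheaf.obj.obj (op U)) (pureTensor m n)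

theorem tmul_smul {M N : X.Modules} {U : X.Opens} (r : Γ(X, U)) (m : Γ(M, U)) (n : Γ(N, U)) :
    tmul m (r • n) = r • tmul m n := by
  rw [← smul_tmul]
  have : pureTensor m (r • n) = pureTensor (r • m) n :=
    (TensorProduct.smul_tmul (R := Γ(X, U)) (M := Γ(M, U)) (N := Γ(N, U)) r m n).symm
  rw [tmul, this, tmul]

theorem res_tmul {M N : X.Modules} {U V : X.Opens} (h : V ≤ U) (m : Γ(M, U)) (n : Γ(N, U)) :
    res _ h (tmul m n) = tmul (res M h m) (res N h n) :=
  (PresheafOfModules.naturality_apply (toTensor M N) (homOfLE h).op (pureTensor m n)).symm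

/-- Morphisms out of a tensor product are determined by their values on pure tensors. -/
theorem tensor_hom_ext {M N P : X.Modules} {g h : tensor M N ⟶ P}
    (H : ∀ (U : X.Opens) (m : Γ(M, U)) (n : Γ(N, U)),
      g.app U (tmul m n) = h.app U (tmul m n)) : g = h := by
  refine ((PresheafOfModules.sheafificationAdjunction (𝟙 X.ringCatSheaf.obj)).homEquiv
    (preTensor M N) P).injective ?_
  refine ((Adjunction.homEquiv_unit _ _ _ _).trans ?_).trans
    (Adjunction.homEquiv_unit _ _ _ _).symm
  refine PresheafOfModules.hom_ext fun U => ?_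
  refine ModuleCat.hom_ext (LinearMap.ext fun t => ?_)
  exact pureTensor_ext (A := Γ(P, U.unop)) (U := U.unop) (map_add (ModuleCat.Hom.hom _))
    (map_add (ModuleCat.Hom.hom _)) (fun m n => H U.unop m n) t

/-- Compatible bilinear maps give a morphism from the presheaf tensor product; since the target is a
sheaf, the sheafification adjunction extends it. -/
theorem exists_tensor_desc {M N P : X.Modules}
    (b : ∀ U : X.Opens, Γ(M, U) →ₗ[Γ(X, U)] Γ(N, U) →ₗ[Γ(X, U)] Γ(P, U))
    (hb : ∀ (U V : X.Opens) (h : V ≤ U) (m : Γ(M, U)) (n : Γ(N, U)),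
      b V (res M h m) (res N h n) = res P h (b U m n)) :
    ∃ g : tensor M N ⟶ P, ∀ (U : X.Opens) (m : Γ(M, U)) (n : Γ(N, U)),
      g.app U (tmul m n) = b U m n := by
  let k : preTensor M N ⟶
      (PresheafOfModules.restrictScalars (𝟙 X.ringCatSheaf.obj)).obj P.val :=
    { app U := ModuleCat.ofHom (R := Γ(X, U.unop)) (X := Γ(M, U.unop) ⊗[Γ(X, U.unop)] Γ(N, U.unop))
        (Y := Γ(P, U.unop)) (TensorProduct.lift (b U.unop))
      naturality := fun {U V} f => by
        refine ModuleCat.hom_ext (LinearMap.ext fun t => ?_)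
        exact pureTensor_ext (A := Γ(P, V.unop)) (U := U.unop) (map_add (ModuleCat.Hom.hom _))
          (map_add (ModuleCat.Hom.hom _))
          (fun m n => hb U.unop V.unop (leOfHom f.unop) m n) t }
  obtain ⟨g, hg⟩ := ((PresheafOfModules.sheafificationAdjunction (𝟙 X.ringCatSheaf.obj)).homEquiv
    (preTensor M N) P).surjective k
  refine ⟨g, fun U m n => ?_⟩
  have := congr(($hg).app (op U) (pureTensor m n))
  exact this

/-- Again by `isGenerator_of_factor`: `lam` sends m ⊗ n to the product of the coordinates of m and
n, and the conditions are checked on pure tensors. -/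
theorem IsGenerator.tmul {M N : X.Modules} {U : X.Opens} {e : Γ(M, U)} {f : Γ(N, U)}
    (he : IsGenerator e) (hf : IsGenerator f) : IsGenerator (tmul e f) := by
  let c (V : X.Opens) (m : Γ(M, V)) : Γ(X, cut U V) :=
    he.coord (cut_le_left U V) (Lef.res M (cut_le_right U V) m)
  let d (V : X.Opens) (n : Γ(N, V)) : Γ(X, cut U V) :=
    hf.coord (cut_le_left U V) (Lef.res N (cut_le_right U V) n)
  have hc (V : X.Opens) (m : Γ(M, V)) :
      c V m • Lef.res M (cut_le_left U V) e = Lef.res M (cut_le_right U V) m :=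
    he.coord_smul _ _
  have hd (V : X.Opens) (n : Γ(N, V)) :
      d V n • Lef.res N (cut_le_left U V) f = Lef.res N (cut_le_right U V) n :=
    hf.coord_smul _ _
  have cs (V : X.Opens) (r : Γ(X, V)) (m : Γ(M, V)) :
      c V (r • m) = resO (cut_le_right U V) r * c V m := by
    simp only [c, res_smul, IsGenerator.coord_smul']
  have ds (V : X.Opens) (r : Γ(X, V)) (m : Γ(N, V)) :
      d V (r • m) = resO (cut_le_right U V) r * d V m := by
    simp only [d, res_smul, IsGenerator.coord_smul']
  let b (V : X.Opens) : Γ(M, V) →ₗ[Γ(X, V)] Γ(N, V) →ₗ[Γ(X, V)]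
      Γ(loc U (structureModule X), V) :=
    LinearMap.mk₂ _ (fun m n => locUnit U V (c V m * d V n))
      (fun m m' n => by simp only [c, map_add, add_mul])
      (fun r m n => by rw [cs, mul_assoc, locUnit_smul])
      (fun m n n' => by simp only [d, map_add, mul_add])
      (fun r m n => by rw [ds, mul_left_comm, locUnit_smul])
  obtain ⟨lam, hlam⟩ := exists_tensor_desc b (fun V V' h m n => by
    simp only [b, LinearMap.mk₂_apply, c, d]
    rw [res_locUnit, map_mul (resO (cut_mono U h)), ← he.coord_res _ (cut_mono U h), ← hf.coord_res _ (cut_mono U h)]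
    simp only [res_res])
  refine isGenerator_of_factor _ lam ?_ ?_
  · have h1 : c U e = 1 := he.coord_eq _ (by simp)
    have h2 : d U f = 1 := hf.coord_eq _ (by simp)
    rw [hlam, LinearMap.mk₂_apply, h1, h2, mul_one]
  · refine tensor_hom_ext fun V m n => ?_
    rw [Scheme.Modules.Hom.comp_app, ConcreteCategory.comp_apply, hlam, toLoc_app,
      LinearMap.mk₂_apply, mulSection_app, res_tmul, res_tmul, ← hc, ← hd, smul_tmul, tmul_smul,
      mul_smul]
end Tensor

/-! ### Local generators and line bundles -/

section LineBundle
variable {X : Scheme.{0}}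

/-- A sheaf of modules with local generators is a line bundle. -/
theorem isLineBundle_of_isGenerator {M : X.Modules}
    (h : ∀ x : X, ∃ (U : X.Opens) (e : Γ(M, U)), x ∈ U ∧ IsGenerator e) : IsLineBundle M := by
  intro x
  obtain ⟨U, e, hx, he⟩ := h x
  have hle (V : U.toScheme.Opens) : U.ι ''ᵁ V ≤ U := by
    simpa using U.ι.image_le_opensRange V
  refine ⟨U, hx, ⟨?_⟩⟩
  let σ (V : U.toScheme.Opens) : Γ(M, U.ι ''ᵁ V) ≃+ Γ(M.restrict U.ι, V) :=
    AddEquiv.refl Γ(M, U.ι ''ᵁ V)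
  have σ_smul (V : U.toScheme.Opens) (r : Γ(U, V)) (m : Γ(M, U.ι ''ᵁ V)) :
      σ V ((U.ι.appIso V).inv r • m) = r • σ V m := rfl
  let φ : structureModule U.toScheme ⟶ M.restrict U.ι :=
    mkHom (fun V r => σ V ((U.ι.appIso V).inv ((unitSection V).symm r) • res M (hle V) e))
      (fun V r s => by rw [map_add, map_add, add_smul, map_add])
      (fun V r s => by
        obtain ⟨s, rfl⟩ := (unitSection V).surjective s
        rw [← unitSection_smul, AddEquiv.symm_apply_apply, AddEquiv.symm_apply_apply, map_mul,
          mul_smul, σ_smul])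
      (fun V V' h r => by
        obtain ⟨s, rfl⟩ := (unitSection V).surjective r
        rw [res_unitSection, AddEquiv.symm_apply_apply, AddEquiv.symm_apply_apply]
        have h' : U.ι ''ᵁ V' ≤ U.ι ''ᵁ V := U.ι.image_mono h
        change _ = σ V' (res M h' ((U.ι.appIso V).inv s • res M (hle V) e))
        rw [res_smul, res_res]
        congr 2
        simp [resO]
        rfl)
  have : IsIso φ := by
    rw [Scheme.Modules.Hom.isIso_iff_isIso_app]
    intro V
    rw [ConcreteCategory.isIso_iff_bijective]
    have h1 : Function.Bijective (U.ι.appIso V).inv :=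
      (ConcreteCategory.isIso_iff_bijective _).mp inferInstance
    exact ((σ V).bijective.comp ((he _ (hle V)).comp h1)).comp (unitSection V).symm.bijective
  exact (asIso φ).symm

end LineBundle
end
end Lef

namespace Lef
noncomputable section
open Opposite TopologicalSpace TensorProduct

/-! ### Complex vector spaces of sections and external products of sections -/

section Scalars
variable {X : Scheme.{0}} (π : X ⟶ SpecC)

/-- Constant functions. -/
def scal (U : X.Opens) : ℂ →+* Γ(X, U) :=
  (resO le_top).comp ((π.appTop.hom).comp (Scheme.ΓSpecIso (CommRingCat.of ℂ)).inv.hom)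

@[simp]
theorem resO_scal {U V : X.Opens} (h : V ≤ U) (c : ℂ) : resO h (scal π U c) = scal π V c := by
  simp only [scal, RingHom.comp_apply, resO_resO]

theorem pullO_scal {Z : Scheme.{0}} (f : Z ⟶ X) (U : X.Opens) (c : ℂ) :
    pullO f U (scal π U c) = scal (f ≫ π) (f ⁻¹ᵁ U) c := by
  simp only [scal, RingHom.comp_apply]
  rw [← resO_pullO f le_top]
  simp only [pullO, Scheme.Hom.comp_appTop, CommRingCat.hom_comp, RingHom.comp_apply]
  rfl

/-- The sections of a sheaf of modules as a complex vector space. -/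
def Sec (_ : X ⟶ SpecC) (M : X.Modules) (U : X.Opens) : Type := Γ(M, U)

instance (M : X.Modules) (U : X.Opens) : AddCommGroup (Sec π M U) :=
  inferInstanceAs (AddCommGroup Γ(M, U))

instance (M : X.Modules) (U : X.Opens) : Module ℂ (Sec π M U) :=
  Module.compHom Γ(M, U) (scal π U)

/-- Sections as elements of the complex vector space of sections. -/
def sec (M : X.Modules) (U : X.Opens) : Γ(M, U) ≃+ Sec π M U := AddEquiv.refl Γ(M, U)

theorem sec_smul {M : X.Modules} {U : X.Opens} (c : ℂ) (m : Γ(M, U)) :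
    sec π M U (scal π U c • m) = c • sec π M U m := rfl

theorem sec_symm_smul {M : X.Modules} {U : X.Opens} (c : ℂ) (m : Sec π M U) :
    (sec π M U).symm (c • m) = scal π U c • (sec π M U).symm m := rfl

end Scalars

section Box
variable {X Y : Scheme.{0}} (πX : X ⟶ SpecC) (πY : Y ⟶ SpecC)

/-- The projection to the first factor. -/
abbrev fst : prod πX πY ⟶ X := Limits.pullback.fst πX πY

/-- The projection to the second factor. -/
abbrev snd : prod πX πY ⟶ Y := Limits.pullback.snd πX πY

/-- The open set `U × V`. -/
def rect (U : X.Opens) (V : Y.Opens) : (prod πX πY).Opens :=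
  fst πX πY ⁻¹ᵁ U ⊓ snd πX πY ⁻¹ᵁ V

theorem rect_le_fst (U : X.Opens) (V : Y.Opens) : rect πX πY U V ≤ fst πX πY ⁻¹ᵁ U := inf_le_left

theorem rect_le_snd (U : X.Opens) (V : Y.Opens) : rect πX πY U V ≤ snd πX πY ⁻¹ᵁ V := inf_le_right

theorem rect_mono {U U' : X.Opens} {V V' : Y.Opens} (h : U' ≤ U) (h' : V' ≤ V) :
    rect πX πY U' V' ≤ rect πX πY U V := fun _ hz => ⟨h hz.1, h' hz.2⟩

/-- The pullback of functions from the first factor. -/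
def pullFst {U : X.Opens} (V : Y.Opens) : Γ(X, U) →+* Γ(prod πX πY, rect πX πY U V) :=
  (resO (rect_le_fst πX πY U V)).comp (pullO (fst πX πY) U)

/-- The pullback of functions from the second factor. -/
def pullSnd (U : X.Opens) {V : Y.Opens} : Γ(Y, V) →+* Γ(prod πX πY, rect πX πY U V) :=
  (resO (rect_le_snd πX πY U V)).comp (pullO (snd πX πY) V)

theorem pullFst_scal {U : X.Opens} (V : Y.Opens) (c : ℂ) :
    pullFst πX πY V (scal πX U c) = scal (prodToSpecC πX πY) (rect πX πY U V) c := by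
  rw [pullFst, RingHom.comp_apply, pullO_scal, resO_scal]

theorem pullSnd_scal (U : X.Opens) {V : Y.Opens} (c : ℂ) :
    pullSnd πX πY U (scal πY V c) = scal (prodToSpecC πX πY) (rect πX πY U V) c := by
  rw [pullSnd, RingHom.comp_apply, pullO_scal, resO_scal, ← Limits.pullback.condition]

theorem resO_pullFst {U U' : X.Opens} {V V' : Y.Opens} (h : U' ≤ U) (h' : V' ≤ V) (r : Γ(X, U)) :
    resO (rect_mono πX πY h h') (pullFst πX πY V r) = pullFst πX πY V' (resO h r) := by
  simp only [pullFst, RingHom.comp_apply, ← resO_pullO (fst πX πY) h, resO_resO]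

theorem resO_pullSnd {U U' : X.Opens} {V V' : Y.Opens} (h : U' ≤ U) (h' : V' ≤ V) (r : Γ(Y, V)) :
    resO (rect_mono πX πY h h') (pullSnd πX πY U r) = pullSnd πX πY U' (resO h' r) := by
  simp only [pullSnd, RingHom.comp_apply, ← resO_pullO (snd πX πY) h', resO_resO]

variable (M : X.Modules) (N : Y.Modules)

/-- The external tensor product. -/
def ext : (prod πX πY).Modules := tensor (pull (fst πX πY) M) (pull (snd πX πY) N)

variable {M N}

/-- The section `p^*m ⊗ q^*n` of the external tensor product. -/
def box {U : X.Opens} {V : Y.Opens} (m : Γ(M, U)) (n : Γ(N, V)) :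
    Γ(ext πX πY M N, rect πX πY U V) :=
  tmul (res _ (rect_le_fst πX πY U V) (pullSection (fst πX πY) U m))
    (res _ (rect_le_snd πX πY U V) (pullSection (snd πX πY) V n))

theorem add_box {U : X.Opens} {V : Y.Opens} (m m' : Γ(M, U)) (n : Γ(N, V)) :
    box πX πY (m + m') n = box πX πY m n + box πX πY m' n := by
  rw [box, pullSection_add, map_add, add_tmul]; rfl

theorem box_add {U : X.Opens} {V : Y.Opens} (m : Γ(M, U)) (n n' : Γ(N, V)) :
    box πX πY m (n + n') = box πX πY m n + box πX πY m n' := by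
  rw [box, pullSection_add, map_add, tmul_add]; rfl

theorem smul_box {U : X.Opens} {V : Y.Opens} (r : Γ(X, U)) (m : Γ(M, U)) (n : Γ(N, V)) :
    box πX πY (r • m) n = pullFst πX πY V r • box πX πY m n := by
  rw [box, pullSection_smul, res_smul, smul_tmul]; rfl

theorem box_smul {U : X.Opens} {V : Y.Opens} (r : Γ(Y, V)) (m : Γ(M, U)) (n : Γ(N, V)) :
    box πX πY m (r • n) = pullSnd πX πY U r • box πX πY m n := by
  rw [box, pullSection_smul, res_smul, tmul_smul]; rfl

theorem res_box {U U' : X.Opens} {V V' : Y.Opens} (h : U' ≤ U) (h' : V' ≤ V) (m : Γ(M, U))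
    (n : Γ(N, V)) :
    res _ (rect_mono πX πY h h') (box πX πY m n) = box πX πY (res M h m) (res N h' n) := by
  refine (res_tmul _ _ _).trans ?_
  rw [res_res, res_res, box, ← res_pullSection (fst πX πY) h,
    ← res_pullSection (snd πX πY) h', res_res, res_res]

theorem IsGenerator.box {U : X.Opens} {V : Y.Opens} {e : Γ(M, U)} {f : Γ(N, V)}
    (he : IsGenerator e) (hf : IsGenerator f) : IsGenerator (box πX πY e f) :=
  ((he.pullSection _).res _).tmul ((hf.pullSection _).res _)

/-- The canonical map from the tensor product of spaces of sections. -/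
def boxMap (M : X.Modules) (N : Y.Modules) (U : X.Opens) (V : Y.Opens) :
    Sec πX M U ⊗[ℂ] Sec πY N V →ₗ[ℂ]
      Sec (prodToSpecC πX πY) (ext πX πY M N) (rect πX πY U V) :=
  TensorProduct.lift (LinearMap.mk₂ ℂ
    (fun m n => sec _ _ _ (box πX πY ((sec πX M U).symm m) ((sec πY N V).symm n)))
    (fun m m' n => by rw [map_add, add_box, map_add])
    (fun c m n => by rw [sec_symm_smul, smul_box, pullFst_scal, sec_smul])
    (fun m n n' => by rw [map_add, box_add, map_add])
    (fun c m n => by rw [sec_symm_smul, box_smul, pullSnd_scal, sec_smul]))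

end Box

/-! ### The Künneth formula -/

section Affine
variable {X Y : Scheme.{0}} (πX : X ⟶ SpecC) (πY : Y ⟶ SpecC)

/-- The algebra structure on functions. -/
abbrev algO (U : X.Opens) : Algebra ℂ Γ(X, U) := (scal πX U).toAlgebra

/-- The functions on a fibre product of affine opens over an affine base form a pushout of rings,
and so does the tensor product. -/
theorem exists_kunneth_affine {U : X.Opens} {V : Y.Opens} (hU : IsAffineOpen U)
    (hV : IsAffineOpen V) :
    letI := algO πX U
    letI := algO πY V
    ∃ e : Γ(X, U) ⊗[ℂ] Γ(Y, V) ≃+* Γ(prod πX πY, rect πX πY U V),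
      ∀ a b, e (a ⊗ₜ b) = pullFst πX πY V a * pullSnd πX πY U b := by
  let _ := algO πX U
  let _ := algO πY V
  have h1 := (isIso_pushoutSection_iff (.of_hasPullback πX πY) (US := ⊤) (UT := V) (UX := U)
    le_top le_top rfl).mp (isIso_pushoutSection_of_isAffineOpen _ _ _ _
      (isAffineOpen_top _) hV hU)
  have h2 := CommRingCat.isPushout_tensorProduct ℂ Γ(X, U) Γ(Y, V)
  have h3 := h1.of_iso (Scheme.ΓSpecIso (CommRingCat.of ℂ)) (Iso.refl _) (Iso.refl _) (Iso.refl _)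
    (f' := CommRingCat.ofHom (algebraMap ℂ Γ(X, U))) (g' := CommRingCat.ofHom (algebraMap ℂ Γ(Y, V)))
    (inl' := CommRingCat.ofHom (pullFst πX πY V)) (inr' := CommRingCat.ofHom (pullSnd πX πY U))
    ((Iso.inv_comp_eq _).mp rfl)
    ((Iso.inv_comp_eq _).mp rfl)
    rfl rfl
  refine ⟨(h2.isoIsPushout _ _ h3).commRingCatIsoToRingEquiv, fun a b => ?_⟩
  have e1 : (h2.isoIsPushout _ _ h3).hom (a ⊗ₜ 1) = pullFst πX πY V a :=
    congr($(h2.inl_isoIsPushout_hom _ _ h3) a)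
  have e2 : (h2.isoIsPushout _ _ h3).hom (1 ⊗ₜ b) = pullSnd πX πY U b :=
    congr($(h2.inr_isoIsPushout_hom _ _ h3) b)
  rw [← e1, ← e2, ← map_mul, Algebra.TensorProduct.tmul_mul_tmul, mul_one, one_mul]
  rfl

end Affine
end
end Lef

namespace Lef
noncomputable section
open Opposite TopologicalSpace TensorProduct

section Kunneth

/-- Compatible sections on an open cover glue. -/
theorem section_glue {X : Scheme.{0}} (M : X.Modules) {ι : Type} (U : ι → X.Opens)
    (hU : ⨆ i, U i = ⊤) (s : ∀ i, Γ(M, U i))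
    (h : ∀ i j, res M (inf_le_left : U i ⊓ U j ≤ U i) (s i) = res M inf_le_right (s j)) :
    ∃ t : Γ(M, ⊤), ∀ i, res M le_top t = s i := by
  obtain ⟨t, ht, -⟩ := TopCat.Sheaf.existsUnique_gluing' ⟨M.presheaf, M.isSheaf⟩ U ⊤
    (fun i => homOfLE le_top) hU.ge s h
  exact ⟨t, ht⟩

/-- If finite sums of values of the maps `φ k` describe `G` on a basis of a compact scheme, they
describe it globally. -/
theorem bijective_top_of_basis {X : Scheme.{0}} [CompactSpace X] (F : X.Modules)
    {G : X.Opens → Type} [∀ U, AddCommGroup (G U)]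
    (r : ∀ {U V : X.Opens}, V ≤ U → G U →+ G V)
    (comp : ∀ {U V W : X.Opens} (h : V ≤ U) (h' : W ≤ V) (s : G U), r h' (r h s) = r (h'.trans h) s)
    (sep : ∀ s : G ⊤, (∀ x : X, ∃ U, x ∈ U ∧ r (le_top : U ≤ ⊤) s = 0) → s = 0)
    {κ : Type} (φ : ∀ U, κ → Γ(F, U) →+ G U)
    (nat : ∀ {U V : X.Opens} (h : V ≤ U) (k : κ) (m : Γ(F, U)), r h (φ U k m) = φ V k (res F h m))
    (basis : ∀ (x : X) (W : X.Opens), x ∈ W → ∃ U ≤ W, x ∈ U ∧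
      Function.Bijective (Finsupp.liftAddHom (φ U))) :
    Function.Bijective (Finsupp.liftAddHom (φ ⊤)) := by
  have nat' {U V : X.Opens} (h : V ≤ U) (m : κ →₀ Γ(F, U)) :
      r h (Finsupp.liftAddHom (φ U) m) =
        Finsupp.liftAddHom (φ V) (m.mapRange (res F h) (map_zero _)) := by
    induction m using Finsupp.induction_linear with
    | zero => simp
    | add a b ha hb => rw [Finsupp.mapRange_add' , map_add, map_add, map_add, ha, hb]
    | single k a => simp [nat]
  -- Injectivity is local and so holds over every open set; it is needed on the overlaps U x ⊓ U y
  -- below, which need not belong to the basis.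
  have inj (W : X.Opens) : Function.Injective (Finsupp.liftAddHom (φ W)) := by
    rw [injective_iff_map_eq_zero]
    intro m hm
    ext k
    refine section_ext F fun x hx => ?_
    obtain ⟨U, hUW, hxU, hU⟩ := basis x W hx
    refine ⟨U, hUW, hxU, ?_⟩
    have h := nat' hUW m
    rw [hm, map_zero] at h
    have h0 := (injective_iff_map_eq_zero _).mp hU.injective _ h.symm
    simpa using congr($h0 k)
  refine ⟨inj ⊤, fun s => ?_⟩
  choose U _ hxU hU using fun x : X => basis x ⊤ trivial
  obtain ⟨T, hT⟩ := isCompact_univ.elim_finite_subcover (fun x : X => (U x : Set X))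
    (fun x => (U x).isOpen) (fun x _ => Set.mem_iUnion.mpr ⟨x, hxU x⟩)
  choose m hm using fun x : X => (hU x).surjective (r le_top s)
  have glue (k : κ) : ∃ t : Γ(F, ⊤), ∀ x : T, res F le_top t = m x.1 k := by
    refine section_glue F (fun x : T => U x.1) ?_ (fun x => m x.1 k) fun x y => ?_
    · refine top_le_iff.mp fun x _ => ?_
      obtain ⟨y, hy, hxy⟩ := Set.mem_iUnion₂.mp (hT (Set.mem_univ x))
      exact Opens.mem_iSup.mpr ⟨⟨y, hy⟩, hxy⟩
    · have h : (m x.1).mapRange (res F (inf_le_left : U x.1 ⊓ U y.1 ≤ U x.1)) (map_zero _) =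
          (m y.1).mapRange (res F (inf_le_right : U x.1 ⊓ U y.1 ≤ U y.1)) (map_zero _) := by
        apply inj
        rw [← nat', ← nat', hm, hm, comp, comp]
      simpa using congr($h k)
  choose t ht using glue
  have cover (x : X) : ∃ y : T, x ∈ U y.1 := by
    obtain ⟨y, hy, hxy⟩ := Set.mem_iUnion₂.mp (hT (Set.mem_univ x))
    exact ⟨⟨y, hy⟩, hxy⟩
  classical
  -- Compactness enters here: with finitely many patches the glued family of coefficients has finite
  -- support, so it is again a finite sum.
  let S : Finset κ := T.biUnion fun x => (m x).support
  have htS (k : κ) (hk : t k ≠ 0) : k ∈ S := by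
    by_contra hkS
    apply hk
    refine section_ext F fun x _ => ?_
    obtain ⟨y, hy⟩ := cover x
    refine ⟨U y.1, le_top, hy, ?_⟩
    rw [ht, map_zero]
    simp only [S, Finset.mem_biUnion, not_exists, not_and, Finsupp.mem_support_iff, not_not] at hkS
    exact hkS y.1 y.2
  let t' : κ →₀ Γ(F, ⊤) := Finsupp.onFinset S t htS
  refine ⟨t', ?_⟩
  rw [← sub_eq_zero]
  refine sep _ fun x => ?_
  obtain ⟨y, hy⟩ := cover x
  refine ⟨U y.1, hy, ?_⟩
  rw [map_sub, sub_eq_zero, nat', ← hm]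
  congr 1
  ext k
  exact ht k y


section Product
variable {X Y : Scheme.{0}} (πX : X ⟶ SpecC) (πY : Y ⟶ SpecC) {M : X.Modules} {N : Y.Modules}

/-- A basis of the second factor turns the tensor product into finitely supported families of
sections of M, the form required by `bijective_top_of_basis`. -/
theorem bijective_boxMap_iff_right {U : X.Opens} {V : Y.Opens} {κ : Type}
    (b : Module.Basis κ ℂ (Sec πY N V)) :
    Function.Bijective (boxMap πX πY M N U V) ↔
      Function.Bijective (Finsupp.liftAddHom fun k => AddMonoidHom.mk'
        (fun m : Γ(M, U) => box πX πY m ((sec πY N V).symm (b k))) fun m m' => add_box _ _ m m' _) := by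
  classical
  rw [← Function.Bijective.of_comp_iff _ (TensorProduct.equivFinsuppOfBasisRight
    (M := Sec πX M U) b).symm.bijective]
  have : (boxMap πX πY M N U V) ∘ (TensorProduct.equivFinsuppOfBasisRight (M := Sec πX M U) b).symm =
      Finsupp.liftAddHom fun k => AddMonoidHom.mk'
        (fun m : Γ(M, U) => box πX πY m ((sec πY N V).symm (b k))) fun m m' => add_box _ _ m m' _ := by
    funext m
    rw [Function.comp_apply, TensorProduct.equivFinsuppOfBasisRight_symm_apply, map_finsuppSum]
    rfl
  rw [this]
  rfl

theorem bijective_boxMap_iff_left {U : X.Opens} {V : Y.Opens} {κ : Type}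
    (b : Module.Basis κ ℂ (Sec πX M U)) :
    Function.Bijective (boxMap πX πY M N U V) ↔
      Function.Bijective (Finsupp.liftAddHom fun k => AddMonoidHom.mk'
        (fun n : Γ(N, V) => box πX πY ((sec πX M U).symm (b k)) n) fun n n' => box_add _ _ _ n n') := by
  classical
  rw [← Function.Bijective.of_comp_iff _ (TensorProduct.equivFinsuppOfBasisLeft
    (N := Sec πY N V) b).symm.bijective]
  have : (boxMap πX πY M N U V) ∘ (TensorProduct.equivFinsuppOfBasisLeft (N := Sec πY N V) b).symm =
      Finsupp.liftAddHom fun k => AddMonoidHom.mk'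
        (fun n : Γ(N, V) => box πX πY ((sec πX M U).symm (b k)) n) fun n n' => box_add _ _ _ n n' := by
    funext m
    rw [Function.comp_apply, TensorProduct.equivFinsuppOfBasisLeft_symm_apply, map_finsuppSum]
    rfl
  rw [this]
  rfl

/-- The linear isomorphism given by a generator. -/
def IsGenerator.linearEquiv {U : X.Opens} {e : Γ(M, U)} (he : IsGenerator e) :
    letI := algO πX U
    Γ(X, U) ≃ₗ[ℂ] Sec πX M U :=
  letI := algO πX U
  LinearEquiv.ofBijective
    { toFun r := sec πX M U (r • e)
      map_add' r s := by rw [add_smul, map_add]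
      map_smul' c r := by
        rw [Algebra.smul_def, mul_smul]
        rfl }
    ((sec πX M U).bijective.comp (by simpa using he U le_rfl))

/-- The generators e, f and their external product trivialize all three sheaves, and the map becomes
the one of `exists_kunneth_affine`. -/
theorem bijective_boxMap_affine {U : X.Opens} {V : Y.Opens} (hU : IsAffineOpen U)
    (hV : IsAffineOpen V) {e : Γ(M, U)} {f : Γ(N, V)} (he : IsGenerator e) (hf : IsGenerator f) :
    Function.Bijective (boxMap πX πY M N U V) := by
  let _ := algO πX U
  let _ := algO πY V
  obtain ⟨κ, hκ⟩ := exists_kunneth_affine πX πY hU hV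
  let ε := TensorProduct.congr (he.linearEquiv πX) (hf.linearEquiv πY)
  rw [← Function.Bijective.of_comp_iff _ ε.bijective]
  have hg : Function.Bijective
      fun r : Γ(prod πX πY, rect πX πY U V) => r • box πX πY e f := by
    simpa using he.box πX πY hf _ le_rfl
  have : boxMap πX πY M N U V ∘ ε =
      (sec (prodToSpecC πX πY) (ext πX πY M N) (rect πX πY U V)) ∘
        (fun r : Γ(prod πX πY, rect πX πY U V) => r • box πX πY e f) ∘ κ := by
    funext t
    induction t using TensorProduct.induction_on with
    | zero => simp
    | tmul a b =>
      change sec _ _ _ (box πX πY (a • e) (b • f)) = sec _ _ _ (κ (a ⊗ₜ b) • box πX πY e f)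
      rw [hκ, smul_box, box_smul, mul_smul]
    | add x y hx hy =>
      simp only [Function.comp_apply, map_add, add_smul] at hx hy ⊢
      rw [hx, hy]
  rw [this]
  exact (AddEquiv.bijective _).comp (hg.comp κ.bijective)

theorem exists_affine_generator {X : Scheme.{0}} {M : X.Modules} {x : X} {U W : X.Opens}
    {e : Γ(M, U)} (hx : x ∈ U) (he : IsGenerator e) (hW : x ∈ W) :
    ∃ (V : X.Opens) (_ : V ≤ W) (e' : Γ(M, V)), x ∈ V ∧ IsAffineOpen V ∧ IsGenerator e' := by
  obtain ⟨V, hV, hxV, hVU⟩ := Opens.isBasis_iff_nbhd.mp X.isBasis_affineOpens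
    (show x ∈ U ⊓ W from ⟨hx, hW⟩)
  exact ⟨V, hVU.trans inf_le_right, res M (hVU.trans inf_le_left) e, hxV, hV, he.res _⟩

/-- The formula is globalized one factor at a time. Here V stays affine, so a fixed basis of N(V),
possibly infinite, serves for all open sets of X; the second factor is treated afterwards with a
basis of the global sections of M. -/
theorem bijective_boxMap_top_affine [CompactSpace X]
    (hM : ∀ x : X, ∃ (U : X.Opens) (e : Γ(M, U)), x ∈ U ∧ IsGenerator e) {V : Y.Opens}
    (hV : IsAffineOpen V) {f : Γ(N, V)} (hf : IsGenerator f) :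
    Function.Bijective (boxMap πX πY M N ⊤ V) := by
  let b := Module.Basis.ofVectorSpace ℂ (Sec πY N V)
  rw [bijective_boxMap_iff_right πX πY b]
  refine bijective_top_of_basis M (G := fun U => Γ(ext πX πY M N, rect πX πY U V))
    (r := fun h => res _ (rect_mono πX πY h le_rfl)) (fun h h' s => res_res _ _ _ s) ?_
    (fun U k => AddMonoidHom.mk' (fun m : Γ(M, U) => box πX πY m ((sec πY N V).symm (b k)))
      fun m m' => add_box _ _ m m' _) ?_ ?_
  · intro s hs
    refine section_ext _ fun z hz => ?_
    obtain ⟨U, hU, h⟩ := hs (fst πX πY z)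
    exact ⟨_, rect_mono πX πY le_top le_rfl, ⟨hU, hz.2⟩, h.trans (map_zero _).symm⟩
  · intro U U' h k m
    exact (res_box πX πY h le_rfl m _).trans (by rw [res_self]; rfl)
  · intro x W hx
    obtain ⟨U, e, hxU, he⟩ := hM x
    obtain ⟨U', hU', e', hxU', haff, he'⟩ := exists_affine_generator hxU he hx
    exact ⟨U', hU', hxU', (bijective_boxMap_iff_right πX πY b).mp
      (bijective_boxMap_affine πX πY haff hV he' hf)⟩

/-- The Künneth formula for global sections. -/
theorem bijective_boxMap_top [CompactSpace X] [CompactSpace Y]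
    (hM : ∀ x : X, ∃ (U : X.Opens) (e : Γ(M, U)), x ∈ U ∧ IsGenerator e)
    (hN : ∀ y : Y, ∃ (V : Y.Opens) (f : Γ(N, V)), y ∈ V ∧ IsGenerator f) :
    Function.Bijective (boxMap πX πY M N ⊤ ⊤) := by
  let b := Module.Basis.ofVectorSpace ℂ (Sec πX M ⊤)
  rw [bijective_boxMap_iff_left πX πY b]
  refine bijective_top_of_basis N (G := fun V => Γ(ext πX πY M N, rect πX πY ⊤ V))
    (r := fun h => res _ (rect_mono πX πY le_rfl h)) (fun h h' s => res_res _ _ _ s) ?_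
    (fun V k => AddMonoidHom.mk' (fun n : Γ(N, V) => box πX πY ((sec πX M ⊤).symm (b k)) n)
      fun n n' => box_add _ _ _ n n') ?_ ?_
  · intro s hs
    refine section_ext _ fun z hz => ?_
    obtain ⟨V, hV, h⟩ := hs (snd πX πY z)
    exact ⟨_, rect_mono πX πY le_rfl le_top, ⟨hz.1, hV⟩, h.trans (map_zero _).symm⟩
  · intro V V' h k n
    exact (res_box πX πY le_rfl h _ n).trans (by rw [res_self]; rfl)
  · intro y W hy
    obtain ⟨V, f, hyV, hf⟩ := hN y
    obtain ⟨V', hV', f', hyV', haff, hf'⟩ := exists_affine_generator hyV hf hy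
    exact ⟨V', hV', hyV', (bijective_boxMap_iff_left πX πY b).mp
      (bijective_boxMap_top_affine πX πY hM haff hf')⟩

theorem top_le_rect : (⊤ : (prod πX πY).Opens) ≤ rect πX πY ⊤ ⊤ := fun _ _ => ⟨trivial, trivial⟩

/-- The global section `p^*m ⊗ q^*n`. -/
def boxTop (m : Γ(M, ⊤)) (n : Γ(N, ⊤)) : Γ(ext πX πY M N, ⊤) :=
  res _ (top_le_rect πX πY) (box πX πY m n)

theorem res_boxTop {U : X.Opens} {V : Y.Opens} (m : Γ(M, ⊤)) (n : Γ(N, ⊤)) :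
    res _ le_top (boxTop πX πY m n) = box πX πY (res M (le_top : U ≤ ⊤) m)
      (res N (le_top : V ≤ ⊤) n) := by
  rw [boxTop, res_res, ← res_box πX πY le_top le_top]

/-- The comparison of the two vector space structures on global sections. -/
def secTop {X : Scheme.{0}} (π : X ⟶ SpecC) (M : X.Modules) :
    letI := sectionsModule π M
    Γ(M, ⊤) ≃ₗ[ℂ] Sec π M ⊤ :=
  letI := sectionsModule π M
  { sec π M ⊤ with
    map_smul' := fun c m => by
      change sec π M ⊤ (_ • m) = sec π M ⊤ (scal π ⊤ c • m)
      rw [scal, RingHom.comp_apply, resO_self]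
      rfl }

theorem isSectionBasis_boxTop [CompactSpace X] [CompactSpace Y]
    (hM : ∀ x : X, ∃ (U : X.Opens) (e : Γ(M, U)), x ∈ U ∧ IsGenerator e)
    (hN : ∀ y : Y, ∃ (V : Y.Opens) (f : Γ(N, V)), y ∈ V ∧ IsGenerator f)
    {ι κ : Type} {s : ι → Γ(M, ⊤)} {t : κ → Γ(N, ⊤)} (hs : IsSectionBasis πX M s)
    (ht : IsSectionBasis πY N t) :
    IsSectionBasis (prodToSpecC πX πY) (ext πX πY M N)
      fun k : ι × κ => boxTop πX πY (s k.1) (t k.2) := by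
  let _ := sectionsModule πX M
  let _ := sectionsModule πY N
  let _ := sectionsModule (prodToSpecC πX πY) (ext πX πY M N)
  obtain ⟨b, rfl⟩ := hs
  obtain ⟨c, rfl⟩ := ht
  -- The rectangle on the two whole spaces is the whole product, but not by definition; restriction
  -- identifies the two spaces of sections.
  let ρ : Sec (prodToSpecC πX πY) (ext πX πY M N) (rect πX πY ⊤ ⊤) ≃ₗ[ℂ]
      Sec (prodToSpecC πX πY) (ext πX πY M N) ⊤ :=
    LinearEquiv.ofBijective
      { toFun m := sec _ _ _ (res _ (top_le_rect πX πY) ((sec _ _ _).symm m))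
        map_add' m n := by simp only [map_add]
        map_smul' r m := by
          rw [sec_symm_smul, res_smul, resO_scal, sec_smul]
          rfl }
      (by
        refine (sec _ _ _).bijective.comp (Function.Bijective.comp ?_ (sec _ _ _).symm.bijective)
        refine Function.bijective_iff_has_inverse.mpr ⟨res _ le_top, fun m => ?_, fun m => ?_⟩
        · rw [res_res, res_self]
        · rw [res_res, res_self])
  let B := ((b.map (secTop πX M)).tensorProduct (c.map (secTop πY N))).map
    ((LinearEquiv.ofBijective _ (bijective_boxMap_top πX πY hM hN)).trans
      (ρ.trans (secTop (prodToSpecC πX πY) (ext πX πY M N)).symm))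
  refine ⟨B, funext fun k => ?_⟩
  obtain ⟨i, j⟩ := k
  rw [Module.Basis.map_apply, Module.Basis.tensorProduct_apply]
  rfl

end Product

end Kunneth
end
end Lef

namespace Lef
noncomputable section
open Opposite TopologicalSpace

/-! ### Functions on the standard charts of projective space -/

section Away
variable {ι : Type} (i : ι)

/-- The degree zero part of `ℂ[x][1/x_i]`. -/
abbrev AwayRing : Type := HomogeneousLocalization.Away (grading ι) (MvPolynomial.X i)

/-- The ring `ℂ[x][1/x_i]`. -/
abbrev AwayLoc : Type := Localization.Away (MvPolynomial.X i : MvPolynomial ι ℂ)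

/-- The element `x_j / x_i`. -/
def awayRatio (j : ι) : AwayRing i :=
  HomogeneousLocalization.Away.mk (grading ι) (X_mem_grading i) 1 (MvPolynomial.X j)
    (by rw [one_smul]; exact X_mem_grading j)

/-- The constants in `ℂ[x][1/x_i]`. -/
def awayConst : ℂ →+* AwayRing i :=
  (HomogeneousLocalization.fromZeroRingHom (grading ι) _).comp (algebraMap ℂ (grading ι 0))

theorem val_awayRatio (j : ι) :
    (awayRatio i j).val * algebraMap (MvPolynomial ι ℂ) (AwayLoc i) (MvPolynomial.X i) =
      algebraMap (MvPolynomial ι ℂ) (AwayLoc i) (MvPolynomial.X j) := by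
  rw [awayRatio, HomogeneousLocalization.Away.val_mk, Localization.mk_eq_mk']
  simp

theorem val_awayConst (c : ℂ) :
    (awayConst i c).val = algebraMap (MvPolynomial ι ℂ) (AwayLoc i) (MvPolynomial.C c) := by
  rw [awayConst, RingHom.comp_apply, HomogeneousLocalization.fromZeroRingHom]
  exact Localization.mk_one_eq_algebraMap _

theorem awayRatio_self : awayRatio i i = 1 := by
  apply HomogeneousLocalization.val_injective
  have hu : IsUnit (algebraMap (MvPolynomial ι ℂ) (AwayLoc i) (MvPolynomial.X i)) :=
    IsLocalization.Away.algebraMap_isUnit _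
  apply hu.mul_right_cancel
  rw [val_awayRatio, HomogeneousLocalization.val_one, one_mul]

/-- The ring of functions on `D₊(x_i)` is generated by constants and the functions `x_j / x_i`. -/
theorem away_hom_ext {R : Type} [CommRing R] {g h : AwayRing i →+* R}
    (hc : g.comp (awayConst i) = h.comp (awayConst i))
    (hr : ∀ j, g (awayRatio i j) = h (awayRatio i j)) : g = h := by
  -- Dehomogenization x_j ↦ x_j / x_i. For a homogeneous of degree n, `homog` gives ρ(a) · x_i ^ n =
  -- a in the localization, so a / x_i ^ n = ρ(a): thus ρ is surjective, and g, h need only be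
  -- compared on the variables and constants.
  let ρ : MvPolynomial ι ℂ →+* AwayRing i := MvPolynomial.eval₂Hom (awayConst i) (awayRatio i)
  let v : AwayRing i →+* AwayLoc i := algebraMap _ _
  have hv (z : AwayRing i) : v z = z.val := rfl
  have hρ : g.comp ρ = h.comp ρ := by
    apply MvPolynomial.ringHom_ext
    · intro c
      simpa [ρ] using RingHom.congr_fun hc c
    · intro j
      simpa [ρ] using hr j
  have mono (d : ι →₀ ℕ) (c : ℂ) :
      v (ρ (MvPolynomial.monomial d c)) * algebraMap (MvPolynomial ι ℂ) (AwayLoc i) (MvPolynomial.X i) ^ (d.degree) =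
        algebraMap (MvPolynomial ι ℂ) (AwayLoc i) (MvPolynomial.monomial d c) := by
    have h1 : ρ (MvPolynomial.monomial d c) =
        awayConst i c * d.prod fun j k => awayRatio i j ^ k := MvPolynomial.eval₂_monomial _ _
    rw [h1, MvPolynomial.monomial_eq, map_mul, map_mul, hv (awayConst i c), val_awayConst,
      Finsupp.degree_apply, Finsupp.prod, Finsupp.prod, map_prod, map_prod, mul_assoc,
      ← Finset.prod_pow_eq_pow_sum, ← Finset.prod_mul_distrib]
    congr 1
    refine Finset.prod_congr rfl fun j _ => ?_
    rw [map_pow, map_pow, ← mul_pow, hv, val_awayRatio]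
  have homog (n : ℕ) (a : MvPolynomial ι ℂ) (ha : a.IsHomogeneous n) :
      v (ρ a) * algebraMap (MvPolynomial ι ℂ) (AwayLoc i) (MvPolynomial.X i) ^ n = algebraMap (MvPolynomial ι ℂ) (AwayLoc i) a := by
    rw [a.as_sum, map_sum, map_sum, map_sum, Finset.sum_mul]
    refine Finset.sum_congr rfl fun d hd => ?_
    have hdn : d.degree = n := by
      have := ha (MvPolynomial.mem_support_iff.mp hd)
      rw [← this, Finsupp.degree_eq_weight_one]; rfl
    rw [← hdn, mono]
  refine RingHom.ext fun z => ?_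
  obtain ⟨n, a, ha, rfl⟩ := HomogeneousLocalization.Away.mk_surjective (grading ι) (X_mem_grading i) z
  have : HomogeneousLocalization.Away.mk (grading ι) (X_mem_grading i) n a ha = ρ a := by
    apply HomogeneousLocalization.val_injective
    rw [HomogeneousLocalization.Away.val_mk, Localization.mk_eq_mk', IsLocalization.mk'_eq_iff_eq_mul,
      ← hv, map_pow]
    refine (homog n a ?_).symm
    simpa using ha
  rw [this]
  exact RingHom.congr_fun hρ a

/-- Homomorphisms out of the ring of functions on `D₊(x_i)`. -/
theorem exists_away_hom {R : Type} [CommRing R] (c : ℂ →+* R) (a : ι → R) (ha : a i = 1) :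
    ∃ g : AwayRing i →+* R, g.comp (awayConst i) = c ∧ ∀ j, g (awayRatio i j) = a j := by
  let ρ : MvPolynomial ι ℂ →+* R := MvPolynomial.eval₂Hom c a
  -- Evaluation at the a_j sends x_i to 1, so it extends to the localization and can be restricted
  -- to the part of degree zero.
  have hu : IsUnit (ρ (MvPolynomial.X i)) := by simp [ρ, ha]
  let g : AwayLoc i →+* R := IsLocalization.Away.lift _ hu
  have hg (p : MvPolynomial ι ℂ) : g (algebraMap (MvPolynomial ι ℂ) (AwayLoc i) p) = ρ p := IsLocalization.Away.lift_eq _ hu p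
  let v : AwayRing i →+* AwayLoc i := algebraMap _ _
  have hv (z : AwayRing i) : v z = z.val := rfl
  refine ⟨g.comp v, RingHom.ext fun z => ?_, fun j => ?_⟩
  · simp only [RingHom.comp_apply, hv, val_awayConst]
    rw [hg]
    simp [ρ]
  · have h := congrArg g (val_awayRatio i j)
    rw [map_mul, hg, hg] at h
    rw [RingHom.comp_apply, hv]
    simpa [ρ, ha] using h

end Away

/-! ### The charts and their overlaps -/

section Chart
variable {ι : Type}

theorem ratio_eq (i j : ι) :
    ProjSpace.ratio i j = Proj.awayToSection (grading ι) (MvPolynomial.X i) (awayRatio i j) := rfl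

theorem ratio_self (i : ι) : ProjSpace.ratio i i = 1 := by
  rw [ratio_eq, awayRatio_self, map_one]
  rfl

/-- The open immersion of the chart `D₊(x_i)`. -/
def chartι (i : ι) : Spec (CommRingCat.of (AwayRing i)) ⟶ ProjSpace ι :=
  Proj.awayι (grading ι) (MvPolynomial.X i) (X_mem_grading i) one_pos

instance (i : ι) : IsOpenImmersion (chartι i) := inferInstanceAs (IsOpenImmersion (Proj.awayι _ _ _ _))

theorem opensRange_chartι (i : ι) : (chartι i).opensRange = ProjSpace.chart i :=
  Proj.opensRange_awayι _ _ _ _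

theorem chartι_comp_toSpecC (i : ι) :
    chartι i ≫ ProjSpace.toSpecC ι = Spec.map (CommRingCat.ofHom (awayConst i)) := by
  rw [chartι, ProjSpace.toSpecC, Proj.awayι_toSpecZero_assoc, ← Spec.map_comp]
  rfl

theorem top_le_chartι (i : ι) : ⊤ ≤ chartι i ⁻¹ᵁ ProjSpace.chart i := by
  rw [← opensRange_chartι]
  simp

theorem awayToSection_chartι (i : ι) :
    Proj.awayToSection (grading ι) (MvPolynomial.X i) ≫
      (chartι i).appLE (ProjSpace.chart i) ⊤ (top_le_chartι i) =
        (Scheme.ΓSpecIso (CommRingCat.of (AwayRing i))).inv := by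
  let e := Proj.basicOpenIsoSpec (grading ι) (MvPolynomial.X i) (X_mem_grading i) one_pos
  have h1 := Proj.basicOpenToSpec_app_top (grading ι) (MvPolynomial.X i : MvPolynomial ι ℂ)
  have h2 : (chartι i).appLE (ProjSpace.chart i) ⊤ (top_le_chartι i) =
      (Proj.basicOpen (grading ι) (MvPolynomial.X i)).topIso.inv ≫ e.inv.appTop := by
    have h4 : ⊤ ≤ (Proj.basicOpen (grading ι) (MvPolynomial.X i)).ι ⁻¹ᵁ
        (Proj.basicOpen (grading ι) (MvPolynomial.X i)) := by simp
    have h5 := Scheme.Hom.appLE_comp_appLE e.inv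
      (Proj.basicOpen (grading ι) (MvPolynomial.X i)).ι _ ⊤ ⊤ h4 (le_refl _)
    refine h5.symm.trans ?_
    rw [Scheme.Opens.ι_appLE, Scheme.Opens.topIso_inv, Scheme.Hom.appTop, Scheme.Hom.app_eq_appLE]
    rfl
  have h3 : e.hom.appTop ≫ e.inv.appTop = 𝟙 _ := by
    rw [← Scheme.Hom.comp_appTop, e.inv_hom_id]; simp
  rw [h2, ← cancel_epi (Scheme.ΓSpecIso (CommRingCat.of (AwayRing i))).hom, Iso.hom_inv_id, ← h3]
  rw [← Category.assoc, ← Category.assoc, Category.assoc _ _ (Scheme.Opens.topIso _).inv]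
  congr 1
  exact h1.symm


/-- Both sides lie in the image of `chartι i`, so it suffices to compare their preimages in the
affine chart, where both are the basic open set of x_k / x_i. -/
theorem chart_inf (i k : ι) :
    ProjSpace.chart i ⊓ ProjSpace.chart k = (ProjSpace ι).basicOpen (ProjSpace.ratio i k) := by
  have h1 := Proj.awayι_preimage_basicOpen (grading ι) (X_mem_grading i) one_pos
    (X_mem_grading k) one_pos
  have h2 : HomogeneousLocalization.Away.isLocalizationElem (X_mem_grading i) (X_mem_grading k) =
      awayRatio i k := by
    apply HomogeneousLocalization.val_injective
    simp [HomogeneousLocalization.Away.isLocalizationElem, awayRatio]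
  rw [h2] at h1
  have h3 : chartι i ⁻¹ᵁ (ProjSpace ι).basicOpen (ProjSpace.ratio i k) =
      PrimeSpectrum.basicOpen (awayRatio i k) := by
    have h4 : (Scheme.ΓSpecIso (CommRingCat.of (AwayRing i))).inv (awayRatio i k) =
        (chartι i).appLE (ProjSpace.chart i) ⊤ (top_le_chartι i) (ProjSpace.ratio i k) := by
      rw [← awayToSection_chartι]; rfl
    have h5 : (Spec (CommRingCat.of (AwayRing i))).basicOpen
        ((Scheme.ΓSpecIso (CommRingCat.of (AwayRing i))).inv (awayRatio i k)) =
        PrimeSpectrum.basicOpen (awayRatio i k) :=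
      basicOpen_eq_of_affine (R := CommRingCat.of (AwayRing i)) (awayRatio i k)
    rw [← h5, h4, Scheme.preimage_basicOpen, Scheme.Hom.appLE, CommRingCat.comp_apply,
      Scheme.basicOpen_res, inf_eq_right.mpr le_top]
  have h5 : chartι i ⁻¹ᵁ ProjSpace.chart k =
      chartι i ⁻¹ᵁ (ProjSpace ι).basicOpen (ProjSpace.ratio i k) := h1.trans h3.symm
  have h6 : chartι i ''ᵁ (chartι i ⁻¹ᵁ ProjSpace.chart k) =
      chartι i ''ᵁ (chartι i ⁻¹ᵁ (ProjSpace ι).basicOpen (ProjSpace.ratio i k)) := by rw [h5]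
  rw [Scheme.Hom.image_preimage_eq_opensRange_inf, Scheme.Hom.image_preimage_eq_opensRange_inf,
    opensRange_chartι] at h6
  rw [h6]
  exact inf_eq_right.mpr (Scheme.basicOpen_le _ _)

/-- The cocycle identity (x_k / x_i)(x_j / x_k) = x_j / x_i, verified among fractions with
denominators powers of x_i x_k, whose basic open set contains U. -/
theorem ratio_mul_ratio (i k j : ι) (U : (ProjSpace ι).Opens) (hi : U ≤ ProjSpace.chart i)
    (hk : U ≤ ProjSpace.chart k) :
    resO hi (ProjSpace.ratio i k) * resO hk (ProjSpace.ratio k j) =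
      resO hi (ProjSpace.ratio i j) := by
  have hx : (MvPolynomial.X i * MvPolynomial.X k : MvPolynomial ι ℂ) =
    MvPolynomial.X i * MvPolynomial.X k := rfl
  have hx' : (MvPolynomial.X i * MvPolynomial.X k : MvPolynomial ι ℂ) =
    MvPolynomial.X k * MvPolynomial.X i := mul_comm _ _
  have hU : U ≤ Proj.basicOpen (grading ι) (MvPolynomial.X i * MvPolynomial.X k) := by
    rw [Proj.basicOpen_mul]; exact le_inf hi hk
  let W := Localization.Away (MvPolynomial.X i * MvPolynomial.X k : MvPolynomial ι ℂ)
  have key : HomogeneousLocalization.awayMap (grading ι) (X_mem_grading k) hx (awayRatio i k) *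
      HomogeneousLocalization.awayMap (grading ι) (X_mem_grading i) hx' (awayRatio k j) =
      HomogeneousLocalization.awayMap (grading ι) (X_mem_grading k) hx (awayRatio i j) := by
    apply HomogeneousLocalization.val_injective
    rw [HomogeneousLocalization.val_mul, awayRatio, awayRatio, awayRatio,
      HomogeneousLocalization.awayMap_mk, HomogeneousLocalization.awayMap_mk,
      HomogeneousLocalization.awayMap_mk]
    simp only [HomogeneousLocalization.Away.val_mk, Localization.mk_mul, Localization.mk_eq_mk_iff,
      Localization.r_iff_exists]
    refine ⟨1, ?_⟩
    simp
    ring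
  have h1 (a : AwayRing i) := ConcreteCategory.congr_hom (Proj.awayMap_awayToSection (grading ι)
    (X_mem_grading k) hx) a
  have h2 (a : AwayRing k) := ConcreteCategory.congr_hom (Proj.awayMap_awayToSection (grading ι)
    (X_mem_grading i) hx') a
  have h3 := congrArg (fun z => resO hU (Proj.awayToSection (grading ι) _ z)) key
  simp only [map_mul] at h3
  have h4 (a : AwayRing i) : resO hU (Proj.awayToSection (grading ι) _
      (HomogeneousLocalization.awayMap (grading ι) (X_mem_grading k) hx a)) =
      resO hi (Proj.awayToSection (grading ι) (MvPolynomial.X i) a) := by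
    exact (congrArg (resO hU) (h1 a)).trans (resO_resO _ _ _)
  have h5 (a : AwayRing k) : resO hU (Proj.awayToSection (grading ι) _
      (HomogeneousLocalization.awayMap (grading ι) (X_mem_grading i) hx' a)) =
      resO hk (Proj.awayToSection (grading ι) (MvPolynomial.X k) a) := by
    exact (congrArg (resO hU) (h2 a)).trans (resO_resO _ _ _)
  rw [h4, h4, h5] at h3
  exact h3

theorem iSup_chart : ⨆ i : ι, ProjSpace.chart i = ⊤ := by
  apply Proj.iSup_basicOpen_eq_top'
  · exact fun i => ⟨1, X_mem_grading i⟩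
  · refine top_le_iff.mp fun p _ => ?_
    have hp : p ∈ Algebra.adjoin ℂ (Set.range (MvPolynomial.X : ι → MvPolynomial ι ℂ)) := by
      rw [MvPolynomial.adjoin_range_X]; trivial
    induction hp using Algebra.adjoin_induction with
    | mem x hx => exact Algebra.subset_adjoin hx
    | algebraMap r => exact Subalgebra.algebraMap_mem _ (algebraMap ℂ (grading ι 0) r)
    | add x y _ _ hx hy => exact add_mem (hx trivial) (hy trivial)
    | mul x y _ _ hx hy => exact mul_mem (hx trivial) (hy trivial)

end Chart

/-! ### Morphisms to projective space given by coordinates -/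

section Morphism
variable {ι : Type} {T : Scheme.{0}}

/-- The function `x_j / x_i` pulled back along a morphism to `D₊(x_i)`. -/
def coord (f : T ⟶ ProjSpace ι) (i : ι) (h : ⊤ ≤ f ⁻¹ᵁ ProjSpace.chart i) (j : ι) : Γ(T, ⊤) :=
  f.appLE (ProjSpace.chart i) ⊤ h (ProjSpace.ratio i j)

theorem coord_comp {S : Scheme.{0}} (g : S ⟶ T) (f : T ⟶ ProjSpace ι) (i : ι)
    (h : ⊤ ≤ f ⁻¹ᵁ ProjSpace.chart i) (h' : ⊤ ≤ (g ≫ f) ⁻¹ᵁ ProjSpace.chart i) (j : ι) :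
    coord (g ≫ f) i h' j = g.appTop (coord f i h j) := by
  have := Scheme.Hom.appLE_comp_appLE g f (ProjSpace.chart i) ⊤ ⊤ h (le_refl _)
  rw [coord, ← this, coord, Scheme.Hom.appTop, Scheme.Hom.app_eq_appLE]
  rfl

/-- The homomorphism from functions on `D₊(x_i)` given by a morphism to it. -/
theorem factor_chartι (f : T ⟶ ProjSpace ι) (i : ι) (h : ⊤ ≤ f ⁻¹ᵁ ProjSpace.chart i) :
    ∃ f' : T ⟶ Spec (CommRingCat.of (AwayRing i)), f = f' ≫ chartι i := by
  have hr : Set.range f ⊆ Set.range (chartι i) := by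
    rintro _ ⟨x, rfl⟩
    have : f x ∈ (chartι i).opensRange := by
      rw [opensRange_chartι]; exact h (Set.mem_univ x)
    exact this
  exact ⟨IsOpenImmersion.lift (chartι i) f hr, (IsOpenImmersion.lift_fac _ _ hr).symm⟩

theorem coord_chartι (i j : ι) :
    coord (chartι i) i (top_le_chartι i) j =
      (Scheme.ΓSpecIso (CommRingCat.of (AwayRing i))).inv (awayRatio i j) := by
  rw [← awayToSection_chartι]; rfl

/-- A morphism to `D₊(x_i)` over `ℂ` is determined by the functions `x_j / x_i`. -/
theorem hom_chart_ext (f g : T ⟶ ProjSpace ι) (i : ι) (hf : ⊤ ≤ f ⁻¹ᵁ ProjSpace.chart i)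
    (hg : ⊤ ≤ g ⁻¹ᵁ ProjSpace.chart i)
    (hC : f ≫ ProjSpace.toSpecC ι = g ≫ ProjSpace.toSpecC ι)
    (hc : ∀ j, coord f i hf j = coord g i hg j) : f = g := by
  obtain ⟨f, rfl⟩ := factor_chartι f i hf
  obtain ⟨g, rfl⟩ := factor_chartι g i hg
  congr 1
  apply ext_of_isAffine
  rw [← cancel_epi (Scheme.ΓSpecIso (CommRingCat.of (AwayRing i))).inv]
  apply CommRingCat.hom_ext
  apply away_hom_ext
  · rw [Category.assoc, Category.assoc, chartι_comp_toSpecC] at hC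
    have h1 (f : T ⟶ Spec (CommRingCat.of (AwayRing i))) :
        (CommRingCat.ofHom (awayConst i)) ≫
          (Scheme.ΓSpecIso (CommRingCat.of (AwayRing i))).inv ≫ f.appTop =
        (Scheme.ΓSpecIso (CommRingCat.of ℂ)).inv ≫
          (f ≫ Spec.map (CommRingCat.ofHom (awayConst i))).appTop := by
      rw [Scheme.ΓSpecIso_inv_naturality_assoc, Scheme.Hom.comp_appTop]
    have h2 := (h1 f).trans ((congrArg (fun t : T ⟶ SpecC =>
      (Scheme.ΓSpecIso (CommRingCat.of ℂ)).inv ≫ t.appTop) hC).trans (h1 g).symm)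
    exact congrArg CommRingCat.Hom.hom h2
  · intro j
    have := hc j
    rw [coord_comp f (chartι i) i (top_le_chartι i), coord_comp g (chartι i) i (top_le_chartι i),
      coord_chartι] at this
    exact this

/-- Functions `a_j` with `a_i = 1` give a morphism to `D₊(x_i)`. -/
theorem exists_hom_chart (π : T ⟶ SpecC) (i : ι) (a : ι → Γ(T, ⊤)) (ha : a i = 1) :
    ∃ (f : T ⟶ ProjSpace ι) (h : ⊤ ≤ f ⁻¹ᵁ ProjSpace.chart i), f ≫ ProjSpace.toSpecC ι = π ∧
      ∀ j, coord f i h j = a j := by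
  obtain ⟨ρ, hρ, hr⟩ := exists_away_hom i
    ((Scheme.ΓSpecIso (CommRingCat.of ℂ)).inv ≫ π.appTop).hom a ha
  let φ : CommRingCat.of (AwayRing i) ⟶ Γ(T, ⊤) := CommRingCat.ofHom ρ
  have hφ : CommRingCat.ofHom (awayConst i) ≫ φ =
    (Scheme.ΓSpecIso (CommRingCat.of ℂ)).inv ≫ π.appTop := CommRingCat.hom_ext hρ
  let f' : T ⟶ Spec (CommRingCat.of (AwayRing i)) := T.toSpecΓ ≫ Spec.map φ
  have hf' : (Scheme.ΓSpecIso (CommRingCat.of (AwayRing i))).inv ≫ f'.appTop = φ := by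
    simp only [f', Scheme.Hom.comp_appTop, Scheme.toSpecΓ_appTop]
    rw [← Scheme.ΓSpecIso_inv_naturality_assoc, Iso.inv_hom_id, Category.comp_id]
  have h : ⊤ ≤ (f' ≫ chartι i) ⁻¹ᵁ ProjSpace.chart i := fun x _ =>
    top_le_chartι i (Set.mem_univ (f' x))
  refine ⟨f' ≫ chartι i, h, ?_, fun j => ?_⟩
  · rw [Category.assoc, chartι_comp_toSpecC, Category.assoc, ← Spec.map_comp, hφ, Spec.map_comp]
    rw [← Scheme.toSpecΓ_naturality_assoc]
    simp
  · rw [coord_comp f' (chartι i) i (top_le_chartι i), coord_chartι, ← hr]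
    exact ConcreteCategory.congr_hom hf' (awayRatio i j)

theorem coord_mul_coord (f : T ⟶ ProjSpace ι) (i k : ι) (hi : ⊤ ≤ f ⁻¹ᵁ ProjSpace.chart i)
    (hk : ⊤ ≤ f ⁻¹ᵁ ProjSpace.chart k) (j : ι) :
    coord f i hi k * coord f k hk j = coord f i hi j := by
  have h := congrArg (f.appLE (ProjSpace.chart i ⊓ ProjSpace.chart k) ⊤ (le_inf hi hk)).hom
    (ratio_mul_ratio i k j _ inf_le_left inf_le_right)
  rw [map_mul] at h
  have hres (V V' : (ProjSpace ι).Opens) (hV : V' ≤ V) (h : ⊤ ≤ f ⁻¹ᵁ V')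
      (b : Γ(ProjSpace ι, V)) :
      f.appLE V' ⊤ h (resO hV b) = f.appLE V ⊤ (h.trans (preimage_mono f hV)) b :=
    ConcreteCategory.congr_hom (f.map_appLE h (homOfLE hV).op) b
  exact (congrArg₂ (· * ·) (hres _ _ _ _ _) (hres _ _ _ _ _)).symm.trans
    (h.trans (hres _ _ _ _ _))

theorem preimage_chart (f : T ⟶ ProjSpace ι) (i : ι) (h : ⊤ ≤ f ⁻¹ᵁ ProjSpace.chart i) (j : ι) :
    f ⁻¹ᵁ ProjSpace.chart j = T.basicOpen (coord f i h j) := by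
  have h1 : f ⁻¹ᵁ ProjSpace.chart j = f ⁻¹ᵁ (ProjSpace.chart i ⊓ ProjSpace.chart j) :=
    TopologicalSpace.Opens.ext (Set.ext fun x => ⟨fun hx => ⟨h (Set.mem_univ x), hx⟩, fun hx => hx.2⟩)
  rw [h1, chart_inf, coord, Scheme.preimage_basicOpen, Scheme.Hom.appLE, CommRingCat.comp_apply,
    Scheme.basicOpen_res, inf_eq_right.mpr le_top]

theorem appLE_comp_appTop {S V : Scheme.{0}} (p : S ⟶ V) (q : V ⟶ T) {U : T.Opens}
    (hU : ⊤ ≤ q ⁻¹ᵁ U) (h : ⊤ ≤ (p ≫ q) ⁻¹ᵁ U) :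
    q.appLE U ⊤ hU ≫ p.appTop = (p ≫ q).appLE U ⊤ h := by
  rw [← Scheme.Hom.appLE_comp_appLE p q U ⊤ ⊤ hU (le_refl _), Scheme.Hom.appTop,
    Scheme.Hom.app_eq_appLE]
  rfl

/-- Functions `a_{ij}` which are compatible like the quotients of homogeneous coordinates give a
morphism to projective space. -/
theorem exists_hom_projSpace (π : T ⟶ SpecC) (W : ι → T.Opens) (hW : ⨆ i, W i = ⊤)
    (a : ∀ i, ι → Γ(T, W i)) (ha : ∀ i, a i i = 1)
    (hmul : ∀ i k j, resO (inf_le_left : W i ⊓ W k ≤ W i) (a i k) *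
      resO (inf_le_right : W i ⊓ W k ≤ W k) (a k j) = resO inf_le_left (a i j))
    (hbasic : ∀ i k, W i ⊓ W k = T.basicOpen (a i k)) :
    ∃ ψ : T ⟶ ProjSpace ι, ψ ≫ ProjSpace.toSpecC ι = π ∧
      (∀ i, ψ ⁻¹ᵁ ProjSpace.chart i = W i) ∧
      ∀ i j (h : W i ≤ ψ ⁻¹ᵁ ProjSpace.chart i),
        ψ.appLE (ProjSpace.chart i) (W i) h (ProjSpace.ratio i j) = a i j := by
  have hι (i : ι) : ⊤ ≤ (W i).ι ⁻¹ᵁ W i := by simp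
  let r (i : ι) : Γ(T, W i) →+* Γ(W i, ⊤) := ((W i).ι.appLE (W i) ⊤ (hι i)).hom
  have hrbij (i : ι) : Function.Bijective (r i) := by
    have : IsIso ((W i).ι.appLE (W i) ⊤ (hι i)) := by
      rw [Scheme.Opens.ι_appLE]
      have h : W i = (W i).ι ''ᵁ ⊤ := by simp
      have h' : (W i).ι ''ᵁ ⊤ ≤ W i := h.ge
      have : IsIso (homOfLE h') := ⟨homOfLE h.le, Subsingleton.elim _ _, Subsingleton.elim _ _⟩
      exact inferInstanceAs (IsIso (T.presheaf.map (homOfLE h').op))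
    exact ConcreteCategory.bijective_of_isIso _
  choose f hf hfπ hfa using fun i => exists_hom_chart ((W i).ι ≫ π) i (fun j => r i (a i j))
    (by simp [ha])
  let 𝒰 : T.OpenCover := T.openCoverOfIsOpenCover W (.mk hW)
  have pre (i k : ι) : f k ⁻¹ᵁ ProjSpace.chart i = (W k).ι ⁻¹ᵁ W i := by
    rw [preimage_chart (f k) k (hf k) i, hfa]
    simp only [r]
    change (W k).toScheme.basicOpen ((W k).ι.appLE (W k) ⊤ (hι k) (a k i)) = _
    rw [Scheme.Hom.appLE, CommRingCat.comp_apply, Scheme.basicOpen_res, inf_eq_right.mpr le_top,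
      ← Scheme.preimage_basicOpen, ← hbasic k i]
    ext x
    exact ⟨fun h => h.2, fun h => ⟨x.2, h⟩⟩
  -- Agreement on overlaps, stated for any test scheme S mapping to both patches; gluing uses it for
  -- their fibre product over T.
  have pull {S : Scheme.{0}} (i k : ι) (p : S ⟶ (W i).toScheme) (q : S ⟶ (W k).toScheme)
      (hpq : p ≫ (W i).ι = q ≫ (W k).ι) : p ≫ f i = q ≫ f k := by
    let t := p ≫ (W i).ι
    have ti : ⊤ ≤ t ⁻¹ᵁ W i := fun x _ => (p x).2
    have tk : ⊤ ≤ t ⁻¹ᵁ W k := fun x _ => by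
      change t x ∈ W k
      simp only [t, hpq]
      exact (q x).2
    have hp : ⊤ ≤ (p ≫ f i) ⁻¹ᵁ ProjSpace.chart i := fun x _ => hf i (Set.mem_univ (p x))
    have hq : ⊤ ≤ (q ≫ f k) ⁻¹ᵁ ProjSpace.chart k := fun x _ => hf k (Set.mem_univ (q x))
    have hq' : ⊤ ≤ (q ≫ f k) ⁻¹ᵁ ProjSpace.chart i := fun x _ => by
      have : q x ∈ (W k).ι ⁻¹ᵁ W i := by
        change (q ≫ (W k).ι) x ∈ W i
        rw [← hpq]; exact (p x).2
      rwa [← pre i k] at this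
    have ci (j : ι) : coord (p ≫ f i) i hp j = t.appLE (W i) ⊤ ti (a i j) := by
      rw [coord_comp p (f i) i (hf i), hfa]
      exact ConcreteCategory.congr_hom (appLE_comp_appTop p (W i).ι (hι i) ti) (a i j)
    have ck (j : ι) : coord (q ≫ f k) k hq j = t.appLE (W k) ⊤ tk (a k j) := by
      rw [coord_comp q (f k) k (hf k), hfa]
      have h := ConcreteCategory.congr_hom
        (appLE_comp_appTop q (W k).ι (hι k) (by rwa [← hpq])) (a k j)
      simp only [t, hpq]
      exact h
    have hres (V V' : T.Opens) (hV : V' ≤ V) (h : ⊤ ≤ t ⁻¹ᵁ V') (b : Γ(T, V)) :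
        t.appLE V' ⊤ h (resO hV b) = t.appLE V ⊤ (h.trans (preimage_mono t hV)) b :=
      ConcreteCategory.congr_hom (t.map_appLE h (homOfLE hV).op) b
    have hmul' (i k j : ι) (ti : ⊤ ≤ t ⁻¹ᵁ W i) (tk : ⊤ ≤ t ⁻¹ᵁ W k) :
        t.appLE (W i) ⊤ ti (a i k) * t.appLE (W k) ⊤ tk (a k j) =
        t.appLE (W i) ⊤ ti (a i j) := by
      have h := congrArg (t.appLE (W i ⊓ W k) ⊤ (le_inf ti tk)).hom (hmul i k j)
      rw [map_mul] at h
      exact (congrArg₂ (· * ·) (hres _ _ _ _ _) (hres _ _ _ _ _)).symm.trans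
        (h.trans (hres _ _ _ _ _))
    refine hom_chart_ext _ _ i hp hq' ?_ fun j => ?_
    · rw [Category.assoc, hfπ, Category.assoc, hfπ, ← Category.assoc, hpq, Category.assoc]
    · have h1 := coord_mul_coord (q ≫ f k) k i hq hq' j
      rw [ck, ck, ← hmul' k i j tk ti] at h1
      -- Since a_ii = 1, the cocycle identity makes a_ik and a_ki mutually inverse over S. This
      -- allows passage from the coordinates of chart k to those of chart i.
      have h2 := hmul' i k i ti tk
      rw [ha i, map_one] at h2
      rw [ci]
      calc _ = (t.appLE (W i) ⊤ ti (a i k) * t.appLE (W k) ⊤ tk (a k i)) *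
            t.appLE (W i) ⊤ ti (a i j) := by rw [h2, one_mul]
        _ = _ := by rw [mul_assoc, ← h1, ← mul_assoc, h2, one_mul]
  let ψ : T ⟶ ProjSpace ι := 𝒰.glueMorphisms f fun i k => pull i k _ _ Limits.pullback.condition
  have hψ (i : ι) : (W i).ι ≫ ψ = f i := Scheme.Cover.ι_glueMorphisms 𝒰 f _ i
  refine ⟨ψ, ?_, ?_, ?_⟩
  · refine Scheme.Cover.hom_ext 𝒰 _ _ fun i => ?_
    exact (Category.assoc _ _ _).symm.trans
      ((congrArg (· ≫ ProjSpace.toSpecC ι) (hψ i)).trans (hfπ i))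
  · intro i
    refine TopologicalSpace.Opens.ext (Set.ext fun x => ?_)
    have hx : x ∈ ⨆ i, W i := by rw [hW]; trivial
    obtain ⟨k, hk⟩ := Opens.mem_iSup.mp hx
    have h1 : ((⟨x, hk⟩ : W k) ∈ f k ⁻¹ᵁ ProjSpace.chart i) ↔ x ∈ W i := by
      rw [pre]; rfl
    rw [← hψ] at h1
    exact h1
  · intro i j h
    apply (hrbij i).1
    rw [← hfa]
    have := Scheme.Hom.appLE_comp_appLE (W i).ι ψ (ProjSpace.chart i) (W i) ⊤ h (hι i)
    simp only [coord, ← hψ]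
    rw [← this]
    rfl

end Morphism
end
end Lef

namespace Lef
noncomputable section
open Opposite TopologicalSpace

/-! ### Nonvanishing loci and global generation -/

section Nonvanishing
variable {X : Scheme.{0}} {M : X.Modules}

theorem mem_nonvanishingLocus {s : Γ(M, ⊤)} {x : X} :
    x ∈ nonvanishingLocus s ↔
      ∃ U : X.Opens, x ∈ U ∧ IsGenerator (res M (le_top : U ≤ ⊤) s) := by
  refine exists_congr fun U => and_congr_right fun _ => forall_congr' fun V => forall_congr'
    fun hV => ?_
  rw [restrictSection_eq, res_res]

/-- As r • e generates, e = t • (r • e) for some t, and cancelling the generator e gives t r = 1. -/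
theorem IsGenerator.isUnit {U : X.Opens} {e : Γ(M, U)} {r : Γ(X, U)} (he : IsGenerator e)
    (h : IsGenerator (r • e)) : IsUnit r := by
  obtain ⟨t, ht⟩ := (h U le_rfl).2 e
  have := (he U le_rfl).1 (a₁ := t * r) (a₂ := 1) (by
    simpa [mul_smul] using ht)
  exact IsUnit.of_mul_eq_one t ((mul_comm _ _).trans this)

/-- A global section as a compatible family of sections. -/
def globalSection (s : Γ(M, ⊤)) : SheafOfModules.sections (R := X.ringCatSheaf) M :=
  PresheafOfModules.sectionsMk (fun U => res M (le_top : U.unop ≤ ⊤) s)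
    fun _ _ f => res_res M le_top (leOfHom f.unop) s

/-- This is the epimorphism property behind global generation: near each point every section is a
multiple of some s_i. -/
theorem hom_ext_of_nonvanishing {I : Type} (s : I → Γ(M, ⊤))
    (h : ∀ x, ∃ i, x ∈ nonvanishingLocus (s i)) {P : X.Modules} {g g' : M ⟶ P}
    (key : ∀ i (U : X.Opens), g.app U (res M le_top (s i)) = g'.app U (res M le_top (s i))) :
    g = g' := by
  refine modules_hom_ext fun U m => ?_
  refine section_ext _ fun x hx => ?_
  obtain ⟨i, hi⟩ := h x
  obtain ⟨V, hV, hgen⟩ := mem_nonvanishingLocus.mp hi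
  refine ⟨U ⊓ V, inf_le_left, ⟨hx, hV⟩, ?_⟩
  obtain ⟨r, hr⟩ := (hgen (U ⊓ V) inf_le_right).2 (res M inf_le_left m)
  simp only [res_res] at hr
  rw [← app_res, ← app_res, ← hr, Scheme.Modules.Hom.app_smul, Scheme.Modules.Hom.app_smul, key]

/-- A sheaf with local generators among global sections is globally generated. -/
theorem isGloballyGenerated_of_nonvanishing {I : Type} (s : I → Γ(M, ⊤))
    (h : ∀ x, ∃ i, x ∈ nonvanishingLocus (s i)) : IsGloballyGenerated M := by
  refine ⟨⟨I, fun i => globalSection (s i), ⟨fun {P} g g' hg => ?_⟩⟩⟩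
  refine hom_ext_of_nonvanishing (P := P) s h fun i U => ?_
  have h1 := (SheafOfModules.freeHomEquiv_symm_comp (R := X.ringCatSheaf) (M := M) _ g).symm.trans
    (hg.trans (SheafOfModules.freeHomEquiv_symm_comp (R := X.ringCatSheaf) (M := M) _ g'))
  exact congrArg (fun t : P.sections => t.eval (op U))
    (congr_fun (P.freeHomEquiv.symm.injective h1) i)

end Nonvanishing

/-! ### The morphism of a linear system and the product of two such morphisms -/

section Pull
variable {X : Scheme.{0}} {ι : Type} (φ : X ⟶ ProjSpace ι)

/-- The pullback of the function `x_j / x_i`. -/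
def pullRatio (i j : ι) : Γ(X, φ ⁻¹ᵁ ProjSpace.chart i) :=
  pullO φ (ProjSpace.chart i) (ProjSpace.ratio i j)

theorem pullRatio_self (i : ι) : pullRatio φ i i = 1 := by
  rw [pullRatio, ratio_self, map_one]

theorem pullRatio_mul (i k j : ι) (U : X.Opens) (hi : U ≤ φ ⁻¹ᵁ ProjSpace.chart i)
    (hk : U ≤ φ ⁻¹ᵁ ProjSpace.chart k) :
    resO hi (pullRatio φ i k) * resO hk (pullRatio φ k j) = resO hi (pullRatio φ i j) := by
  have hU : U ≤ φ ⁻¹ᵁ (ProjSpace.chart i ⊓ ProjSpace.chart k) := le_inf hi hk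
  have h := congrArg (fun t => resO hU (pullO φ _ t))
    (ratio_mul_ratio i k j (ProjSpace.chart i ⊓ ProjSpace.chart k) inf_le_left inf_le_right)
  simp only [map_mul, ← resO_pullO, resO_resO] at h
  exact h

theorem preimage_chart_inf (i k : ι) :
    φ ⁻¹ᵁ ProjSpace.chart i ⊓ φ ⁻¹ᵁ ProjSpace.chart k = X.basicOpen (pullRatio φ i k) := by
  rw [pullRatio, pullO, ← Scheme.preimage_basicOpen, ← chart_inf]
  rfl

theorem exists_mem_preimage_chart (x : X) : ∃ i, x ∈ φ ⁻¹ᵁ ProjSpace.chart i := by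
  have h : φ x ∈ ⨆ i : ι, ProjSpace.chart i := by rw [iSup_chart]; trivial
  exact (Opens.mem_iSup (s := fun i : ι => ProjSpace.chart i)).mp h

variable {φ} {π : X ⟶ SpecC} {M : X.Modules} {s : ι → Γ(M, ⊤)}

theorem IsMorphismOfSections.exists_isGenerator (h : IsMorphismOfSections π M s φ) {i : ι} {x : X}
    (hx : x ∈ φ ⁻¹ᵁ ProjSpace.chart i) :
    ∃ U ≤ φ ⁻¹ᵁ ProjSpace.chart i, x ∈ U ∧ IsGenerator (res M (le_top : U ≤ ⊤) (s i)) := by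
  have h1 : x ∈ nonvanishingLocus (s i) := by rw [← h.preimage_chart]; exact hx
  obtain ⟨U, hU, hg⟩ := mem_nonvanishingLocus.mp h1
  refine ⟨U ⊓ φ ⁻¹ᵁ ProjSpace.chart i, inf_le_right, ⟨hU, hx⟩, ?_⟩
  simpa using hg.res (inf_le_left : U ⊓ φ ⁻¹ᵁ ProjSpace.chart i ≤ U)

theorem IsMorphismOfSections.exists_generator (h : IsMorphismOfSections π M s φ) (x : X) :
    ∃ (U : X.Opens) (e : Γ(M, U)), x ∈ U ∧ IsGenerator e := by
  obtain ⟨i, hi⟩ := exists_mem_preimage_chart φ x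
  obtain ⟨U, -, hU, he⟩ := h.exists_isGenerator hi
  exact ⟨U, _, hU, he⟩

theorem IsMorphismOfSections.pullRatio_smul (h : IsMorphismOfSections π M s φ) (i j : ι) :
    pullRatio φ i j • res M (le_top : φ ⁻¹ᵁ ProjSpace.chart i ≤ ⊤) (s i) =
      res M le_top (s j) := h.ratio_smul i j

theorem IsMorphismOfSections.resO_pullRatio_smul (h : IsMorphismOfSections π M s φ) (i j : ι)
    {U : X.Opens} (hU : U ≤ φ ⁻¹ᵁ ProjSpace.chart i) :
    resO hU (pullRatio φ i j) • res M (le_top : U ≤ ⊤) (s i) = res M le_top (s j) := by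
  have := congrArg (res M hU) (h.pullRatio_smul i j)
  simpa using this

end Pull

section Product
variable {X Y : Scheme.{0}} {πX : X ⟶ SpecC} {πY : Y ⟶ SpecC} {M : X.Modules} {N : Y.Modules}
  {ι κ : Type} {s : ι → Γ(M, ⊤)} {t : κ → Γ(N, ⊤)} {φ : X ⟶ ProjSpace ι} {χ : Y ⟶ ProjSpace κ}

theorem basicOpen_pullFst {U : X.Opens} (V : Y.Opens) (r : Γ(X, U)) :
    (prod πX πY).basicOpen (pullFst πX πY V r) = rect πX πY (X.basicOpen r) V := by
  rw [pullFst, RingHom.comp_apply, resO]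
  refine (Scheme.basicOpen_res _ _ _).trans ?_
  rw [pullO, ← Scheme.preimage_basicOpen]
  exact TopologicalSpace.Opens.ext <| Set.ext fun z => ⟨fun h => ⟨h.2, h.1.2⟩,
    fun h => ⟨⟨X.basicOpen_le r h.1, h.2⟩, h.1⟩⟩

theorem basicOpen_pullSnd (U : X.Opens) {V : Y.Opens} (r : Γ(Y, V)) :
    (prod πX πY).basicOpen (pullSnd πX πY U r) = rect πX πY U (Y.basicOpen r) := by
  rw [pullSnd, RingHom.comp_apply, resO]
  refine (Scheme.basicOpen_res _ _ _).trans ?_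
  rw [pullO, ← Scheme.preimage_basicOpen]
  exact TopologicalSpace.Opens.ext <| Set.ext fun z => ⟨fun h => ⟨h.1.1, h.2⟩,
    fun h => ⟨⟨h.1, Y.basicOpen_le r h.2⟩, h.2⟩⟩

variable (πX πY φ χ) in
/-- The product of two quotients of homogeneous coordinates. -/
def prodRatio (p q : ι × κ) :
    Γ(prod πX πY, rect πX πY (φ ⁻¹ᵁ ProjSpace.chart p.1) (χ ⁻¹ᵁ ProjSpace.chart p.2)) :=
  pullFst πX πY _ (pullRatio φ p.1 q.1) * pullSnd πX πY _ (pullRatio χ p.2 q.2)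

variable (πX πY φ χ) in
theorem basicOpen_prodRatio (p q : ι × κ) :
    rect πX πY (φ ⁻¹ᵁ ProjSpace.chart p.1) (χ ⁻¹ᵁ ProjSpace.chart p.2) ⊓
      rect πX πY (φ ⁻¹ᵁ ProjSpace.chart q.1) (χ ⁻¹ᵁ ProjSpace.chart q.2) =
        (prod πX πY).basicOpen (prodRatio πX πY φ χ p q) := by
  rw [prodRatio, Scheme.basicOpen_mul, basicOpen_pullFst, basicOpen_pullSnd,
    ← preimage_chart_inf, ← preimage_chart_inf]
  refine TopologicalSpace.Opens.ext (Set.ext fun z => ?_)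
  constructor
  · rintro ⟨⟨h1, h2⟩, h3, h4⟩
    exact ⟨⟨⟨h1, h3⟩, h2⟩, h1, h2, h4⟩
  · rintro ⟨⟨⟨h1, h3⟩, h2⟩, -, -, h4⟩
    exact ⟨⟨h1, h2⟩, h3, h4⟩

theorem resO_prodRatio_smul (h : IsMorphismOfSections πX M s φ)
    (h' : IsMorphismOfSections πY N t χ) (p q : ι × κ) {U : X.Opens} {V : Y.Opens}
    (hU : U ≤ φ ⁻¹ᵁ ProjSpace.chart p.1) (hV : V ≤ χ ⁻¹ᵁ ProjSpace.chart p.2) :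
    resO (rect_mono πX πY hU hV) (prodRatio πX πY φ χ p q) •
      res _ (le_top : rect πX πY U V ≤ ⊤) (boxTop πX πY (s p.1) (t p.2)) =
        res _ le_top (boxTop πX πY (s q.1) (t q.2)) := by
  rw [res_boxTop, res_boxTop, prodRatio, map_mul, resO_pullFst πX πY hU hV,
    resO_pullSnd πX πY hU hV, mul_smul,
    ← box_smul, ← smul_box, h.resO_pullRatio_smul, h'.resO_pullRatio_smul]

/-- The inclusion of the locus in the rectangle is the substantial one. If the section with index p
generates near z, compare it with a section of index (i, j) whose chart contains z: the two
generators differ by the product of ratios, which is a unit near z by `IsGenerator.isUnit`. Hence z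
lies in the basic open set of that product, and so in the rectangle of p. -/
theorem nonvanishingLocus_boxTop (h : IsMorphismOfSections πX M s φ)
    (h' : IsMorphismOfSections πY N t χ) (p : ι × κ) :
    nonvanishingLocus (boxTop πX πY (s p.1) (t p.2)) =
      (rect πX πY (φ ⁻¹ᵁ ProjSpace.chart p.1) (χ ⁻¹ᵁ ProjSpace.chart p.2) : Set (prod πX πY)) := by
  have key (q : ι × κ) (z : prod πX πY)
      (hz : z ∈ rect πX πY (φ ⁻¹ᵁ ProjSpace.chart q.1) (χ ⁻¹ᵁ ProjSpace.chart q.2)) :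
      ∃ (U : X.Opens) (V : Y.Opens) (_ : U ≤ φ ⁻¹ᵁ ProjSpace.chart q.1)
        (_ : V ≤ χ ⁻¹ᵁ ProjSpace.chart q.2), z ∈ rect πX πY U V ∧
        IsGenerator (res _ (le_top : rect πX πY U V ≤ ⊤) (boxTop πX πY (s q.1) (t q.2))) := by
    obtain ⟨U, hU, hzU, hgU⟩ := h.exists_isGenerator hz.1
    obtain ⟨V, hV, hzV, hgV⟩ := h'.exists_isGenerator hz.2
    refine ⟨U, V, hU, hV, ⟨hzU, hzV⟩, ?_⟩
    rw [res_boxTop]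
    exact hgU.box πX πY hgV
  refine Set.Subset.antisymm (fun z hz => ?_) fun z hz => ?_
  · obtain ⟨i, hi⟩ := exists_mem_preimage_chart φ (fst πX πY z)
    obtain ⟨j, hj⟩ := exists_mem_preimage_chart χ (snd πX πY z)
    obtain ⟨U, V, hU, hV, hzUV, hg⟩ := key (i, j) z ⟨hi, hj⟩
    obtain ⟨W, hW, hgW⟩ := mem_nonvanishingLocus.mp hz
    have h1 := hg.res (inf_le_left : rect πX πY U V ⊓ W ≤ _)
    have h2 := hgW.res (inf_le_right : rect πX πY U V ⊓ W ≤ _)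
    have h3 := congrArg (res _ (inf_le_left : rect πX πY U V ⊓ W ≤ _))
      (resO_prodRatio_smul h h' (i, j) p hU hV)
    rw [res_smul, resO_resO] at h3
    rw [res_res] at h2 h3
    rw [res_res] at h3
    rw [res_res] at h1
    rw [← h3] at h2
    have h4 := h1.isUnit h2
    have h5 := Scheme.basicOpen_of_isUnit (prod πX πY) h4
    have hz' : z ∈ (prod πX πY).basicOpen (prodRatio πX πY φ χ (i, j) p) := by
      have h6 : z ∈ rect πX πY U V ⊓ W := ⟨hzUV, hW⟩
      rw [← h5] at h6
      exact ((Scheme.basicOpen_res _ _ _).le h6).2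
    rw [← basicOpen_prodRatio] at hz'
    exact hz'.2
  · obtain ⟨U, V, -, -, hzUV, hg⟩ := key p z hz
    exact mem_nonvanishingLocus.mpr ⟨_, hzUV, hg⟩

/-- Glued from the products of ratios by `exists_hom_projSpace`. The last two conclusions record ψ
in coordinates, which is what `IsSegre` asks for. -/
theorem exists_isMorphismOfSections (h : IsMorphismOfSections πX M s φ)
    (h' : IsMorphismOfSections πY N t χ) :
    ∃ ψ : prod πX πY ⟶ ProjSpace (ι × κ),
      IsMorphismOfSections (prodToSpecC πX πY) (ext πX πY M N)
        (fun p : ι × κ => boxTop πX πY (s p.1) (t p.2)) ψ ∧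
      (∀ p, ψ ⁻¹ᵁ ProjSpace.chart p =
        rect πX πY (φ ⁻¹ᵁ ProjSpace.chart p.1) (χ ⁻¹ᵁ ProjSpace.chart p.2)) ∧
      ∀ p q hp, ψ.appLE (ProjSpace.chart p)
        (rect πX πY (φ ⁻¹ᵁ ProjSpace.chart p.1) (χ ⁻¹ᵁ ProjSpace.chart p.2)) hp
          (ProjSpace.ratio p q) = prodRatio πX πY φ χ p q := by
  have hcov : ⨆ p : ι × κ,
      rect πX πY (φ ⁻¹ᵁ ProjSpace.chart p.1) (χ ⁻¹ᵁ ProjSpace.chart p.2) = ⊤ := by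
    refine top_le_iff.mp fun z _ => ?_
    obtain ⟨i, hi⟩ := exists_mem_preimage_chart φ (fst πX πY z)
    obtain ⟨j, hj⟩ := exists_mem_preimage_chart χ (snd πX πY z)
    exact Opens.mem_iSup.mpr ⟨(i, j), hi, hj⟩
  have hself : ∀ p, prodRatio πX πY φ χ p p = 1 := by
    intro p
    rw [prodRatio, pullRatio_self, pullRatio_self, map_one, map_one, one_mul]
  have hmul : ∀ p q r, resO inf_le_left (prodRatio πX πY φ χ p q) *
      resO inf_le_right (prodRatio πX πY φ χ q r) = resO inf_le_left (prodRatio πX πY φ χ p r) := by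
    intro p q r
    have e : rect πX πY (φ ⁻¹ᵁ ProjSpace.chart p.1) (χ ⁻¹ᵁ ProjSpace.chart p.2) ⊓
      rect πX πY (φ ⁻¹ᵁ ProjSpace.chart q.1) (χ ⁻¹ᵁ ProjSpace.chart q.2) ≤
      rect πX πY (φ ⁻¹ᵁ ProjSpace.chart p.1 ⊓ φ ⁻¹ᵁ ProjSpace.chart q.1)
        (χ ⁻¹ᵁ ProjSpace.chart p.2 ⊓ χ ⁻¹ᵁ ProjSpace.chart q.2) :=
      fun z hz => ⟨⟨hz.1.1, hz.2.1⟩, hz.1.2, hz.2.2⟩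
    have h1 := pullRatio_mul φ p.1 q.1 r.1 _ inf_le_left inf_le_right
    have h2 := pullRatio_mul χ p.2 q.2 r.2 _ inf_le_left inf_le_right
    have h3 := congrArg₂ (fun a b => resO e (pullFst πX πY _ a * pullSnd πX πY _ b)) h1 h2
    simp only [map_mul, ← resO_pullFst πX πY inf_le_left inf_le_left,
      ← resO_pullFst πX πY inf_le_right inf_le_right, ← resO_pullSnd πX πY inf_le_left inf_le_left,
      ← resO_pullSnd πX πY inf_le_right inf_le_right, resO_resO] at h3
    simp only [prodRatio, map_mul]
    rw [← h3]
    ring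
  obtain ⟨ψ, h1, h2, h3⟩ := exists_hom_projSpace (prodToSpecC πX πY)
    (fun p : ι × κ => rect πX πY (φ ⁻¹ᵁ ProjSpace.chart p.1) (χ ⁻¹ᵁ ProjSpace.chart p.2)) hcov
    (prodRatio πX πY φ χ) hself hmul (basicOpen_prodRatio πX πY φ χ)
  · refine ⟨ψ, ⟨h1, fun p => ?_, fun p q => ?_⟩, h2, h3⟩
    · rw [h2, nonvanishingLocus_boxTop h h']
    · have hp := (h2 p).ge
      have h4 := h3 p q hp
      rw [Scheme.Hom.appLE, CommRingCat.comp_apply] at h4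
      rw [restrictSection_eq, restrictSection_eq]
      have h5 := resO_prodRatio_smul h h' p q le_rfl le_rfl
      rw [resO_self, ← h4] at h5
      have h6 := congrArg (res _ (h2 p).le) h5
      rw [res_smul, res_res, res_res] at h6
      rw [← h6]
      congr 1
      exact ((resO_resO hp (h2 p).le _).trans (resO_self _ _)).symm

end Product
end
end Lef

namespace Lef
noncomputable section
open Opposite TopologicalSpace

/-! ### Krull dimension through chains of specializations -/

section Chains
variable {α β : Type} [TopologicalSpace α] [TopologicalSpace β]

/-- There is a chain of `n` strict specializations in `S` starting at `x`. -/
def HasChain (S : Set α) : ℕ → α → Prop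
  | 0, x => x ∈ S
  | n + 1, x => x ∈ S ∧ ∃ y, x ⤳ y ∧ ¬ y ⤳ x ∧ HasChain S n y

theorem HasChain.mem {S : Set α} {n : ℕ} {x : α} (h : HasChain S n x) : x ∈ S := by
  cases n with
  | zero => exact h
  | succ n => exact h.1

/-- The irreducible closed set with a given generic point. -/
def irredClosure (x : α) : IrreducibleCloseds α :=
  ⟨closure {x}, isIrreducible_singleton.closure, isClosed_closure⟩

theorem irredClosure_le {x y : α} : irredClosure y ≤ irredClosure x ↔ x ⤳ y := by
  rw [specializes_iff_closure_subset]; rfl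

theorem exists_eq_irredClosure [QuasiSober α] (Z : IrreducibleCloseds α) :
    ∃ x, Z = irredClosure x := by
  obtain ⟨x, hx⟩ := QuasiSober.sober Z.isIrreducible Z.isClosed
  exact ⟨x, IrreducibleCloseds.ext hx.def.symm⟩

/-- In a quasi-sober space every irreducible closed set has a generic point, and strict inclusion of
closures is strict specialization. -/
theorem hasChain_univ_iff [QuasiSober α] (n : ℕ) (x : α) :
    HasChain Set.univ n x ↔ (n : ℕ∞) ≤ Order.height (irredClosure x) := by
  induction n generalizing x with
  | zero => simp [HasChain]
  | succ n ih =>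
    have h1 : ((n + 1 : ℕ) : ℕ∞) ≤ Order.height (irredClosure x) ↔
        ∃ b < irredClosure x, (n : ℕ∞) ≤ Order.height b := by
      constructor
      · intro h
        by_contra! hc
        have := Order.height_le_coe_iff.not.mp (not_le.mpr
          (lt_of_lt_of_le (by exact_mod_cast Nat.lt_succ_self n) h))
        push Not at this
        obtain ⟨b, hb, hb'⟩ := this
        exact absurd hb' (not_le.mpr (hc b hb))
      · rintro ⟨b, hb, hn⟩
        push_cast
        exact (add_le_add_left hn 1).trans (Order.height_add_one_le hb)
    rw [h1]
    constructor
    · rintro ⟨-, y, hxy, hyx, hy⟩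
      exact ⟨irredClosure y, lt_of_le_not_ge (irredClosure_le.mpr hxy)
        (fun h => hyx (irredClosure_le.mp h)), (ih y).mp hy⟩
    · rintro ⟨b, hb, hn⟩
      obtain ⟨y, rfl⟩ := exists_eq_irredClosure b
      exact ⟨trivial, y, irredClosure_le.mp hb.le, fun h => hb.not_ge (irredClosure_le.mpr h),
        (ih y).mpr hn⟩

theorem le_topologicalKrullDim_iff [QuasiSober α] {n : ℕ} :
    (n : WithBot ℕ∞) ≤ topologicalKrullDim α ↔ ∃ x : α, HasChain Set.univ n x := by
  constructor
  · intro h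
    obtain ⟨l, hl⟩ := Order.le_krullDim_iff.mp h
    obtain ⟨x, hx⟩ := exists_eq_irredClosure l.last
    refine ⟨x, (hasChain_univ_iff n x).mpr ?_⟩
    rw [← hx, ← hl]
    exact Order.length_le_height_last
  · rintro ⟨x, hx⟩
    have h := (hasChain_univ_iff n x).mp hx
    exact (WithBot.coe_le_coe.mpr h).trans (Order.height_le_krullDim _)

theorem hasChain_subtype_iff {S : Set α} {n : ℕ} (x : S) :
    HasChain (Set.univ : Set S) n x ↔ HasChain S n (x : α) := by
  induction n generalizing x with
  | zero => simp [HasChain]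
  | succ n ih =>
    constructor
    · rintro ⟨-, y, hxy, hyx, hy⟩
      exact ⟨x.2, y, (subtype_specializes_iff x y).mp hxy,
        fun h => hyx ((subtype_specializes_iff y x).mpr h),
        (ih y).mp hy⟩
    · rintro ⟨-, y, hxy, hyx, hy⟩
      exact ⟨trivial, ⟨y, hy.mem⟩, (subtype_specializes_iff x ⟨y, hy.mem⟩).mpr hxy,
        fun h => hyx ((subtype_specializes_iff ⟨y, hy.mem⟩ x).mp h), (ih ⟨y, hy.mem⟩).mpr hy⟩

theorem le_topologicalKrullDim_subtype_iff {S : Set α} [QuasiSober S] {n : ℕ} :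
    (n : WithBot ℕ∞) ≤ topologicalKrullDim S ↔ ∃ x : α, HasChain S n x := by
  rw [le_topologicalKrullDim_iff]
  exact ⟨fun ⟨x, hx⟩ => ⟨x, (hasChain_subtype_iff x).mp hx⟩,
    fun ⟨x, hx⟩ => ⟨⟨x, hx.mem⟩, (hasChain_subtype_iff ⟨x, hx.mem⟩).mpr hx⟩⟩

/-- A chain of specializations lies in each neighbourhood of its last point. -/
theorem HasChain.exists_forall_isOpen {S : Set α} {n : ℕ} {x : α} (h : HasChain S n x) :
    ∃ z ∈ S, x ⤳ z ∧ ∀ U : Set α, IsOpen U → z ∈ U → HasChain (S ∩ U) n x := by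
  induction n generalizing x with
  | zero => exact ⟨x, h, specializes_rfl, fun U _ hz => ⟨h, hz⟩⟩
  | succ n ih =>
    obtain ⟨hx, y, hxy, hyx, hy⟩ := h
    obtain ⟨z, hzS, hyz, hz⟩ := ih hy
    -- All members of the chain specialize to z, and open sets are stable under generization.
    exact ⟨z, hzS, hxy.trans hyz, fun U hU hzU =>
      ⟨⟨hx, (hxy.trans hyz).mem_open hU hzU⟩, y, hxy, hyx, hz U hU hzU⟩⟩

/-- Chains of specializations lift along closed maps. -/
theorem HasChain.of_image {f : α → β} (hf : Continuous f) (hc : IsClosedMap f) {S : Set α}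
    (hS : IsClosed S) {n : ℕ} {x : α} (hx : x ∈ S) (h : HasChain (f '' S) n (f x)) :
    HasChain S n x := by
  induction n generalizing x with
  | zero => exact hx
  | succ n ih =>
    obtain ⟨-, y, hxy, hyx, hy⟩ := h
    obtain ⟨x', hx', rfl⟩ := hc.specializingMap hxy
    exact ⟨hx, x', hx', fun h' => hyx (h'.map hf), ih (hx'.mem_closed hS hx) hy⟩

theorem le_of_forall_natCast_le {a b : WithBot ℕ∞} (h : ∀ n : ℕ, (n : WithBot ℕ∞) ≤ a → (n : WithBot ℕ∞) ≤ b) :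
    a ≤ b := by
  induction a using WithBot.recBotCoe with
  | bot => exact bot_le
  | coe a =>
    have h0 := h 0 (by exact_mod_cast zero_le)
    induction b using WithBot.recBotCoe with
    | bot => simp at h0
    | coe b =>
      refine WithBot.coe_le_coe.mpr (ENat.forall_natCast_le_iff_le.mp fun n hn => ?_)
      exact WithBot.coe_le_coe.mp (h n (WithBot.coe_le_coe.mpr hn))

/-- A chain in the image lifts step by step, since specializations lift along closed maps and S is
stable under specialization; strictness is preserved by continuity. -/
theorem topologicalKrullDim_image_le [QuasiSober α] [QuasiSober β] {f : α → β}
    (hf : Continuous f) (hc : IsClosedMap f) {S : Set α} (hS : IsClosed S) :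
    topologicalKrullDim (f '' S) ≤ topologicalKrullDim S := by
  have : QuasiSober S := hS.isClosedEmbedding_subtypeVal.quasiSober
  have : QuasiSober (f '' S) := (hc S hS).isClosedEmbedding_subtypeVal.quasiSober
  refine le_of_forall_natCast_le fun n hn => ?_
  obtain ⟨y, hy⟩ := le_topologicalKrullDim_subtype_iff.mp hn
  obtain ⟨x, hx, rfl⟩ := hy.mem
  exact le_topologicalKrullDim_subtype_iff.mpr ⟨x, hy.of_image hf hc hS hx⟩

theorem topologicalKrullDim_subset_le {S T : Set α} (h : S ⊆ T) :
    topologicalKrullDim S ≤ topologicalKrullDim T :=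
  (Topology.IsEmbedding.inclusion h).isInducing.topologicalKrullDim_le

theorem topologicalKrullDim_le_zero_of_finite {S : Set α} (hS : S.Finite)
    (h : ∀ x ∈ S, IsClosed {x}) : topologicalKrullDim S ≤ 0 := by
  have : Finite S := hS
  have : T1Space S := ⟨fun x => by
    have := (h x x.2).preimage (continuous_subtype_val (p := (· ∈ S)))
    convert this using 1
    ext y; simp [Subtype.ext_iff]⟩
  exact topologicalKrullDim_zero_of_discreteTopology S

/-- A zero-dimensional set of closed points in a Noetherian space is finite. -/
theorem finite_of_topologicalKrullDim_le_zero [NoetherianSpace α] {S : Set α}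
    (h : ∀ x ∈ S, IsClosed {x}) (hd : topologicalKrullDim S ≤ 0) : S.Finite := by
  have h1 : T1Space S := ⟨fun x => by
    have := (h x x.2).preimage (continuous_subtype_val (p := (· ∈ S)))
    convert this using 1
    ext y; simp [Subtype.ext_iff]⟩
  have : NoetherianSpace S := Topology.IsInducing.subtypeVal.noetherianSpace
  -- In dimension zero an irreducible closed set is the closure of each of its points. As points are
  -- closed, distinct points have distinct irreducible components, of which a Noetherian space has
  -- finitely many.
  have key (Z : IrreducibleCloseds S) (x : S) (hx : x ∈ Z) : irredClosure x = Z := by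
    by_contra hne
    have hle : irredClosure x ≤ Z := closure_minimal (Set.singleton_subset_iff.mpr hx) Z.isClosed
    have h2 : 1 ≤ topologicalKrullDim S :=
      Order.one_le_krullDim_iff.mpr ⟨_, _, lt_of_le_of_ne hle hne⟩
    exact absurd (h2.trans hd) (by decide)
  have hfin := NoetherianSpace.finite_irreducibleComponents (α := S)
  have hinj : Function.Injective (irreducibleComponent : S → Set S) := by
    intro x y hxy
    have hx := key ⟨_, isIrreducible_irreducibleComponent, isClosed_irreducibleComponent⟩ x
      mem_irreducibleComponent
    have hy := key ⟨_, isIrreducible_irreducibleComponent, isClosed_irreducibleComponent⟩ y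
      mem_irreducibleComponent
    have h3 : (irredClosure x : Set S) = irredClosure y := by
      rw [hx, hy]; exact hxy
    change closure {x} = closure {y} at h3
    rwa [closure_singleton, closure_singleton, Set.singleton_eq_singleton_iff] at h3
  have : Finite (irreducibleComponents S) := hfin
  have : Finite S := Finite.of_injective
    (fun x : S => (⟨irreducibleComponent x, irreducibleComponent_mem_irreducibleComponents x⟩ :
      irreducibleComponents S)) fun x y h => hinj (Subtype.ext_iff.mp h)
  exact Set.toFinite S

end Chains

/-! ### Dimension of tensor products of finitely generated algebras -/

section Algebra

theorem ringKrullDim_le_of_isIntegral (A B : Type) [CommRing A] [CommRing B] [Algebra A B]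
    [Algebra.IsIntegral A B] : ringKrullDim B ≤ ringKrullDim A := by
  refine Order.krullDim_le_of_strictMono (fun P : PrimeSpectrum B => PrimeSpectrum.comap (algebraMap A B) P)
    fun P Q h => ?_
  exact Ideal.IsIntegral.comap_lt_comap h

/-- One inequality is incomparability. For the other, Spec B → Spec A is closed by integrality and
surjective by lying over, so `topologicalKrullDim_image_le` applies. -/
theorem ringKrullDim_eq_of_isIntegral (A B : Type) [CommRing A] [CommRing B] [Algebra A B]
    [Algebra.IsIntegral A B] (hinj : Function.Injective (algebraMap A B)) :
    ringKrullDim B = ringKrullDim A := by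
  refine le_antisymm (ringKrullDim_le_of_isIntegral A B) ?_
  rw [← PrimeSpectrum.topologicalKrullDim_eq_ringKrullDim, ← PrimeSpectrum.topologicalKrullDim_eq_ringKrullDim]
  have h1 : IsClosedMap (PrimeSpectrum.comap (algebraMap A B)) :=
    PrimeSpectrum.isClosedMap_comap_of_isIntegral _ (algebraMap_isIntegral_iff.mpr inferInstance)
  have h2 : PrimeSpectrum.comap (algebraMap A B) '' Set.univ = Set.univ := by
    rw [Set.image_univ, Set.range_eq_univ]
    intro P
    obtain ⟨Q, -, hQ, h⟩ := Ideal.exists_ideal_over_prime_of_isIntegral (S := B) P.asIdeal ⊥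
      (by
        change RingHom.ker (algebraMap A B) ≤ _
        rw [(RingHom.injective_iff_ker_eq_bot _).mp hinj]; exact bot_le)
    exact ⟨⟨Q, hQ⟩, PrimeSpectrum.ext h⟩
  have h3 := topologicalKrullDim_image_le (PrimeSpectrum.continuous_comap (algebraMap A B)) h1
    isClosed_univ
  rw [h2] at h3
  have h4 {α : Type} [TopologicalSpace α] :
      topologicalKrullDim (Set.univ : Set α) = topologicalKrullDim α :=
    IsHomeomorph.topologicalKrullDim_eq _ (Homeomorph.Set.univ α).isHomeomorph
  rwa [h4, h4] at h3

-- Noether normalization presents A and B as integral over polynomial rings in m and n variables.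
-- The tensor product of the two inclusions is injective by flatness and again integral, so the
-- dimension is that of a polynomial ring in m + n variables. The zero ring, of dimension ⊥, is
-- treated apart.
open TensorProduct in
theorem ringKrullDim_tensorProduct (A B : Type) [CommRing A] [CommRing B] [Algebra ℂ A]
    [Algebra ℂ B] [Algebra.FiniteType ℂ A] [Algebra.FiniteType ℂ B] :
    ringKrullDim (A ⊗[ℂ] B) = ringKrullDim A + ringKrullDim B := by
  by_cases hA : Nontrivial A
  swap
  · have := not_nontrivial_iff_subsingleton.mp hA
    have : Subsingleton (A ⊗[ℂ] B) := Algebra.TensorProduct.includeLeftRingHom.codomain_trivial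
    rw [ringKrullDim_eq_bot_of_subsingleton, ringKrullDim_eq_bot_of_subsingleton, WithBot.bot_add]
  by_cases hB : Nontrivial B
  swap
  · have := not_nontrivial_iff_subsingleton.mp hB
    have : Subsingleton (A ⊗[ℂ] B) :=
      (Algebra.TensorProduct.includeRight : B →ₐ[ℂ] A ⊗[ℂ] B).toRingHom.codomain_trivial
    rw [ringKrullDim_eq_bot_of_subsingleton, ringKrullDim_eq_bot_of_subsingleton (R := B),
      WithBot.add_bot]
  obtain ⟨m, f, hf, hf'⟩ := exists_integral_inj_algHom_of_fg ℂ A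
  obtain ⟨n, g, hg, hg'⟩ := exists_integral_inj_algHom_of_fg ℂ B
  have hAd : ringKrullDim A = m := by
    let _ := f.toRingHom.toAlgebra
    have : Algebra.IsIntegral (MvPolynomial (Fin m) ℂ) A := ⟨hf'⟩
    rw [ringKrullDim_eq_of_isIntegral (MvPolynomial (Fin m) ℂ) A hf]
    simp
  have hBd : ringKrullDim B = n := by
    let _ := g.toRingHom.toAlgebra
    have : Algebra.IsIntegral (MvPolynomial (Fin n) ℂ) B := ⟨hg'⟩
    rw [ringKrullDim_eq_of_isIntegral (MvPolynomial (Fin n) ℂ) B hg]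
    simp
  let F := Algebra.TensorProduct.map f g
  have hF : Function.Injective F :=
    TensorProduct.map_injective_of_flat_flat f.toLinearMap g.toLinearMap hf hg
  let _ := F.toRingHom.toAlgebra
  have h1 (a : A) : IsIntegral (MvPolynomial (Fin m) ℂ ⊗[ℂ] MvPolynomial (Fin n) ℂ)
      (a ⊗ₜ[ℂ] (1 : B)) := by
    let _ := f.toRingHom.toAlgebra
    have ha : IsIntegral (MvPolynomial (Fin m) ℂ) a := hf' a
    exact ha.map_of_comp_eq (Algebra.TensorProduct.includeLeftRingHom)
      (Algebra.TensorProduct.includeLeftRingHom : A →+* A ⊗[ℂ] B) (by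
        ext x <;> simp [RingHom.algebraMap_toAlgebra, F])
  have h2 (b : B) : IsIntegral (MvPolynomial (Fin m) ℂ ⊗[ℂ] MvPolynomial (Fin n) ℂ)
      ((1 : A) ⊗ₜ[ℂ] b) := by
    let _ := g.toRingHom.toAlgebra
    have hb : IsIntegral (MvPolynomial (Fin n) ℂ) b := hg' b
    exact hb.map_of_comp_eq
      (Algebra.TensorProduct.includeRight : _ →ₐ[ℂ] MvPolynomial (Fin m) ℂ ⊗[ℂ] _).toRingHom
      (Algebra.TensorProduct.includeRight : B →ₐ[ℂ] A ⊗[ℂ] B).toRingHom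
      (RingHom.ext fun x => by
        change F ((1 : MvPolynomial (Fin m) ℂ) ⊗ₜ x) = (1 : A) ⊗ₜ g x
        simp [F])
  have : Algebra.IsIntegral (MvPolynomial (Fin m) ℂ ⊗[ℂ] MvPolynomial (Fin n) ℂ) (A ⊗[ℂ] B) := by
    refine ⟨fun z => ?_⟩
    induction z using TensorProduct.induction_on with
    | zero => exact isIntegral_zero
    | tmul a b =>
      have := (h1 a).mul (h2 b)
      rwa [Algebra.TensorProduct.tmul_mul_tmul, mul_one, one_mul] at this
    | add x y hx hy => exact hx.add hy
  rw [ringKrullDim_eq_of_isIntegral (MvPolynomial (Fin m) ℂ ⊗[ℂ] MvPolynomial (Fin n) ℂ)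
    (A ⊗[ℂ] B) hF, hAd, hBd, ringKrullDim_eq_of_ringEquiv
      (MvPolynomial.algebraTensorAlgEquiv ℂ (MvPolynomial (Fin m) ℂ)).toRingEquiv,
    MvPolynomial.ringKrullDim_of_isNoetherianRing, MvPolynomial.ringKrullDim_of_isNoetherianRing]
  simp

end Algebra
end
end Lef

namespace Lef
noncomputable section
open Opposite TopologicalSpace

/-! ### Dimension of products of schemes over ℂ -/

section ProductDim
variable {X Y : Scheme.{0}}

theorem topologicalKrullDim_affine {U : X.Opens} (hU : IsAffineOpen U) :
    topologicalKrullDim U = ringKrullDim Γ(X, U) := by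
  rw [← PrimeSpectrum.topologicalKrullDim_eq_ringKrullDim]
  exact IsHomeomorph.topologicalKrullDim_eq _ hU.isoSpec.hom.homeomorph.isHomeomorph

theorem finiteType_algO (πX : X ⟶ SpecC) [LocallyOfFiniteType πX] {U : X.Opens}
    (hU : IsAffineOpen U) :
    letI := algO πX U
    Algebra.FiniteType ℂ Γ(X, U) := by
  let _ := algO πX U
  have h1 := πX.finiteType_appLE (isAffineOpen_top _) hU (by simp)
  have h2 : ((Scheme.ΓSpecIso (CommRingCat.of ℂ)).inv.hom).FiniteType :=
    RingHom.FiniteType.of_surjective _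
      (Scheme.ΓSpecIso (CommRingCat.of ℂ)).symm.commRingCatIsoToRingEquiv.surjective
  exact RingHom.finiteType_algebraMap.mp (h1.comp h2)

variable (πX : X ⟶ SpecC) (πY : Y ⟶ SpecC)

theorem isAffineOpen_rect {U : X.Opens} {V : Y.Opens} (hU : IsAffineOpen U)
    (hV : IsAffineOpen V) : IsAffineOpen (rect πX πY U V) := by
  have : IsAffine U := hU
  have : IsAffine V := hV
  let j := Limits.pullback.map (U.ι ≫ πX) (V.ι ≫ πY) πX πY U.ι V.ι (𝟙 _) (by simp) (by simp)
  have hj : IsOpenImmersion j := inferInstance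
  have h : j.opensRange = rect πX πY U V := by
    refine TopologicalSpace.Opens.ext ?_
    have := Scheme.Pullback.range_map (U.ι ≫ πX) (V.ι ≫ πY) πX πY U.ι V.ι (𝟙 _) (by simp) (by simp)
    rw [Scheme.Opens.range_ι, Scheme.Opens.range_ι] at this
    exact this
  rw [← h]
  exact isAffineOpen_opensRange j

variable [LocallyOfFiniteType πX] [LocallyOfFiniteType πY]

theorem topologicalKrullDim_rect {U : X.Opens} {V : Y.Opens} (hU : IsAffineOpen U)
    (hV : IsAffineOpen V) :
    topologicalKrullDim (rect πX πY U V) = topologicalKrullDim U + topologicalKrullDim V := by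
  let _ := algO πX U
  let _ := algO πY V
  have := finiteType_algO πX hU
  have := finiteType_algO πY hV
  obtain ⟨e, -⟩ := exists_kunneth_affine πX πY hU hV
  rw [topologicalKrullDim_affine hU, topologicalKrullDim_affine hV,
    topologicalKrullDim_affine (isAffineOpen_rect πX πY hU hV), ← ringKrullDim_tensorProduct,
    ringKrullDim_eq_of_ringEquiv e]

/-- Any affine neighbourhood of the last point of a chain contains the whole chain. -/
theorem exists_isAffineOpen_le_dim {n : ℕ} (h : (n : WithBot ℕ∞) ≤ topologicalKrullDim X) :
    ∃ U : X.Opens, IsAffineOpen U ∧ (n : WithBot ℕ∞) ≤ topologicalKrullDim U := by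
  obtain ⟨x, hx⟩ := le_topologicalKrullDim_iff.mp h
  obtain ⟨z, -, -, hz⟩ := hx.exists_forall_isOpen
  obtain ⟨U, hU, hzU, -⟩ := Opens.isBasis_iff_nbhd.mp X.isBasis_affineOpens
    (show z ∈ (⊤ : X.Opens) from trivial)
  have : QuasiSober (U : Set X) := U.isOpenEmbedding'.quasiSober
  refine ⟨U, hU, ?_⟩
  have := hz U U.isOpen hzU
  rw [Set.univ_inter] at this
  exact (le_topologicalKrullDim_subtype_iff (S := (U : Set X))).mpr ⟨x, this⟩

theorem le_topologicalKrullDim_prod {m n : ℕ} (hm : (m : WithBot ℕ∞) ≤ topologicalKrullDim X)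
    (hn : (n : WithBot ℕ∞) ≤ topologicalKrullDim Y) :
    ((m + n : ℕ) : WithBot ℕ∞) ≤ topologicalKrullDim (prod πX πY) := by
  obtain ⟨U, hU, hmU⟩ := exists_isAffineOpen_le_dim hm
  obtain ⟨V, hV, hnV⟩ := exists_isAffineOpen_le_dim hn
  have h := topologicalKrullDim_rect πX πY hU hV
  calc _ = (m : WithBot ℕ∞) + n := by push_cast; rfl
    _ ≤ _ := add_le_add hmU hnV
    _ = _ := h.symm
    _ ≤ _ := topologicalKrullDim_subspace_le _ _

/-- A chain in the product lies in a rectangle of affine neighbourhoods of the projections of its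
last point, where `topologicalKrullDim_rect` applies. -/
theorem topologicalKrullDim_prod_le :
    topologicalKrullDim (prod πX πY) ≤ topologicalKrullDim X + topologicalKrullDim Y := by
  refine le_of_forall_natCast_le fun n hn => ?_
  obtain ⟨x, hx⟩ := le_topologicalKrullDim_iff.mp hn
  obtain ⟨z, -, -, hz⟩ := hx.exists_forall_isOpen
  obtain ⟨U, hU, hzU, -⟩ := Opens.isBasis_iff_nbhd.mp X.isBasis_affineOpens
    (show fst πX πY z ∈ (⊤ : X.Opens) from trivial)
  obtain ⟨V, hV, hzV, -⟩ := Opens.isBasis_iff_nbhd.mp Y.isBasis_affineOpens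
    (show snd πX πY z ∈ (⊤ : Y.Opens) from trivial)
  have : QuasiSober (rect πX πY U V : Set (prod πX πY)) :=
    (rect πX πY U V).isOpenEmbedding'.quasiSober
  have h1 := hz (rect πX πY U V) (rect πX πY U V).isOpen ⟨hzU, hzV⟩
  rw [Set.univ_inter] at h1
  refine ((le_topologicalKrullDim_subtype_iff (S := (rect πX πY U V : Set (prod πX πY)))).mpr
    ⟨x, h1⟩).trans ?_
  refine (topologicalKrullDim_rect πX πY hU hV).le.trans ?_
  exact add_le_add (topologicalKrullDim_subspace_le _ _) (topologicalKrullDim_subspace_le _ _)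

theorem exists_isClosedImmersion_range {F : Set X} (hF : IsClosed F) :
    ∃ (F' : Scheme.{0}) (i : F' ⟶ X), IsClosedImmersion i ∧ Set.range i = F := by
  let I := Scheme.IdealSheafData.vanishingIdeal (⟨F, hF⟩ : Closeds X)
  refine ⟨I.subscheme, I.subschemeι, inferInstance, ?_⟩
  rw [Scheme.IdealSheafData.range_subschemeι]
  simp [I]

theorem topologicalKrullDim_range {F : Scheme.{0}} (i : F ⟶ X) [IsClosedImmersion i] :
    topologicalKrullDim (Set.range i) = topologicalKrullDim F :=
  (IsHomeomorph.topologicalKrullDim_eq _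
    i.isClosedEmbedding.isEmbedding.toHomeomorph.isHomeomorph).symm

/-- The dimension of a product of closed sets is at most the sum of their dimensions. -/
theorem topologicalKrullDim_inter_le {F : Set X} {G : Set Y} (hF : IsClosed F) (hG : IsClosed G) :
    topologicalKrullDim ↑(fst πX πY ⁻¹' F ∩ snd πX πY ⁻¹' G) ≤
      topologicalKrullDim F + topologicalKrullDim G := by
  obtain ⟨F', i, hi, rfl⟩ := exists_isClosedImmersion_range hF
  obtain ⟨G', j, hj, rfl⟩ := exists_isClosedImmersion_range hG
  -- The product of the two closed subschemes maps by a closed immersion onto the set in question,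
  -- which reduces the claim to `topologicalKrullDim_prod_le`.
  let k := Limits.pullback.map (i ≫ πX) (j ≫ πY) πX πY i j (𝟙 _) (by simp) (by simp)
  have hcomp : MorphismProperty.IsStableUnderComposition
      (@IsClosedImmersion : MorphismProperty Scheme.{0}) :=
    ⟨fun f g (_ : IsClosedImmersion f) (_ : IsClosedImmersion g) =>
      (inferInstance : IsClosedImmersion (f ≫ g))⟩
  have hk : IsClosedImmersion k :=
    MorphismProperty.pullbackMap (P := (@IsClosedImmersion : MorphismProperty Scheme.{0})) hi hj rfl rfl
  have h : Set.range k = fst πX πY ⁻¹' Set.range i ∩ snd πX πY ⁻¹' Set.range j :=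
    Scheme.Pullback.range_map (i ≫ πX) (j ≫ πY) πX πY i j (𝟙 _) (by simp) (by simp)
  rw [← h, topologicalKrullDim_range, topologicalKrullDim_range, topologicalKrullDim_range]
  exact topologicalKrullDim_prod_le (i ≫ πX) (j ≫ πY)

end ProductDim
end
end Lef

namespace Lef
noncomputable section
open Opposite TopologicalSpace

/-! ### Properness and complex points -/

section Proper

theorem isSeparated_toSpecC (ι : Type) : IsSeparated (ProjSpace.toSpecC ι) := by
  rw [ProjSpace.toSpecC]; infer_instance

theorem bijective_algebraMap_grading (ι : Type) :
    Function.Bijective (algebraMap ℂ (grading ι 0)) := by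
  constructor
  · intro a b h
    exact MvPolynomial.C_injective ι ℂ (congrArg Subtype.val h)
  · rintro ⟨p, hp⟩
    have h := MvPolynomial.totalDegree_eq_zero_iff_eq_C.mp
      ((MvPolynomial.totalDegree_zero_iff_isHomogeneous (p := p)).mpr
        ((MvPolynomial.mem_homogeneousSubmodule 0 p).mp hp))
    exact ⟨p.coeff 0, Subtype.ext h.symm⟩

/-- Proj of an algebra of finite type over its degree zero part is proper over that part, which here
is ℂ. -/
theorem isProper_toSpecC (ι : Type) [Finite ι] : IsProper (ProjSpace.toSpecC ι) := by
  have : IsScalarTower ℂ (grading ι 0) (MvPolynomial ι ℂ) :=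
    ⟨fun c a x => smul_mul_assoc c (a : MvPolynomial ι ℂ) x⟩
  have : Algebra.FiniteType (grading ι 0) (MvPolynomial ι ℂ) :=
    Algebra.FiniteType.of_restrictScalars_finiteType ℂ _ _
  have : IsIso (CommRingCat.ofHom (algebraMap ℂ (grading ι 0))) :=
    (ConcreteCategory.isIso_iff_bijective _).mpr (bijective_algebraMap_grading ι)
  rw [ProjSpace.toSpecC]
  infer_instance

theorem IsNonsingularProjectiveVariety.isProper {X : Scheme.{0}} {π : X ⟶ SpecC}
    (h : IsNonsingularProjectiveVariety π) : IsProper π := by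
  obtain ⟨n, i, hi, rfl⟩ := h.projective
  have := isProper_toSpecC (Fin (n + 1))
  infer_instance

end Proper

section Points
variable {ι : Type}

instance : Unique SpecC := inferInstanceAs (Unique (PrimeSpectrum ℂ))

theorem top_le_of_mem {Z : Scheme.{0}} (f : SpecC ⟶ Z) {U : Z.Opens} {x : SpecC} (h : f x ∈ U) :
    ⊤ ≤ f ⁻¹ᵁ U := fun y _ => by
  rw [Subsingleton.elim y x]; exact h

theorem appLE_scal {X Z : Scheme.{0}} (f : Z ⟶ X) (π : X ⟶ SpecC) (U : X.Opens)
    (h : ⊤ ≤ f ⁻¹ᵁ U) (c : ℂ) : f.appLE U ⊤ h (scal π U c) = scal (f ≫ π) ⊤ c :=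
  (congrArg (resO h) (pullO_scal π f U c)).trans (resO_scal _ _ _)

theorem scal_id_surjective (s : Γ(SpecC, ⊤)) : ∃ c, scal (𝟙 SpecC) ⊤ c = s := by
  refine ⟨(Scheme.ΓSpecIso (CommRingCat.of ℂ)).hom s, ?_⟩
  simp only [scal, RingHom.comp_apply, resO_self, Scheme.Hom.id_appTop, CommRingCat.hom_id,
    RingHom.id_apply]
  exact ConcreteCategory.congr_hom (Scheme.ΓSpecIso (CommRingCat.of ℂ)).hom_inv_id s

theorem preimage_basicOpen_appLE {X Z : Scheme.{0}} (f : Z ⟶ X) (U : X.Opens) (h : ⊤ ≤ f ⁻¹ᵁ U)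
    (r : Γ(X, U)) : f ⁻¹ᵁ X.basicOpen r = Z.basicOpen (f.appLE U ⊤ h r) := by
  rw [Scheme.preimage_basicOpen, Scheme.Hom.appLE, CommRingCat.comp_apply,
    Scheme.basicOpen_res, inf_eq_right.mpr le_top]

/-- A complex point of projective space is determined by its image. -/
theorem point_ext {f g : SpecC ⟶ ProjSpace ι} (hf : f ≫ ProjSpace.toSpecC ι = 𝟙 _)
    (hg : g ≫ ProjSpace.toSpecC ι = 𝟙 _) (H : f default = g default) : f = g := by
  obtain ⟨i, hi⟩ := exists_mem_preimage_chart f default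
  have hfi := top_le_of_mem f (U := ProjSpace.chart i) hi
  have hgi : ⊤ ≤ g ⁻¹ᵁ ProjSpace.chart i := top_le_of_mem g (x := default) (by rw [← H]; exact hi)
  refine hom_chart_ext f g i hfi hgi (hf.trans hg.symm) fun j => ?_
  obtain ⟨c, hc⟩ := scal_id_surjective (coord f i hfi j)
  -- With c the value of x_j / x_i at f, the function r vanishes at the common image point. Its
  -- pullback along g thus has empty basic open set in the reduced scheme Spec ℂ, so it is zero and
  -- g has the same coordinate.
  let r := ProjSpace.ratio i j - scal (ProjSpace.toSpecC ι) (ProjSpace.chart i) c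
  have h1 : f.appLE (ProjSpace.chart i) ⊤ hfi r = coord f i hfi j - scal (𝟙 SpecC) ⊤ c := by
    rw [map_sub, appLE_scal, hf]; rfl
  have h2 : g.appLE (ProjSpace.chart i) ⊤ hgi r = coord g i hgi j - scal (𝟙 SpecC) ⊤ c := by
    rw [map_sub, appLE_scal, hg]; rfl
  have h3 : f default ∉ (ProjSpace ι).basicOpen r := by
    intro h
    have h' : (default : SpecC) ∈ f ⁻¹ᵁ (ProjSpace ι).basicOpen r := h
    rw [preimage_basicOpen_appLE f _ hfi, h1, hc, sub_self, Scheme.basicOpen_zero] at h'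
    exact h'
  have h4 : SpecC.basicOpen (g.appLE (ProjSpace.chart i) ⊤ hgi r) = ⊥ := by
    rw [← preimage_basicOpen_appLE g _ hgi, eq_bot_iff]
    intro x hx
    rw [Subsingleton.elim x default] at hx
    exact h3 (by rw [H]; exact hx)
  rw [basicOpen_eq_bot_iff, h2, hc, sub_eq_zero] at h4
  exact h4.symm

end Points

/-! ### The Segre embedding on closed points -/

section Segre
variable {X Y : Scheme.{0}} {πX : X ⟶ SpecC} {πY : Y ⟶ SpecC} {ι κ : Type}

variable (πX πY) in
/-- `ψ` is the composition of `φ × χ` with the Segre embedding. -/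
structure IsSegre (φ : X ⟶ ProjSpace ι) (χ : Y ⟶ ProjSpace κ)
    (ψ : prod πX πY ⟶ ProjSpace (ι × κ)) : Prop where
  comp_fst : φ ≫ ProjSpace.toSpecC ι = πX
  comp_snd : χ ≫ ProjSpace.toSpecC κ = πY
  comp : ψ ≫ ProjSpace.toSpecC (ι × κ) = prodToSpecC πX πY
  preimage_chart : ∀ p, ψ ⁻¹ᵁ ProjSpace.chart p =
    rect πX πY (φ ⁻¹ᵁ ProjSpace.chart p.1) (χ ⁻¹ᵁ ProjSpace.chart p.2)
  appLE_ratio : ∀ p q hp, ψ.appLE (ProjSpace.chart p)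
    (rect πX πY (φ ⁻¹ᵁ ProjSpace.chart p.1) (χ ⁻¹ᵁ ProjSpace.chart p.2)) hp
      (ProjSpace.ratio p q) = prodRatio πX πY φ χ p q

variable {φ : X ⟶ ProjSpace ι} {χ : Y ⟶ ProjSpace κ} {ψ : prod πX πY ⟶ ProjSpace (ι × κ)}

theorem IsSegre.coord_eq (h : IsSegre πX πY φ χ ψ) {T : Scheme.{0}} (f : T ⟶ prod πX πY)
    (p q : ι × κ) (hp : ⊤ ≤ (f ≫ ψ) ⁻¹ᵁ ProjSpace.chart p)
    (h1 : ⊤ ≤ (f ≫ fst πX πY ≫ φ) ⁻¹ᵁ ProjSpace.chart p.1)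
    (h2 : ⊤ ≤ (f ≫ snd πX πY ≫ χ) ⁻¹ᵁ ProjSpace.chart p.2) :
    coord (f ≫ ψ) p hp q = coord (f ≫ fst πX πY ≫ φ) p.1 h1 q.1 *
      coord (f ≫ snd πX πY ≫ χ) p.2 h2 q.2 := by
  let R := rect πX πY (φ ⁻¹ᵁ ProjSpace.chart p.1) (χ ⁻¹ᵁ ProjSpace.chart p.2)
  have hR : ⊤ ≤ f ⁻¹ᵁ R := le_inf h1 h2
  have e1 := congrArg (f.appLE R ⊤ hR).hom (h.appLE_ratio p q (h.preimage_chart p).ge)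
  rw [prodRatio, map_mul] at e1
  have e2 := Scheme.Hom.appLE_comp_appLE f ψ (ProjSpace.chart p) R ⊤ (h.preimage_chart p).ge hR
  have e3 : coord (f ≫ ψ) p hp q = (f.appLE R ⊤ hR).hom
      (ψ.appLE (ProjSpace.chart p) R (h.preimage_chart p).ge (ProjSpace.ratio p q)) :=
    (ConcreteCategory.congr_hom e2 (ProjSpace.ratio p q)).symm
  refine e3.trans (e1.trans (congrArg₂ (· * ·) ?_ ?_))
  · have e4 := Scheme.Hom.comp_appLE f (fst πX πY ≫ φ) (ProjSpace.chart p.1) ⊤ h1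
    have e5 := f.map_appLE hR (homOfLE (rect_le_fst πX πY _ _)).op
    rw [coord, e4, Scheme.Hom.comp_app]
    exact ConcreteCategory.congr_hom e5 _
  · have e4 := Scheme.Hom.comp_appLE f (snd πX πY ≫ χ) (ProjSpace.chart p.2) ⊤ h2
    have e5 := f.map_appLE hR (homOfLE (rect_le_snd πX πY _ _)).op
    rw [coord, e4, Scheme.Hom.comp_app]
    exact ConcreteCategory.congr_hom e5 _

theorem IsSegre.mem_chart_iff (h : IsSegre πX πY φ χ ψ) (f : SpecC ⟶ prod πX πY) (p : ι × κ) :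
    ⊤ ≤ (f ≫ ψ) ⁻¹ᵁ ProjSpace.chart p ↔
      ⊤ ≤ (f ≫ fst πX πY ≫ φ) ⁻¹ᵁ ProjSpace.chart p.1 ∧
        ⊤ ≤ (f ≫ snd πX πY ≫ χ) ⁻¹ᵁ ProjSpace.chart p.2 := by
  have : (f ≫ ψ) ⁻¹ᵁ ProjSpace.chart p = f ⁻¹ᵁ (ψ ⁻¹ᵁ ProjSpace.chart p) := rfl
  rw [this, h.preimage_chart]
  exact ⟨fun h => ⟨h.trans (preimage_mono f (rect_le_fst πX πY _ _)),
    h.trans (preimage_mono f (rect_le_snd πX πY _ _))⟩, fun h => le_inf h.1 h.2⟩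

/-- Injectivity of the Segre map on complex points. In the chart (i, j) the coordinate with index
(k, j) is (x_k / x_i)(y_j / y_j) = x_k / x_i, and (i, l) recovers y_l / y_j in the same way. -/
theorem IsSegre.comp_eq_iff (h : IsSegre πX πY φ χ ψ) {f g : SpecC ⟶ prod πX πY}
    (hf : f ≫ prodToSpecC πX πY = 𝟙 _) (hg : g ≫ prodToSpecC πX πY = 𝟙 _) :
    f ≫ ψ = g ≫ ψ ↔ f ≫ fst πX πY ≫ φ = g ≫ fst πX πY ≫ φ ∧
      f ≫ snd πX πY ≫ χ = g ≫ snd πX πY ≫ χ := by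
  obtain ⟨i, hi⟩ := exists_mem_preimage_chart (f ≫ fst πX πY ≫ φ) default
  obtain ⟨j, hj⟩ := exists_mem_preimage_chart (f ≫ snd πX πY ≫ χ) default
  have fi := top_le_of_mem _ (U := ProjSpace.chart i) hi
  have fj := top_le_of_mem _ (U := ProjSpace.chart j) hj
  have fp := (h.mem_chart_iff f (i, j)).mpr ⟨fi, fj⟩
  constructor
  · intro e
    have gp : ⊤ ≤ (g ≫ ψ) ⁻¹ᵁ ProjSpace.chart (i, j) := by rw [← e]; exact fp
    obtain ⟨gi, gj⟩ := (h.mem_chart_iff g (i, j)).mp gp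
    have self {κ : Type} (f : SpecC ⟶ ProjSpace κ) (i : κ) (h) : coord f i h i = 1 := by
      rw [coord, ratio_self, map_one]
    have e' (q : ι × κ) : coord (f ≫ ψ) (i, j) fp q = coord (g ≫ ψ) (i, j) gp q := by
      simp only [e]
    refine ⟨hom_chart_ext _ _ i fi gi ?_ fun k => ?_, hom_chart_ext _ _ j fj gj ?_ fun l => ?_⟩
    · simp only [Category.assoc, h.comp_fst, hf, hg]
    · have := e' (k, j)
      rwa [h.coord_eq f _ _ fp fi fj, h.coord_eq g _ _ gp gi gj, self, self, mul_one, mul_one]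
        at this
    · simp only [Category.assoc, h.comp_snd]
      rw [← Limits.pullback.condition, hf, hg]
    · have := e' (i, l)
      rwa [h.coord_eq f _ _ fp fi fj, h.coord_eq g _ _ gp gi gj, self, self, one_mul, one_mul]
        at this
  · rintro ⟨e1, e2⟩
    have gi : ⊤ ≤ (g ≫ fst πX πY ≫ φ) ⁻¹ᵁ ProjSpace.chart i := by rw [← e1]; exact fi
    have gj : ⊤ ≤ (g ≫ snd πX πY ≫ χ) ⁻¹ᵁ ProjSpace.chart j := by rw [← e2]; exact fj
    have gp := (h.mem_chart_iff g (i, j)).mpr ⟨gi, gj⟩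
    refine hom_chart_ext _ _ (i, j) fp gp ?_ fun q => ?_
    · rw [Category.assoc, h.comp, Category.assoc, h.comp, hf, hg]
    · rw [h.coord_eq f _ _ fp fi fj, h.coord_eq g _ _ gp gi gj]
      simp only [e1, e2]

variable [LocallyOfFiniteType πX] [LocallyOfFiniteType πY]

theorem exists_point {Z : Scheme.{0}} (π : Z ⟶ SpecC) [LocallyOfFiniteType π] {z : Z}
    (hz : IsClosed {z}) : ∃ f : SpecC ⟶ Z, f ≫ π = 𝟙 _ ∧ f default = z :=
  ⟨pointOfClosedPoint π z hz, pointOfClosedPoint_comp π z hz, pointOfClosedPoint_apply π z hz _⟩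

theorem isClosed_point {Z : Scheme.{0}} (π : Z ⟶ SpecC) [LocallyOfFiniteType π] (f : SpecC ⟶ Z)
    (hf : f ≫ π = 𝟙 _) : IsClosed {f default} := by
  have := (pointEquivClosedPoint π ⟨f, hf⟩).2
  rwa [pointEquivClosedPoint_apply_coe, Subsingleton.elim (IsLocalRing.closedPoint ℂ) default] at this

/-- Closed points are complex points, and complex points of the product are pairs of complex points.
-/
theorem exists_closed_pair {x : X} {y : Y} (hx : IsClosed {x}) (hy : IsClosed {y}) :
    ∃ z : prod πX πY, IsClosed {z} ∧ fst πX πY z = x ∧ snd πX πY z = y := by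
  obtain ⟨f, hf, rfl⟩ := exists_point πX hx
  obtain ⟨g, hg, rfl⟩ := exists_point πY hy
  let k : SpecC ⟶ prod πX πY := Limits.pullback.lift f g (hf.trans hg.symm)
  have hk : k ≫ prodToSpecC πX πY = 𝟙 _ := by
    rw [← Category.assoc, Limits.pullback.lift_fst, hf]
  refine ⟨k default, isClosed_point (prodToSpecC πX πY) k hk, ?_, ?_⟩
  · rw [← Scheme.Hom.comp_apply, Limits.pullback.lift_fst]
  · rw [← Scheme.Hom.comp_apply, Limits.pullback.lift_snd]

theorem IsSegre.apply_eq_iff (h : IsSegre πX πY φ χ ψ) {z z' : prod πX πY} (hz : IsClosed {z})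
    (hz' : IsClosed {z'}) :
    ψ z = ψ z' ↔ φ (fst πX πY z) = φ (fst πX πY z') ∧ χ (snd πX πY z) = χ (snd πX πY z') := by
  obtain ⟨f, hf, rfl⟩ := exists_point (prodToSpecC πX πY) hz
  obtain ⟨g, hg, rfl⟩ := exists_point (prodToSpecC πX πY) hz'
  have ext {κ : Type} {a b : SpecC ⟶ ProjSpace κ} (ha : a ≫ ProjSpace.toSpecC κ = 𝟙 _)
      (hb : b ≫ ProjSpace.toSpecC κ = 𝟙 _) : a default = b default ↔ a = b :=
    ⟨point_ext ha hb, fun e => by rw [e]⟩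
  simp only [← Scheme.Hom.comp_apply]
  rw [ext, ext, ext, h.comp_eq_iff hf hg] <;>
    simp only [Category.assoc, h.comp, h.comp_fst, h.comp_snd, hf, hg,
      ← Limits.pullback.condition]

end Segre
end
end Lef

namespace Lef
noncomputable section
open Opposite TopologicalSpace

/-! ### Dimension of unions; semi-small morphisms from surfaces -/

section Union
variable {α : Type} [TopologicalSpace α]

theorem HasChain.of_isClosed {S F : Set α} (hF : IsClosed F) {n : ℕ} {x : α} (hx : x ∈ F)
    (h : HasChain S n x) : HasChain F n x := by
  induction n generalizing x with
  | zero => exact hx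
  | succ n ih =>
    obtain ⟨-, y, hxy, hyx, hy⟩ := h
    exact ⟨hx, y, hxy, hyx, ih (hxy.mem_closed hF hx) hy⟩

/-- A chain of specializations stays in whichever of the two closed sets contains its first point.
-/
theorem topologicalKrullDim_union_le [QuasiSober α] {F G : Set α} (hF : IsClosed F)
    (hG : IsClosed G) {d : WithBot ℕ∞} (h1 : topologicalKrullDim F ≤ d)
    (h2 : topologicalKrullDim G ≤ d) : topologicalKrullDim ↑(F ∪ G) ≤ d := by
  have : QuasiSober F := hF.isClosedEmbedding_subtypeVal.quasiSober
  have : QuasiSober G := hG.isClosedEmbedding_subtypeVal.quasiSober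
  have : QuasiSober ↑(F ∪ G) := (hF.union hG).isClosedEmbedding_subtypeVal.quasiSober
  refine le_of_forall_natCast_le fun n hn => ?_
  obtain ⟨x, hx⟩ := le_topologicalKrullDim_subtype_iff.mp hn
  rcases hx.mem with h | h
  · exact (le_topologicalKrullDim_subtype_iff.mpr ⟨x, hx.of_isClosed hF h⟩).trans h1
  · exact (le_topologicalKrullDim_subtype_iff.mpr ⟨x, hx.of_isClosed hG h⟩).trans h2

theorem isClosed_of_finite {S : Set α} (hS : S.Finite) (h : ∀ x ∈ S, IsClosed {x}) :
    IsClosed S := by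
  rw [← S.biUnion_of_singleton]
  exact hS.isClosed_biUnion h

theorem topologicalKrullDim_nonneg {S : Set α} (h : S.Nonempty) : 0 ≤ topologicalKrullDim S := by
  have : Nonempty S := h.to_subtype
  have : Nonempty (IrreducibleCloseds S) := ⟨irredClosure (Classical.arbitrary S)⟩
  exact Order.krullDim_nonneg

theorem topologicalKrullDim_eq_bot {S : Set α} (h : S = ∅) : topologicalKrullDim S = ⊥ := by
  have : IsEmpty S := Set.isEmpty_coe_sort.mpr h
  have : IsEmpty (IrreducibleCloseds S) :=
    ⟨fun Z => isEmptyElim Z.isIrreducible.nonempty.some⟩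
  exact Order.krullDim_eq_bot

end Union

section Image
variable {X Z : Scheme.{0}} (f : X ⟶ Z)

theorem imageι_toImage_apply (x : X) : f.imageι (f.toImage x) = f x := by
  rw [← Scheme.Hom.comp_apply, Scheme.Hom.toImage_imageι]

theorem preimage_toImage (w : f.image) : f.toImage ⁻¹' {w} = f ⁻¹' {f.imageι w} := by
  ext x
  rw [Set.mem_preimage, Set.mem_preimage, Set.mem_singleton_iff, Set.mem_singleton_iff,
    ← imageι_toImage_apply f x]
  exact f.imageι.isClosedEmbedding.injective.eq_iff.symm

theorem isClosed_singleton_imageι (w : f.image) : IsClosed {f.imageι w} ↔ IsClosed {w} := by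
  rw [f.imageι.isClosedEmbedding.isClosed_iff_image_isClosed, Set.image_singleton]

theorem isProper_toImage [IsProper f] : IsProper f.toImage := by
  have : IsProper (f.toImage ≫ f.imageι) := by rw [Scheme.Hom.toImage_imageι]; infer_instance
  exact IsProper.of_comp f.toImage f.imageι

theorem surjective_toImage [IsProper f] : Surjective f.toImage := by
  have := isProper_toImage f
  refine ⟨fun w => ?_⟩
  have h : IsClosed (Set.range f.toImage) := f.toImage.isClosedMap.isClosed_range
  have h2 := f.toImage.denseRange.closure_range
  rw [h.closure_eq] at h2
  rw [← Set.mem_range, h2]; trivial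

variable {f}

/-- If the fibre has dimension k, the corresponding locus is nonempty, so 0 + 2k ≤ 2. -/
theorem IsSemiSmall.fiber_dim (h : IsSemiSmall f.toImage) (hd : topologicalKrullDim X = 2) {x : X}
    (hx : IsClosed {f x}) : topologicalKrullDim ↑(f ⁻¹' {f x}) = 0 ∨
      topologicalKrullDim ↑(f ⁻¹' {f x}) = 1 := by
  have h0 : 0 ≤ topologicalKrullDim ↑(f ⁻¹' {f x}) := topologicalKrullDim_nonneg ⟨x, rfl⟩
  have h2 : topologicalKrullDim ↑(f ⁻¹' {f x}) ≤ 2 := (topologicalKrullDim_subspace_le X _).trans hd.le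
  obtain ⟨k, hk⟩ : ∃ k : ℕ, topologicalKrullDim ↑(f ⁻¹' {f x}) = k := by
    generalize topologicalKrullDim ↑(f ⁻¹' {f x}) = a at h0 h2
    induction a using WithBot.recBotCoe with
    | bot => simp at h0
    | coe a =>
      induction a using ENat.recTopCoe with
      | top => exact absurd (WithBot.coe_le_coe.mp h2) (by decide)
      | coe a => exact ⟨a, rfl⟩
  have h3 := h.dim_le k
  have h4 : 0 ≤ topologicalKrullDim ↑(fiberDimLocus f.toImage k) := by
    refine topologicalKrullDim_nonneg ⟨f.toImage x, ?_, ?_⟩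
    · rwa [← isClosed_singleton_imageι, imageι_toImage_apply]
    · rwa [preimage_toImage, imageι_toImage_apply]
  have h5 := (add_le_add_left h4 ((2 * k : ℕ) : WithBot ℕ∞)).trans h3
  rw [hd, zero_add] at h5
  have h6 : 2 * k ≤ 2 := by exact_mod_cast h5
  rw [hk]
  have : k = 0 ∨ k = 1 := by omega
  rcases this with rfl | rfl <;> simp

/-- A finite set of closed points meeting all the one-dimensional fibres of a semi-small morphism
from a surface. -/
theorem IsSemiSmall.exists_finite (h : IsSemiSmall f.toImage) (hd : topologicalKrullDim X = 2)
    [NoetherianSpace X] [IsProper f] : ∃ S : Set X, S.Finite ∧ (∀ x ∈ S, IsClosed {x}) ∧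
      ∀ x : X, IsClosed {f x} → topologicalKrullDim ↑(f ⁻¹' {f x}) = 1 →
        ∃ y ∈ S, f y = f x := by
  have h1 : NoetherianSpace f.image := by
    rw [← noetherian_univ_iff, ← (surjective_toImage f).surj.range_eq]
    exact NoetherianSpace.range _ f.toImage.continuous
  have h2 : topologicalKrullDim ↑(fiberDimLocus f.toImage 1) ≤ 0 := by
    have := h.dim_le 1
    rw [hd] at this
    generalize topologicalKrullDim ↑(fiberDimLocus f.toImage 1) = a at this
    induction a using WithBot.recBotCoe with
    | bot => simp
    | coe a =>
      induction a using ENat.recTopCoe with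
      | top => exact absurd (WithBot.coe_le_coe.mp this) (by decide)
      | coe a =>
        have h6 : (a : ℕ∞) + ((2 * 1 : ℕ) : ℕ∞) ≤ 2 := WithBot.coe_le_coe.mp this
        have h7 : a + 2 * 1 ≤ 2 := by exact_mod_cast h6
        have : a = 0 := by omega
        simp [this]
  have h3 := finite_of_topologicalKrullDim_le_zero (fun x hx => hx.1) h2
  -- One closed point is chosen in each one-dimensional fibre. Keeping the whole fibres would give a
  -- one-dimensional set, too large for the later estimates.
  have h4 (w : fiberDimLocus f.toImage 1) : ∃ y : X, IsClosed {y} ∧ f.toImage y = w := by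
    obtain ⟨x, hx⟩ := (surjective_toImage f).surj w
    obtain ⟨y, hy, hy'⟩ := (w.2.1.preimage f.toImage.continuous).exists_closed_singleton ⟨x, hx⟩
    exact ⟨y, hy', hy⟩
  choose g hg using h4
  have := h3.to_subtype
  refine ⟨Set.range g, Set.finite_range g, ?_, fun x hx hx1 => ?_⟩
  · rintro _ ⟨w, rfl⟩
    exact (hg w).1
  · have hw : f.toImage x ∈ fiberDimLocus f.toImage 1 := by
      refine ⟨?_, ?_⟩
      · rwa [← isClosed_singleton_imageι, imageι_toImage_apply]
      · rw [preimage_toImage, imageι_toImage_apply]; exact_mod_cast hx1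
    refine ⟨_, ⟨⟨_, hw⟩, rfl⟩, ?_⟩
    rw [← imageι_toImage_apply, (hg _).2, imageι_toImage_apply]

end Image

/-! ### Semi-smallness of the product morphism -/

section SemiSmall
variable {X Y : Scheme.{0}} {πX : X ⟶ SpecC} {πY : Y ⟶ SpecC} {ι κ : Type}
  {φ : X ⟶ ProjSpace ι} {χ : Y ⟶ ProjSpace κ} {ψ : prod πX πY ⟶ ProjSpace (ι × κ)}

/-- Only separatedness of the target is used, so no finiteness of the index set of coordinates is
needed. -/
theorem isProper_of_comp_toSpecC {Z : Scheme.{0}} {π : Z ⟶ SpecC} [IsProper π]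
    {f : Z ⟶ ProjSpace ι} (h : f ≫ ProjSpace.toSpecC ι = π) : IsProper f := by
  have := isSeparated_toSpecC ι
  have : IsProper (f ≫ ProjSpace.toSpecC ι) := by rw [h]; infer_instance
  exact IsProper.of_comp f (ProjSpace.toSpecC ι)

theorem compactSpace_of_isProper {Z : Scheme.{0}} (π : Z ⟶ SpecC) [IsProper π] :
    CompactSpace Z := QuasiCompact.compactSpace_of_compactSpace π

theorem noetherianSpace_of_isProper {Z : Scheme.{0}} (π : Z ⟶ SpecC) [IsProper π] :
    NoetherianSpace Z := by
  have := compactSpace_of_isProper π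
  have := LocallyOfFiniteType.isLocallyNoetherian π
  have : IsNoetherian Z := {}
  infer_instance

/-- For closed points this is `IsSegre.apply_eq_iff`. The product is a Jacobson space, so closed
points are dense in the fibre, and the right-hand side is closed. -/
theorem IsSegre.preimage_singleton_subset [IsProper πX] [IsProper πY] (h : IsSegre πX πY φ χ ψ)
    {z : prod πX πY} (hz : IsClosed {z}) :
    ψ ⁻¹' {ψ z} ⊆ fst πX πY ⁻¹' (φ ⁻¹' {φ (fst πX πY z)}) ∩
      snd πX πY ⁻¹' (χ ⁻¹' {χ (snd πX πY z)}) := by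
  have := isProper_of_comp_toSpecC h.comp_fst
  have := isProper_of_comp_toSpecC h.comp_snd
  have := isProper_of_comp_toSpecC h.comp
  have cl {A B : Scheme.{0}} (f : A ⟶ B) [IsProper f] {a : A} (ha : IsClosed {a}) :
      IsClosed {f a} := by
    rw [← Set.image_singleton]; exact f.isClosedMap _ ha
  have : JacobsonSpace ↥(prod πX πY) := LocallyOfFiniteType.jacobsonSpace (prodToSpecC πX πY)
  have h1 : IsClosed (ψ ⁻¹' {ψ z}) := (cl ψ hz).preimage ψ.continuous
  have h2 := (cl φ (cl (fst πX πY) hz)).preimage φ.continuous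
  have h3 := (cl χ (cl (snd πX πY) hz)).preimage χ.continuous
  rw [← JacobsonSpace.closure_inter_closedPoints h1]
  refine closure_minimal ?_ ((h2.preimage (fst πX πY).continuous).inter
    (h3.preimage (snd πX πY).continuous))
  rintro y ⟨hy, hy'⟩
  exact (h.apply_eq_iff hy' hz).mp hy

theorem IsSegre.isSemiSmall [IsProper πX] [IsProper πY] (h : IsSegre πX πY φ χ ψ)
    (hX : topologicalKrullDim X = 2) (hY : topologicalKrullDim Y = 2)
    (hφ : IsSemiSmall φ.toImage) (hχ : IsSemiSmall χ.toImage) : IsSemiSmall ψ.toImage := by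
  have := isProper_of_comp_toSpecC h.comp_fst
  have := isProper_of_comp_toSpecC h.comp_snd
  have := isProper_of_comp_toSpecC h.comp
  have := compactSpace_of_isProper (prodToSpecC πX πY)
  have := noetherianSpace_of_isProper πX
  have := noetherianSpace_of_isProper πY
  have := isProper_toImage ψ
  have cl {A B : Scheme.{0}} (f : A ⟶ B) [IsProper f] {a : A} (ha : IsClosed {a}) :
      IsClosed {f a} := by
    rw [← Set.image_singleton]; exact f.isClosedMap _ ha
  refine ⟨this, surjective_toImage ψ, fun k => ?_⟩
  obtain ⟨S, hS, hSc, hS1⟩ := hφ.exists_finite hX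
  obtain ⟨T, hT, hTc, hT1⟩ := hχ.exists_finite hY
  have hScl := isClosed_of_finite hS hSc
  have hTcl := isClosed_of_finite hT hTc
  have hS0 := topologicalKrullDim_le_zero_of_finite hS hSc
  have hT0 := topologicalKrullDim_le_zero_of_finite hT hTc
  have hSE := hScl.preimage (fst πX πY).continuous
  have hTE := hTcl.preimage (snd πX πY).continuous
  have hdim : ((2 + 2 : ℕ) : WithBot ℕ∞) ≤ topologicalKrullDim (prod πX πY) :=
    le_topologicalKrullDim_prod πX πY hX.ge hY.ge
  have key (w : ψ.image) (hw : w ∈ fiberDimLocus ψ.toImage k) : ∃ z : prod πX πY,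
      IsClosed {z} ∧ ψ z = ψ.imageι w ∧ (k : WithBot ℕ∞) ≤
        topologicalKrullDim ↑(φ ⁻¹' {φ (fst πX πY z)}) +
          topologicalKrullDim ↑(χ ⁻¹' {χ (snd πX πY z)}) := by
    obtain ⟨x, hx⟩ := (surjective_toImage ψ).surj w
    obtain ⟨z, hz, hz'⟩ :=
      (hw.1.preimage ψ.toImage.continuous).exists_closed_singleton ⟨x, hx⟩
    have e : ψ z = ψ.imageι w := by
      rw [← imageι_toImage_apply]; exact congrArg _ hz
    refine ⟨z, hz', e, ?_⟩
    rw [← hw.2, preimage_toImage, ← e]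
    exact (topologicalKrullDim_subset_le (h.preimage_singleton_subset hz')).trans
      (topologicalKrullDim_inter_le πX πY
        ((cl φ (cl (fst πX πY) hz')).preimage φ.continuous)
        ((cl χ (cl (snd πX πY) hz')).preimage χ.continuous))
  have image_le {E : Set ↥(prod πX πY)} (hE : IsClosed E)
      (hL : fiberDimLocus ψ.toImage k ⊆ ψ.toImage '' E) :
      topologicalKrullDim ↑(fiberDimLocus ψ.toImage k) ≤ topologicalKrullDim E :=
    (topologicalKrullDim_subset_le hL).trans
      (topologicalKrullDim_image_le ψ.toImage.continuous ψ.toImage.isClosedMap hE)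
  -- The projections of z may be replaced by other closed points of their fibres under φ and χ
  -- without changing the image under ψ. This moves z onto S or T.
  have move {z : prod πX πY} (hz : IsClosed {z}) {w} (e : ψ z = ψ.imageι w) {x : X} {y : Y}
      (hx : IsClosed {x}) (hy : IsClosed {y}) (ex : φ x = φ (fst πX πY z))
      (ey : χ y = χ (snd πX πY z)) :
      ∃ z', fst πX πY z' = x ∧ snd πX πY z' = y ∧ ψ.toImage z' = w := by
    obtain ⟨z', hz', rfl, rfl⟩ := exists_closed_pair (πX := πX) (πY := πY) hx hy
    refine ⟨z', rfl, rfl, ψ.imageι.isClosedEmbedding.injective ?_⟩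
    rw [imageι_toImage_apply, ← e]
    exact (h.apply_eq_iff hz' hz).mpr ⟨ex, ey⟩
  have fX {z : prod πX πY} (hz : IsClosed {z}) := hφ.fiber_dim hX (cl φ (cl (fst πX πY) hz))
  have fY {z : prod πX πY} (hz : IsClosed {z}) := hχ.fiber_dim hY (cl χ (cl (snd πX πY) hz))
  obtain rfl | rfl | rfl | hk : k = 0 ∨ k = 1 ∨ k = 2 ∨ 3 ≤ k := by omega
  · rw [mul_zero, Nat.cast_zero, add_zero]
    refine (image_le isClosed_univ ?_).trans (topologicalKrullDim_subspace_le _ _)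
    rw [Set.image_univ, (surjective_toImage ψ).surj.range_eq]
    exact Set.subset_univ _
  -- For k = 1 at least one factor fibre is one-dimensional, so the locus is covered by the image of
  -- S × Y ∪ X × T, of dimension at most 2, and 2 + 2 ≤ 4.
  · refine le_trans (add_le_add_left ((image_le (hSE.union hTE) ?_).trans
      (topologicalKrullDim_union_le (d := 2) hSE hTE ?_ ?_)) _) hdim
    · intro w hw
      obtain ⟨z, hz, e, hzk⟩ := key w hw
      have hzx := cl (fst πX πY) hz
      have hzy := cl (snd πX πY) hz
      rcases fX hz with h0 | h1
      · rcases fY hz with h0' | h1'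
        · rw [h0, h0'] at hzk
          exact absurd hzk (by decide)
        · obtain ⟨y, hy, ey⟩ := hT1 _ (cl χ hzy) h1'
          obtain ⟨z', -, rfl, hz'⟩ := move hz e hzx (hTc y hy) rfl ey
          exact ⟨z', Or.inr hy, hz'⟩
      · obtain ⟨x, hx, ex⟩ := hS1 _ (cl φ hzx) h1
        obtain ⟨z', rfl, -, hz'⟩ := move hz e (hSc x hx) hzy ex rfl
        exact ⟨z', Or.inl hx, hz'⟩
    · have := topologicalKrullDim_inter_le πX πY hScl (isClosed_univ (X := Y))
      rw [Set.preimage_univ, Set.inter_univ] at this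
      refine this.trans ((add_le_add hS0 ((topologicalKrullDim_subspace_le Y _).trans hY.le)).trans ?_)
      rw [zero_add]
    · have := topologicalKrullDim_inter_le πX πY (isClosed_univ (X := X)) hTcl
      rw [Set.preimage_univ, Set.univ_inter] at this
      refine this.trans ((add_le_add ((topologicalKrullDim_subspace_le X _).trans hX.le) hT0).trans ?_)
      rw [add_zero]
  -- For k = 2 both factor fibres must be one-dimensional, so the locus is covered by the image of S
  -- × T, of dimension at most 0, and 0 + 4 ≤ 4.
  · refine le_trans (add_le_add_left ((image_le (hSE.inter hTE) ?_).trans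
      ((topologicalKrullDim_inter_le πX πY hScl hTcl).trans (add_le_add hS0 hT0))) _) ?_
    · intro w hw
      obtain ⟨z, hz, e, hzk⟩ := key w hw
      have hzx := cl (fst πX πY) hz
      have hzy := cl (snd πX πY) hz
      have h1 : topologicalKrullDim ↑(φ ⁻¹' {φ (fst πX πY z)}) = 1 := by
        refine (fX hz).resolve_left fun h0 => ?_
        rcases fY hz with h' | h' <;> rw [h0, h'] at hzk <;> exact absurd hzk (by decide)
      have h1' : topologicalKrullDim ↑(χ ⁻¹' {χ (snd πX πY z)}) = 1 := by
        refine (fY hz).resolve_left fun h0 => ?_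
        rw [h1, h0] at hzk; exact absurd hzk (by decide)
      obtain ⟨x, hx, ex⟩ := hS1 _ (cl φ hzx) h1
      obtain ⟨y, hy, ey⟩ := hT1 _ (cl χ hzy) h1'
      obtain ⟨z', rfl, rfl, hz'⟩ := move hz e (hSc x hx) (hTc y hy) ex ey
      exact ⟨z', ⟨hx, hy⟩, hz'⟩
    · rw [add_zero, zero_add]; exact hdim
  -- For k ≥ 3 the locus is empty, because fibre dimensions add up to at most 1 + 1.
  · rw [topologicalKrullDim_eq_bot, WithBot.bot_add]
    · exact bot_le
    refine Set.eq_empty_of_forall_notMem fun w hw => ?_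
    obtain ⟨z, hz, e, hzk⟩ := key w hw
    have h3 : ((3 : ℕ) : WithBot ℕ∞) ≤ k := by exact_mod_cast hk
    replace hzk := h3.trans hzk
    rcases fX hz with h0 | h0 <;> rcases fY hz with h' | h' <;> rw [h0, h'] at hzk <;>
      exact absurd hzk (by decide)

end SemiSmall

/-! ### Lef line bundles and the exponent -/

section Lef
variable {X Y : Scheme.{0}} {πX : X ⟶ SpecC} {πY : Y ⟶ SpecC}

theorem isLefAt_one_of_lefExponent_eq {M : X.Modules} (h : lefExponent πX M = 1) :
    IsLefAt πX M 1 := by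
  have : (1 : ℕ) ∈ {n : ℕ | 0 < n ∧ IsLefAt πX M n} := by
    rw [← h]
    -- The infimum of the empty set of naturals is 0, so an exponent equal to 1 is really attained.
    refine Nat.sInf_mem (Set.nonempty_iff_ne_empty.mpr fun h0 => ?_)
    rw [lefExponent, h0, Nat.sInf_empty] at h
    exact zero_ne_one h
  exact this.2

theorem lefExponent_eq_one {M : X.Modules} (h : IsLefAt πX M 1) : lefExponent πX M = 1 :=
  le_antisymm (Nat.sInf_le ⟨one_pos, h⟩)
    (Nat.sInf_mem (s := {n : ℕ | 0 < n ∧ IsLefAt πX M n}) ⟨1, one_pos, h⟩).1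

/-- The first tensor power is the sheaf itself by definition, so the data at n = 1 concern M, N and
their external product directly. -/
theorem isLefAt_one_externalTensor (hX : IsNonsingularProjectiveSurface πX)
    (hY : IsNonsingularProjectiveSurface πY) {M : X.Modules} {N : Y.Modules}
    (hM : IsLefAt πX M 1) (hN : IsLefAt πY N 1) :
    IsLineBundle (externalTensor πX πY M N) ∧
      IsLefAt (prodToSpecC πX πY) (externalTensor πX πY M N) 1 := by
  obtain ⟨-, ι, s, φ, hs, hφ, hφs⟩ := hM
  obtain ⟨-, κ, t, χ, ht, hχ, hχs⟩ := hN
  have := hX.isProper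
  have := hY.isProper
  have := compactSpace_of_isProper πX
  have := compactSpace_of_isProper πY
  obtain ⟨ψ, hψ, hchart, hratio⟩ := exists_isMorphismOfSections hφ hχ
  have hS : IsSegre πX πY φ χ ψ :=
    ⟨hφ.comp_toSpecC, hχ.comp_toSpecC, hψ.comp_toSpecC, hchart, hratio⟩
  refine ⟨isLineBundle_of_isGenerator hψ.exists_generator, ?_, ι × κ,
    fun p : ι × κ => boxTop πX πY (s p.1) (t p.2), ψ,
    isSectionBasis_boxTop πX πY hφ.exists_generator hχ.exists_generator hs ht, hψ,
    hS.isSemiSmall hX.dim_eq hY.dim_eq hφs hχs⟩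
  refine isGloballyGenerated_of_nonvanishing (fun p : ι × κ => boxTop πX πY (s p.1) (t p.2)) fun x => ?_
  obtain ⟨i, hi⟩ := exists_mem_preimage_chart ψ x
  exact ⟨i, (hψ.preimage_chart i).subset hi⟩

end Lef
end
end Lef

theorem mainTheorem5 {X Y : Scheme.{0}} (πX : X ⟶ Lef.SpecC) (πY : Y ⟶ Lef.SpecC)
    (hX : Lef.IsNonsingularProjectiveSurface πX) (hY : Lef.IsNonsingularProjectiveSurface πY)
    (Γ : X.Modules) (B : Y.Modules)
    (hΓ : Lef.IsLef πX Γ) (hB : Lef.IsLef πY B)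
    (hΓ_exp : Lef.lefExponent πX Γ = 1) (hB_exp : Lef.lefExponent πY B = 1) :
    Lef.IsLef (Lef.prodToSpecC πX πY) (Lef.externalTensor πX πY Γ B) ∧
      Lef.lefExponent (Lef.prodToSpecC πX πY) (Lef.externalTensor πX πY Γ B) = 1 := by
  obtain ⟨h1, h2⟩ := Lef.isLefAt_one_externalTensor hX hY
    (Lef.isLefAt_one_of_lefExponent_eq hΓ_exp) (Lef.isLefAt_one_of_lefExponent_eq hB_exp)
  exact ⟨⟨h1, 1, one_pos, h2⟩, Lef.lefExponent_eq_one h2⟩
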